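/- **Theorem (consistency of the lag-window estimator).** Write $L^2=L^2([0,1])$, and $(f\otimes g)(t,t')=f(t)g(t')\in L^2([0,1]^2)$ for $f,g\in L^2$. *Model.* Let $X_i=\mu+\varepsilon_i$, $i\in\mathbb Z$, with $\mu\in L^2$ and $\mathbb E[\varepsilon_i]=0$, where $\varepsilon_i=g(\epsilon_i,\epsilon_{i-1},\ldots)$ for independent, identically distributed innovations $(\epsilon_i)_{i\in\mathbb Z}$ with values in a measurable space $S$ and a measurable $g:S^\infty\to L^2$. Let $\epsilon^*_{i,\ell,j}$ ($i,j\in\mathbb Z$, $\ell\ge 0$) be independent copies of $\epsilon_0$, independent of $(\epsilon_i)$, put $\varepsilon_{i,\ell}=g(\epsilon_i,\ldots,\epsilon_{i-\ell+1},\epsilon^*_{i,\ell,i-\ell},\epsilon^*_{i,\ell,i-\ell-1},\ldots)$, and suppose that for some $p>4$ $$\sum_{\ell=0}^\infty\big(\mathbb E\|\varepsilon_i-\varepsilon_{i,\ell}\|^p\big)^{1/p}<\infty .$$ Let $\lambda_1\ge\lambda_2\ge\cdots\ge0$ and $\varphi_1,\varphi_2,\ldots$ be the ordered eigenvalues and corresponding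 orthonormal eigenfunctions of the integral operator whose kernel is the covariance kernel $C(t,t')=\mathrm{Cov}(X_0(t),X_0(t'))$, and let $d\ge1$ be such that $\lambda_1>\cdots>\lambda_d>\lambda_{d+1}$. Set $$\theta_{i,j}=\langle\varepsilon_i\otimes\varepsilon_i-\mathbb E[\varepsilon_0\otimes\varepsilon_0],\varphi_j\otimes\varphi_j\rangle,\qquad \Sigma_d(j,j')=\sum_{i\in\mathbb Z}\mathrm{Cov}(\theta_{0,j},\theta_{i,j'}),\qquad 1\le j,j'\le d .$$ *Estimator.* Let $\bar X=\frac1n\sum_{i=1}^nX_i$ and $\hat C=\frac1n\sum_{i=1}^n(X_i-\bar X)\otimes(X_i-\bar X)$, let $\hat\varphi_1,\hat\varphi_2,\ldots$ be any choice of orthonormal eigenfunctions of the integral operator with kernel $\hat C$, ordered by decreasing eigenvalues, and set $\hat\theta_{i,j}=\langle(X_i-\bar X)\otimes(X_i-\bar X)-\hat C,\hat\varphi_j\otimes\hat\varphi_j\rangle$, $\hat{\boldsymbol\Theta}_i=(\hat\theta_{i,1},\ldots,\hat\theta_{i,d})^\top$, $\bar{\boldsymbol\Theta}=\frac1n\sum_{i=1}^n\hat{\boldsymbol\Theta}_i$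 and $$\hat\Sigma_d=\sum_{\ell\in\mathbb Z}w\Big(\frac{\ell}{h}\Big)\frac1n\sum_{i\in\mathcal I_\ell}\big(\hat{\boldsymbol\Theta}_i-\bar{\boldsymbol\Theta}\big)\big(\hat{\boldsymbol\Theta}_{i+\ell}-\bar{\boldsymbol\Theta}\big)^\top ,$$ where $\mathcal I_\ell=\{1,\ldots,n-\ell\}$ if $\ell\ge0$ and $\mathcal I_\ell=\{1-\ell,\ldots,n\}$ if $\ell<0$. Here $w:\mathbb R\to\mathbb R$ is continuous, $w(0)=1$, $w(-u)=w(u)$, $w\le1$, $w(u)=0$ for $|u|>m$ for some $m>0$, and for some $b>0$ the limit $\lim_{x\downarrow0}x^{-b}[1-w(x)]$ exists in $(0,\infty)$. The bandwidth $h=h(n)$ is positive for all large $n$ and satisfies $1/h(n)+h(n)/\sqrt n\to0$ as $n\to\infty$. *Conclusion.* The series defining $\Sigma_d(j,j')$ converge absolutely, and $|\Sigma_d-\hat\Sigma_d|_F\to0$ in probability as $n\to\infty$, where $|\cdot|_F$ is the Frobenius norm. -/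

import Mathlib

open MeasureTheory ProbabilityTheory Filter Topology

attribute [local instance] Matrix.frobeniusNormedAddCommGroup

noncomputable section

/-- The real Hilbert space `L²([0,1])`. -/
abbrev L2I : Type := Lp ℝ 2 (volume : Measure unitInterval)

/-- The real Hilbert space `L²([0,1]²)`. -/
abbrev L2II : Type :=
  Lp ℝ 2 ((volume : Measure unitInterval).prod (volume : Measure unitInterval))

instance instMeasurableSpaceL2I : MeasurableSpace L2I := borel L2I

instance instBorelSpaceL2I : BorelSpace L2I := ⟨rfl⟩

theorem memLp_tensor (f g : L2I) :
    MemLp (fun z : unitInterval × unitInterval => f z.1 * g z.2) 2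
      ((volume : Measure unitInterval).prod (volume : Measure unitInterval)) := by
  have hf := Lp.memLp f
  have hg := Lp.memLp g
  have hm : AEStronglyMeasurable (fun z : unitInterval × unitInterval => f z.1 * g z.2)
      ((volume : Measure unitInterval).prod (volume : Measure unitInterval)) :=
    hf.1.comp_fst.mul hg.1.comp_snd
  rw [memLp_two_iff_integrable_sq hm]
  have h := ((memLp_two_iff_integrable_sq hf.1).1 hf).mul_prod
    ((memLp_two_iff_integrable_sq hg.1).1 hg)
  simpa only [mul_pow] using h

/-- The tensor product `(f ⊗ g)(t, t') = f(t) g(t')` as an element of `L²([0,1]²)`. -/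
def tensorL2 (f g : L2I) : L2II := (memLp_tensor f g).toLp _

/-- The function `t ↦ ∫ K(t,t') f(t') dt'`. -/
def kernelApply (K : L2II) (f : L2I) : unitInterval → ℝ :=
  fun t => ∫ s, K (t, s) * f s

/-- `lam 0 ≥ lam 1 ≥ ⋯ ≥ 0` are the ordered eigenvalues (repeated according to multiplicity) of
the integral operator with kernel `K`, and `phi 0, phi 1, …` are corresponding orthonormal
eigenfunctions; the list is exhaustive, that is, the operator vanishes on the orthogonal
complement of all `phi j`. -/
structure IsEigenSystem (K : L2II) (lam : ℕ → ℝ) (phi : ℕ → L2I) : Prop where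
  orthonormal : Orthonormal ℝ phi
  antitone : Antitone lam
  nonneg : ∀ j, 0 ≤ lam j
  eigen : ∀ j, kernelApply K (phi j) =ᵐ[volume] fun t => lam j * phi j t
  exhaustive : ∀ f : L2I, (∀ j, inner ℝ (phi j) f = 0) → kernelApply K f =ᵐ[volume] 0

section Model

variable {Ω S : Type*}

/-- The Bernoulli shift `ε_i = g(ϵ_i, ϵ_{i-1}, …)`. -/
def bernoulliShift (g : (ℕ → S) → L2I) (e : ℤ → Ω → S) (i : ℤ) (ω : Ω) : L2I :=
  g fun k => e (i - k) ω

/-- The `ℓ`-dependent approximation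
`ε_{i,ℓ} = g(ϵ_i, …, ϵ_{i-ℓ+1}, ϵ*_{i,ℓ,i-ℓ}, ϵ*_{i,ℓ,i-ℓ-1}, …)`. -/
def coupledShift (g : (ℕ → S) → L2I) (e : ℤ → Ω → S) (es : ℤ → ℕ → ℤ → Ω → S)
    (i : ℤ) (l : ℕ) (ω : Ω) : L2I :=
  g fun k => if k < l then e (i - k) ω else es i l (i - k) ω

/-- `ϵ_i` (`i ∈ ℤ`) and `ϵ*_{i,ℓ,j}` are measurable, all have the same law, and all of them
together are independent. -/
structure IsInnovationSystem [MeasurableSpace Ω] [MeasurableSpace S] (P : Measure Ω)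
    (e : ℤ → Ω → S) (es : ℤ → ℕ → ℤ → Ω → S) : Prop where
  measurable : ∀ i, Measurable (e i)
  measurable_copy : ∀ i l j, Measurable (es i l j)
  identDistrib : ∀ i, IdentDistrib (e i) (e 0) P P
  identDistrib_copy : ∀ i l j, IdentDistrib (es i l j) (e 0) P P
  indep : iIndepFun (Sum.elim e fun k : ℤ × ℕ × ℤ => es k.1 k.2.1 k.2.2) P

/-- The covariance kernel `Cov(Y(t), Y(t'))` of a random element `Y` of `L²([0,1])`, as the
Bochner expectation of `(Y - E Y) ⊗ (Y - E Y)` in `L²([0,1]²)`. -/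
def covKernel [MeasurableSpace Ω] (P : Measure Ω) (Y : Ω → L2I) : L2II :=
  ∫ ω, tensorL2 (Y ω - ∫ ω', Y ω' ∂P) (Y ω - ∫ ω', Y ω' ∂P) ∂P

/-- The scores `θ_{i,j} = ⟨ε_i ⊗ ε_i - E[ε_0 ⊗ ε_0], φ_j ⊗ φ_j⟩`. -/
def score [MeasurableSpace Ω] (P : Measure Ω) (eps : ℤ → Ω → L2I) (phi : ℕ → L2I)
    (i : ℤ) (j : ℕ) (ω : Ω) : ℝ :=
  inner ℝ (tensorL2 (eps i ω) (eps i ω) - ∫ ω', tensorL2 (eps 0 ω') (eps 0 ω') ∂P)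
    (tensorL2 (phi j) (phi j))

/-- The long-run covariance matrix, `Σ_d(j,j') = ∑_{i ∈ ℤ} Cov(θ_{0,j}, θ_{i,j'})`. -/
def longRunCov [MeasurableSpace Ω] (P : Measure Ω) (eps : ℤ → Ω → L2I) (phi : ℕ → L2I)
    (d : ℕ) : Matrix (Fin d) (Fin d) ℝ :=
  Matrix.of fun j j' => ∑' i : ℤ, cov[score P eps phi 0 j, score P eps phi i j'; P]

end Model

/-- `n⁻¹ ∑_{i=1}^n x_i`. -/
def sampleMean {E : Type*} [AddCommGroup E] [Module ℝ E] (n : ℕ) (x : ℤ → E) : E :=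
  (n : ℝ)⁻¹ • ∑ i ∈ Finset.Icc (1 : ℤ) n, x i

/-- The sample covariance kernel `n⁻¹ ∑_{i=1}^n (x_i - x̄) ⊗ (x_i - x̄)`. -/
def sampleCov (n : ℕ) (x : ℤ → L2I) : L2II :=
  sampleMean n fun i => tensorL2 (x i - sampleMean n x) (x i - sampleMean n x)

/-- The estimated score vectors, with entries
`⟨(x_i - x̄) ⊗ (x_i - x̄) - Ĉ, φ̂_j ⊗ φ̂_j⟩`, `j = 1, …, d` (in code `0, …, d - 1`). -/
def scoreHat (n d : ℕ) (x : ℤ → L2I) (phiHat : ℕ → L2I) (i : ℤ) : Fin d → ℝ :=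
  fun j => inner ℝ (tensorL2 (x i - sampleMean n x) (x i - sampleMean n x) - sampleCov n x)
    (tensorL2 (phiHat j) (phiHat j))

/-- The index set of the pairs `(i, i + ℓ)` with both entries in `{1, …, n}`. -/
def lagIndex (n : ℕ) (l : ℤ) : Finset ℤ :=
  if 0 ≤ l then Finset.Icc 1 (n - l) else Finset.Icc (1 - l) n

/-- The lag-`ℓ` sample autocovariance `n⁻¹ ∑_{i ∈ I_ℓ} (y_i - ȳ)(y_{i+ℓ} - ȳ)ᵀ`. -/
def sampleAutocov {d : ℕ} (n : ℕ) (y : ℤ → Fin d → ℝ) (l : ℤ) : Matrix (Fin d) (Fin d) ℝ :=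
  (n : ℝ)⁻¹ • ∑ i ∈ lagIndex n l,
    Matrix.vecMulVec (y i - sampleMean n y) (y (i + l) - sampleMean n y)

/-- The kernel lag-window estimator `∑_{ℓ ∈ ℤ} w(ℓ/h) Γ̂_ℓ`; only finitely many terms are
non-zero, because `I_ℓ` is empty for `|ℓ| ≥ n`. -/
def lagWindowEstimator {d : ℕ} (w : ℝ → ℝ) (h : ℝ) (n : ℕ) (y : ℤ → Fin d → ℝ) :
    Matrix (Fin d) (Fin d) ℝ :=
  ∑' l : ℤ, w (l / h) • sampleAutocov n y l

/-- The standard conditions on the weight function of a lag-window estimator. Since the weight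
function is even, the limit that defines its order at zero is taken from the right. -/
structure IsLagWindow (w : ℝ → ℝ) : Prop where
  map_zero : w 0 = 1
  even : ∀ u, w (-u) = w u
  le_one : ∀ u, w u ≤ 1
  bounded_support : ∃ m : ℝ, 0 < m ∧ ∀ u, m < |u| → w u = 0
  continuous : Continuous w
  order : ∃ b : ℝ, 0 < b ∧ ∃ q : ℝ, 0 < q ∧
    Tendsto (fun x : ℝ => x ^ (-b) * (1 - w x)) (𝓝[>] 0) (𝓝 q)

end

noncomputable section

/-! ### Tensor products in `L²([0,1]²)` -/

/-! Every population quantity is a functional of the past `(ϵ_i, ϵ_{i-1}, …)`. Dependence is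
measured by `depCoef`, the L² cost δ_l(F) of replacing all innovations of lag at least l by fresh
copies. The past at i and the coupled past at i+l share no innovation, so a centred G satisfies
|E⟨F_i, G_{i+l}⟩| ≤ ‖F‖ δ_l(G) (`abs_integral_inner_past_le`). Hölder with exponents 4, 4, 2 carries
summability of the coefficients from ε_i to Z_i = ε_i⊗ε_i − C, hence to the scores
(`isShortRange_tensorSquare`). This gives absolute convergence of the long-run covariance, and the
rate n^{-1/2} for the sample mean and for Ĉ − C in Hilbert space (`boundedInProb_mean`).

For the lag-window sum of the true scores, two facts about the mean absolute error of the lag-l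
sample covariance are combined. For fixed l it tends to 0; the products are only integrable, so they
are truncated first. Uniformly in l it is at most 2κ_l + C/√n with κ summable. The uniform bound is
the crux: with two moments of the scores the lagged products have no usable variance, but once the
second factor is coupled at lag l the two factors are independent and their product is square
integrable, with summable covariances (`abs_integral_prod_le`). The κ part is settled by dominated
convergence over the lags; the C/√n part occurs on O(h) lags and costs O(h/√n). The bias vanishes by
dominated convergence, because w(l/h) → w(0) = 1.

For the estimated scores, eigenfunctions enter only through φ̂_j⊗φ̂_j, so their signs are
irrelevant, and the spectral gap bounds the projection error by c‖Ĉ − C‖ (`one_sub_inner_sq_le`).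
The mean squared score error is therefore at most q_n/n with q_n bounded in probability
(`meanSq_scoreHat_sub_le`). A weighted Young inequality changes each lag by at most (2q_n + B_n)/√n,
where B_n is the mean square of the Z_i (`abs_crossCov_sub_le`), again on O(h) lags. No
measurability of φ̂ in ω is needed: the estimates are pointwise, and integrals are taken only of
measurable majorants. -/

theorem coeFn_tensorL2 (f g : L2I) :
    tensorL2 f g =ᵐ[(volume : Measure unitInterval).prod (volume : Measure unitInterval)]
      fun z => f z.1 * g z.2 :=
  MemLp.coeFn_toLp _

theorem inner_tensorL2 (f g f' g' : L2I) :
    inner ℝ (tensorL2 f g) (tensorL2 f' g') = inner ℝ f f' * inner ℝ g g' := by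
  rw [L2.inner_def, L2.inner_def, L2.inner_def, ← integral_prod_mul]
  refine integral_congr_ae ?_
  filter_upwards [coeFn_tensorL2 f g, coeFn_tensorL2 f' g'] with z h1 h2
  rw [h1, h2]
  simp only [RCLike.inner_apply, conj_trivial]
  ring

theorem norm_tensorL2 (f g : L2I) : ‖tensorL2 f g‖ = ‖f‖ * ‖g‖ := by
  have h := inner_tensorL2 f g f g
  rw [real_inner_self_eq_norm_sq, real_inner_self_eq_norm_sq, real_inner_self_eq_norm_sq,
    ← mul_pow] at h
  exact (pow_left_inj₀ (norm_nonneg _) (by positivity) two_ne_zero).1 h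

theorem tensorL2_add_left (f f' g : L2I) :
    tensorL2 (f + f') g = tensorL2 f g + tensorL2 f' g := by
  refine Lp.ext ?_
  filter_upwards [coeFn_tensorL2 (f + f') g, coeFn_tensorL2 f g, coeFn_tensorL2 f' g,
    Lp.coeFn_add (tensorL2 f g) (tensorL2 f' g),
    Measure.quasiMeasurePreserving_fst.ae (Lp.coeFn_add f f')] with z h1 h2 h3 h4 h5
  rw [h1, h4, Pi.add_apply, h2, h3, h5, Pi.add_apply, add_mul]

theorem tensorL2_add_right (f g g' : L2I) :
    tensorL2 f (g + g') = tensorL2 f g + tensorL2 f g' := by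
  refine Lp.ext ?_
  filter_upwards [coeFn_tensorL2 f (g + g'), coeFn_tensorL2 f g, coeFn_tensorL2 f g',
    Lp.coeFn_add (tensorL2 f g) (tensorL2 f g'),
    Measure.quasiMeasurePreserving_snd.ae (Lp.coeFn_add g g')] with z h1 h2 h3 h4 h5
  rw [h1, h4, Pi.add_apply, h2, h3, h5, Pi.add_apply, mul_add]

theorem tensorL2_smul_left (c : ℝ) (f g : L2I) : tensorL2 (c • f) g = c • tensorL2 f g := by
  refine Lp.ext ?_
  filter_upwards [coeFn_tensorL2 (c • f) g, coeFn_tensorL2 f g,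
    Lp.coeFn_smul c (tensorL2 f g),
    Measure.quasiMeasurePreserving_fst.ae (Lp.coeFn_smul c f)] with z h1 h2 h3 h4
  rw [h1, h3, Pi.smul_apply, h2, h4, Pi.smul_apply, smul_mul_assoc]

theorem tensorL2_smul_right (c : ℝ) (f g : L2I) : tensorL2 f (c • g) = c • tensorL2 f g := by
  refine Lp.ext ?_
  filter_upwards [coeFn_tensorL2 f (c • g), coeFn_tensorL2 f g,
    Lp.coeFn_smul c (tensorL2 f g),
    Measure.quasiMeasurePreserving_snd.ae (Lp.coeFn_smul c g)] with z h1 h2 h3 h4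
  rw [h1, h3, Pi.smul_apply, h2, h4, Pi.smul_apply, mul_smul_comm]

/-- The tensor product as a continuous bilinear map. -/
def tensorBilin : L2I →L[ℝ] L2I →L[ℝ] L2II :=
  LinearMap.mkContinuous₂
    (LinearMap.mk₂ ℝ tensorL2 tensorL2_add_left tensorL2_smul_left tensorL2_add_right
      tensorL2_smul_right) 1
    fun f g => by rw [LinearMap.mk₂_apply, norm_tensorL2, one_mul]

@[simp]
theorem tensorBilin_apply (f g : L2I) : tensorBilin f g = tensorL2 f g := rfl

theorem tensorL2_sub_left (f f' g : L2I) :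
    tensorL2 (f - f') g = tensorL2 f g - tensorL2 f' g := by
  simp only [← tensorBilin_apply, map_sub, sub_apply]

theorem tensorL2_sub_right (f g g' : L2I) :
    tensorL2 f (g - g') = tensorL2 f g - tensorL2 f g' := by
  simp only [← tensorBilin_apply, map_sub]

theorem continuous_tensorL2_self : Continuous fun f : L2I => tensorL2 f f := by
  have : Continuous fun f : L2I => tensorBilin f f := by fun_prop
  exact this

theorem norm_tensorL2_self_sub_le (f g : L2I) :
    ‖tensorL2 f f - tensorL2 g g‖ ≤ ‖f - g‖ * (‖f‖ + ‖g‖) := by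
  have h : tensorL2 f f - tensorL2 g g = tensorL2 (f - g) f + tensorL2 g (f - g) := by
    rw [tensorL2_sub_left, tensorL2_sub_right]; abel
  rw [h]
  refine (norm_add_le _ _).trans ?_
  rw [norm_tensorL2, norm_tensorL2]
  exact le_of_eq (by ring)

/-- The rank-one projection does not see the sign of its unit vector, so eigenfunctions that are
chosen arbitrarily can be compared through it. The identity reduces that comparison to the angle
between the vectors. -/
theorem norm_tensorL2_self_sub_sq {f g : L2I} (hf : ‖f‖ = 1) (hg : ‖g‖ = 1) :
    ‖tensorL2 f f - tensorL2 g g‖ ^ 2 = 2 * (1 - inner ℝ f g ^ 2) := by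
  rw [norm_sub_sq_real, inner_tensorL2, norm_tensorL2, norm_tensorL2, hf, hg]
  ring

/-! ### The integral operator of a kernel -/

/-- The integral operator with kernel `K`, as a bounded operator. -/
def kernelOp (K : L2II) : L2I →L[ℝ] L2I :=
  InnerProductSpace.continuousLinearMapOfBilin (𝕜 := ℝ)
    ((ContinuousLinearMap.compL ℝ L2I L2II ℝ (innerSL ℝ K)).comp tensorBilin.flip)

/-- The operator is defined weakly by Riesz representation, so this identity is all that is ever
used of it, and boundedness needs no pointwise argument. -/
theorem inner_kernelOp (K : L2II) (f g : L2I) :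
    inner ℝ (kernelOp K f) g = inner ℝ K (tensorL2 g f) := by
  rw [kernelOp, InnerProductSpace.continuousLinearMapOfBilin_apply]
  simp

/-- Fubini. This is the bridge from the weak operator to the pointwise integral in `IsEigenSystem`.
-/
theorem inner_tensorL2_right (K : L2II) (f g : L2I) :
    inner ℝ K (tensorL2 g f) = ∫ t, kernelApply K f t * g t := by
  have hint : Integrable (fun z : unitInterval × unitInterval => K z * (g z.1 * f z.2))
      ((volume : Measure unitInterval).prod (volume : Measure unitInterval)) :=
    (Lp.memLp K).integrable_mul (memLp_tensor g f)
  rw [L2.inner_def]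
  have h1 : ∫ z, inner ℝ (K z) (tensorL2 g f z)
      ∂((volume : Measure unitInterval).prod (volume : Measure unitInterval)) =
      ∫ z, K z * (g z.1 * f z.2)
        ∂((volume : Measure unitInterval).prod (volume : Measure unitInterval)) := by
    refine integral_congr_ae ?_
    filter_upwards [coeFn_tensorL2 g f] with z h
    rw [h]; simp only [RCLike.inner_apply, conj_trivial]; ring
  rw [h1, integral_prod _ hint]
  refine integral_congr_ae (Eventually.of_forall fun t => ?_)
  simp only [kernelApply]
  rw [← integral_mul_const]
  refine integral_congr_ae (Eventually.of_forall fun s => ?_)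
  simp only
  ring

theorem kernelOp_eq_of_kernelApply {K : L2II} {f g : L2I}
    (h : kernelApply K f =ᵐ[volume] g) : kernelOp K f = g := by
  refine ext_inner_right ℝ fun v => ?_
  rw [inner_kernelOp, inner_tensorL2_right, L2.inner_def]
  refine integral_congr_ae ?_
  filter_upwards [h] with t ht
  rw [ht]; simp only [RCLike.inner_apply, conj_trivial]; ring

theorem kernelOp_sub (K K' : L2II) (f : L2I) :
    kernelOp (K - K') f = kernelOp K f - kernelOp K' f := by
  refine ext_inner_right ℝ fun v => ?_
  rw [inner_sub_left, inner_kernelOp, inner_kernelOp, inner_kernelOp, inner_sub_left]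

theorem norm_kernelOp_le (K : L2II) (f : L2I) : ‖kernelOp K f‖ ≤ ‖K‖ * ‖f‖ := by
  have h : ‖kernelOp K f‖ * ‖kernelOp K f‖ ≤ ‖K‖ * ‖f‖ * ‖kernelOp K f‖ := by
    rw [← real_inner_self_eq_norm_mul_norm, inner_kernelOp]
    refine (real_inner_le_norm _ _).trans ?_
    rw [norm_tensorL2]
    exact le_of_eq (by ring)
  by_cases h0 : ‖kernelOp K f‖ = 0
  · rw [h0]; positivity
  · exact le_of_mul_le_mul_right h (lt_of_le_of_ne (norm_nonneg _) (Ne.symm h0))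

theorem IsEigenSystem.kernelOp_eigen {K : L2II} {lam : ℕ → ℝ} {phi : ℕ → L2I}
    (h : IsEigenSystem K lam phi) (j : ℕ) : kernelOp K (phi j) = lam j • phi j := by
  refine kernelOp_eq_of_kernelApply ((h.eigen j).trans ?_)
  filter_upwards [Lp.coeFn_smul (lam j) (phi j)] with t ht
  rw [ht, Pi.smul_apply, smul_eq_mul]

theorem IsEigenSystem.kernelOp_eq_zero {K : L2II} {lam : ℕ → ℝ} {phi : ℕ → L2I}
    (h : IsEigenSystem K lam phi) {f : L2I} (hf : ∀ j, inner ℝ (phi j) f = 0) :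
    kernelOp K f = 0 :=
  kernelOp_eq_of_kernelApply ((h.exhaustive f hf).trans (Lp.coeFn_zero _ _ _).symm)

/-! ### Perturbation of eigenvalues and eigenvectors -/

section Spectral

variable {H : Type*} [NormedAddCommGroup H] [InnerProductSpace ℝ H] [CompleteSpace H]

/-- `T` is diagonal with eigenvalues `lam` on the orthonormal sequence `phi` and vanishes on its
orthogonal complement. -/
structure IsDiagonal (T : H →L[ℝ] H) (lam : ℕ → ℝ) (phi : ℕ → H) : Prop where
  orthonormal : Orthonormal ℝ phi
  antitone : Antitone lam
  nonneg : ∀ j, 0 ≤ lam j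
  eigen : ∀ j, T (phi j) = lam j • phi j
  exhaustive : ∀ f : H, (∀ j, inner ℝ (phi j) f = 0) → T f = 0

theorem Orthonormal.summable_inner_smul {phi : ℕ → H} (h : Orthonormal ℝ phi) (v : H) :
    Summable fun k => inner ℝ (phi k) v • phi k := by
  have h1 := h.orthogonalFamily.summable_iff_norm_sq_summable (fun k => inner ℝ (phi k) v)
  have h2 := h.inner_products_summable v
  have := h1.2 (by simpa using h2)
  simpa [LinearIsometry.toSpanSingleton_apply] using this

namespace IsDiagonal

variable {T T' : H →L[ℝ] H} {lam lam' : ℕ → ℝ} {phi phi' : ℕ → H}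

/-- The residual of v after its Bessel expansion is orthogonal to every `phi k`, hence killed by T.
Completeness of `phi` is not needed. -/
theorem hasSum (h : IsDiagonal T lam phi) (v : H) :
    HasSum (fun k => (lam k * inner ℝ (phi k) v) • phi k) (T v) := by
  have hs := h.orthonormal.summable_inner_smul v
  set s := ∑' k, inner ℝ (phi k) v • phi k with hsdef
  have h0 : T (v - s) = 0 := by
    refine h.exhaustive _ fun j => ?_
    have h1 : HasSum (fun k => inner ℝ (phi j) (inner ℝ (phi k) v • phi k))
        (inner ℝ (phi j) s) := (innerSL ℝ (phi j)).hasSum hs.hasSum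
    have h2 : HasSum (fun k => inner ℝ (phi j) (inner ℝ (phi k) v • phi k))
        (inner ℝ (phi j) (inner ℝ (phi j) v • phi j)) :=
      hasSum_single j fun k hk => by
        rw [inner_smul_right, h.orthonormal.2 (Ne.symm hk), mul_zero]
    rw [inner_sub_right, h1.unique h2, inner_smul_right, real_inner_self_eq_norm_sq,
      h.orthonormal.1 j]
    ring
  have h1 : HasSum (fun k => T (inner ℝ (phi k) v • phi k)) (T s) := T.hasSum hs.hasSum
  rw [map_sub, sub_eq_zero] at h0
  rw [h0]
  refine h1.congr_fun fun k => ?_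
  rw [map_smul, h.eigen, smul_smul, mul_comm]

theorem hasSum_inner (h : IsDiagonal T lam phi) (v u : H) :
    HasSum (fun k => lam k * (inner ℝ (phi k) v * inner ℝ (phi k) u)) (inner ℝ (T v) u) := by
  have := (innerSL ℝ u).hasSum (h.hasSum v)
  rw [innerSL_apply_apply, real_inner_comm] at this
  refine this.congr_fun fun k => ?_
  simp only [innerSL_apply_apply, inner_smul_right]
  rw [real_inner_comm (phi k) u]; ring

theorem symm (h : IsDiagonal T lam phi) (v u : H) : inner ℝ (T v) u = inner ℝ (T u) v := by
  refine (h.hasSum_inner v u).unique ((h.hasSum_inner u v).congr_fun fun k => ?_)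
  rw [mul_comm (inner ℝ (phi k) u)]

/-- The upper half of the min-max principle. Since `phi` may be incomplete, only Bessel's inequality
is available, and it is usable because `lam j` is nonnegative. -/
theorem inner_le (h : IsDiagonal T lam phi) {j : ℕ} {v : H}
    (hv : ∀ k < j, inner ℝ (phi k) v = 0) : inner ℝ (T v) v ≤ lam j * ‖v‖ ^ 2 := by
  have h1 := h.hasSum_inner v v
  have h2 : Summable fun k => ‖inner ℝ (phi k) v‖ ^ 2 := h.orthonormal.inner_products_summable v
  have h3 : inner ℝ (T v) v ≤ lam j * ∑' k, ‖inner ℝ (phi k) v‖ ^ 2 := by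
    refine hasSum_le (fun k => ?_) h1 (h2.hasSum.mul_left (lam j))
    rw [Real.norm_eq_abs, sq_abs, ← sq]
    rcases lt_or_ge k j with hk | hk
    · rw [hv k hk]; simp
    · exact mul_le_mul_of_nonneg_right (h.antitone hk) (sq_nonneg _)
  exact h3.trans (mul_le_mul_of_nonneg_left (h.orthonormal.tsum_inner_products_le v)
    (h.nonneg j))

theorem inner_sum_phi (h : IsDiagonal T lam phi) (s : Finset ℕ) (c : ℕ → ℝ) :
    inner ℝ (T (∑ k ∈ s, c k • phi k)) (∑ k ∈ s, c k • phi k) = ∑ k ∈ s, lam k * c k ^ 2 := by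
  have h1 : T (∑ k ∈ s, c k • phi k) = ∑ k ∈ s, (lam k * c k) • phi k := by
    rw [map_sum]
    refine Finset.sum_congr rfl fun k _ => ?_
    rw [map_smul, h.eigen, smul_smul, mul_comm]
  rw [h1, h.orthonormal.inner_sum]
  refine Finset.sum_congr rfl fun k _ => ?_
  simp only [conj_trivial]; ring

theorem le_inner_sum_phi (h : IsDiagonal T lam phi) {s : Finset ℕ} {j : ℕ}
    (hs : ∀ k ∈ s, k ≤ j) (c : ℕ → ℝ) :
    lam j * ‖∑ k ∈ s, c k • phi k‖ ^ 2 ≤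
      inner ℝ (T (∑ k ∈ s, c k • phi k)) (∑ k ∈ s, c k • phi k) := by
  rw [h.inner_sum_phi, ← real_inner_self_eq_norm_sq, h.orthonormal.inner_sum, Finset.mul_sum]
  refine Finset.sum_le_sum fun k hk => ?_
  simp only [conj_trivial]
  rw [← sq]
  exact mul_le_mul_of_nonneg_right (h.antitone (hs k hk)) (sq_nonneg _)

/-- Weyl's inequality: some nonzero v in the span of `phi 0, …, phi j` is orthogonal to `phi' 0, …,
phi' (j - 1)`, and the quadratic forms of T and T' are compared at v. -/
theorem eigenvalue_le (h : IsDiagonal T lam phi) (h' : IsDiagonal T' lam' phi') {D : ℝ}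
    (hD : ∀ v, ‖T v - T' v‖ ≤ D * ‖v‖) (j : ℕ) : lam j ≤ lam' j + D := by
  -- Maps the coefficients of a vector in the span of the first j+1 `phi` to its inner products with
  -- the first j `phi'`. The kernel is nonzero by dimension.
  let f : (Fin (j + 1) → ℝ) →ₗ[ℝ] (Fin j → ℝ) :=
    { toFun := fun c i => ∑ k : Fin (j + 1), c k * inner ℝ (phi' i) (phi k)
      map_add' := fun c c' => by
        ext i; simp [add_mul, Finset.sum_add_distrib]
      map_smul' := fun r c => by
        ext i; simp [Finset.mul_sum, mul_assoc] }
  have hker : LinearMap.ker f ≠ ⊥ := LinearMap.ker_ne_bot_of_finrank_lt (by simp)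
  obtain ⟨c, hc, hc0⟩ := (Submodule.ne_bot_iff _).1 hker
  let c' : ℕ → ℝ := fun k => if hk : k < j + 1 then c ⟨k, hk⟩ else 0
  set v := ∑ k ∈ Finset.range (j + 1), c' k • phi k with hv
  have hvF : v = ∑ k : Fin (j + 1), c k • phi k := by
    rw [hv, Finset.sum_range]
    refine Finset.sum_congr rfl fun k _ => ?_
    have hk : (k : ℕ) < j + 1 := k.2
    simp only [c', dif_pos hk]
  have hv0 : 0 < ‖v‖ ^ 2 := by
    have : v ≠ 0 := by
      intro hz
      have hli := (h.orthonormal.comp (fun k : Fin (j + 1) => (k : ℕ))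
        Fin.val_injective).linearIndependent
      rw [Fintype.linearIndependent_iff] at hli
      exact hc0 (funext (hli c (by rw [← hz, hvF]; rfl)))
    positivity
  have h1 : lam j * ‖v‖ ^ 2 ≤ inner ℝ (T v) v :=
    h.le_inner_sum_phi (fun k hk => Nat.lt_succ_iff.1 (Finset.mem_range.1 hk)) c'
  have h2 : inner ℝ (T' v) v ≤ lam' j * ‖v‖ ^ 2 := by
    refine h'.inner_le fun k hk => ?_
    have := congrFun (LinearMap.mem_ker.1 hc) ⟨k, hk⟩
    rw [hvF, inner_sum]
    simp only [inner_smul_right]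
    exact this
  have h3 : inner ℝ (T v) v - inner ℝ (T' v) v ≤ D * ‖v‖ ^ 2 := by
    rw [← inner_sub_left]
    refine (real_inner_le_norm _ _).trans ?_
    rw [sq, ← mul_assoc]
    exact mul_le_mul_of_nonneg_right (hD v) (norm_nonneg _)
  have h4 : lam j * ‖v‖ ^ 2 ≤ (lam' j + D) * ‖v‖ ^ 2 := by linarith
  exact le_of_mul_le_mul_right h4 hv0

/-- On the complement of `phi j` the operator T − lam j is at least δ on the eigenvectors before j
and at most −δ on the rest, so it is bounded below in norm by δ. Both one-sided gaps are needed. -/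
theorem le_norm_sub_smul (h : IsDiagonal T lam phi) {j : ℕ} {δ : ℝ}
    (hlow : δ ≤ lam j - lam (j + 1)) (hup : ∀ k < j, δ ≤ lam k - lam j) {u : H}
    (hu : inner ℝ (phi j) u = 0) : δ * ‖u‖ ≤ ‖T u - lam j • u‖ := by
  set c : ℕ → ℝ := fun k => inner ℝ (phi k) u with hc
  set x := ∑ k ∈ Finset.range j, c k • phi k with hx
  set y := u - x with hy
  have hyk : ∀ k < j + 1, inner ℝ (phi k) y = 0 := by
    intro k hk
    rw [hy, inner_sub_right]
    rcases Nat.lt_succ_iff_lt_or_eq.1 hk with hk | rfl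
    · rw [hx, h.orthonormal.inner_right_sum _ (Finset.mem_range.2 hk), sub_self]
    · have h0 : inner ℝ (phi k) x = 0 := by
        rw [hx, inner_sum]
        refine Finset.sum_eq_zero fun i hi => ?_
        rw [inner_smul_right, h.orthonormal.2 (Finset.mem_range.1 hi).ne', mul_zero]
      rw [h0, hu, sub_zero]
  have hxy : inner ℝ x y = 0 := by
    rw [hx, sum_inner]
    refine Finset.sum_eq_zero fun k hk => ?_
    rw [inner_smul_left, hyk k ((Finset.mem_range.1 hk).trans (Nat.lt_succ_self j)), mul_zero]
  have hTxy : inner ℝ (T x) y = 0 := by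
    rw [hx, map_sum, sum_inner]
    refine Finset.sum_eq_zero fun k hk => ?_
    rw [map_smul, h.eigen, inner_smul_left, inner_smul_left,
      hyk k ((Finset.mem_range.1 hk).trans (Nat.lt_succ_self j)), mul_zero, mul_zero]
  have hTyx : inner ℝ (T y) x = 0 := by rw [h.symm, hTxy]
  have huxy : u = x + y := by rw [hy]; abel
  have h1 : inner ℝ (T y) y ≤ lam (j + 1) * ‖y‖ ^ 2 := h.inner_le hyk
  have h2 : (lam j + δ) * ‖x‖ ^ 2 ≤ inner ℝ (T x) x := by
    rw [hx, h.inner_sum_phi, ← real_inner_self_eq_norm_sq, h.orthonormal.inner_sum,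
      Finset.mul_sum]
    refine Finset.sum_le_sum fun k hk => ?_
    simp only [conj_trivial]
    rw [← sq]
    exact mul_le_mul_of_nonneg_right (by linarith [hup k (Finset.mem_range.1 hk)]) (sq_nonneg _)
  have hn : ‖u‖ ^ 2 = ‖x‖ ^ 2 + ‖y‖ ^ 2 := by
    rw [huxy, norm_add_sq_real, hxy]; ring
  have hn' : ‖x - y‖ ^ 2 = ‖u‖ ^ 2 := by
    rw [hn, norm_sub_sq_real, hxy]; ring
  have hn'' : ‖x - y‖ = ‖u‖ :=
    (pow_left_inj₀ (norm_nonneg _) (norm_nonneg _) two_ne_zero).1 hn'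
  -- Testing against x − y instead of u = x + y flips the sign on the part where T − lam j is
  -- negative, so the two contributions add up; ‖x − y‖ = ‖u‖ by orthogonality.
  have h3 : inner ℝ (T u - lam j • u) (x - y) =
      inner ℝ (T x) x - inner ℝ (T y) y - lam j * ‖x‖ ^ 2 + lam j * ‖y‖ ^ 2 := by
    rw [huxy, map_add]
    simp only [inner_sub_left, inner_sub_right, inner_add_left, inner_smul_left, hTxy, hTyx, hxy,
      real_inner_comm x y, conj_trivial, real_inner_self_eq_norm_sq]
    ring
  have h4 : δ * ‖u‖ ^ 2 ≤ ‖T u - lam j • u‖ * ‖u‖ := by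
    have h5 := real_inner_le_norm (T u - lam j • u) (x - y)
    rw [h3, hn''] at h5
    have h6 : δ * ‖y‖ ^ 2 ≤ (lam j - lam (j + 1)) * ‖y‖ ^ 2 :=
      mul_le_mul_of_nonneg_right hlow (sq_nonneg _)
    rw [hn]
    nlinarith
  by_cases h0 : ‖u‖ = 0
  · rw [h0, mul_zero]; positivity
  · refine le_of_mul_le_mul_right ?_ (lt_of_le_of_ne (norm_nonneg u) (Ne.symm h0))
    rw [mul_assoc, ← sq]; exact h4

/-- A Davis–Kahan argument: the component u of `phi' j` orthogonal to `phi j` has squared norm 1 −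
r², and (T − lam j)u equals (T − T') `phi' j` plus the eigenvalue shift times `phi' j`. Each has
norm at most D, and the gap estimate converts 2D into a bound for ‖u‖. -/
theorem one_sub_inner_sq_le (h : IsDiagonal T lam phi) (h' : IsDiagonal T' lam' phi') {D : ℝ}
    (hD : ∀ v, ‖T v - T' v‖ ≤ D * ‖v‖) {j : ℕ} {δ : ℝ} (hδ : 0 < δ)
    (hlow : δ ≤ lam j - lam (j + 1)) (hup : ∀ k < j, δ ≤ lam k - lam j) :
    1 - inner ℝ (phi' j) (phi j) ^ 2 ≤ (2 * D / δ) ^ 2 := by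
  have hD' : ∀ v, ‖T' v - T v‖ ≤ D * ‖v‖ := fun v => by rw [norm_sub_rev]; exact hD v
  have hw : |lam' j - lam j| ≤ D := by
    rw [abs_le]
    constructor <;> linarith [h.eigenvalue_le h' hD j, h'.eigenvalue_le h hD' j]
  set r := inner ℝ (phi' j) (phi j) with hr
  set u := phi' j - r • phi j with hu
  have hφ := h.orthonormal.1 j
  have hφ' := h'.orthonormal.1 j
  have hu0 : inner ℝ (phi j) u = 0 := by
    rw [hu, inner_sub_right, inner_smul_right, real_inner_self_eq_norm_sq, hφ, hr,
      real_inner_comm]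
    ring
  have hun : ‖u‖ ^ 2 = 1 - r ^ 2 := by
    rw [hu, norm_sub_sq_real, inner_smul_right, norm_smul, hφ, hφ', ← hr, mul_one,
      Real.norm_eq_abs, sq_abs]
    ring
  have hTu : T u - lam j • u = (T (phi' j) - T' (phi' j)) + (lam' j - lam j) • phi' j := by
    rw [hu, map_sub, map_smul, h.eigen, h'.eigen, smul_sub, smul_comm r, sub_smul]
    abel
  have h1 : ‖T u - lam j • u‖ ≤ 2 * D := by
    rw [hTu]
    refine (norm_add_le _ _).trans ?_
    have h2 := hD (phi' j)
    rw [hφ', mul_one] at h2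
    rw [norm_smul, hφ', mul_one, Real.norm_eq_abs]
    linarith
  have h3 := (h.le_norm_sub_smul hlow hup hu0).trans h1
  rw [← hun]
  refine pow_le_pow_left₀ (norm_nonneg _) ?_ 2
  rw [le_div_iff₀ hδ, mul_comm]
  exact h3

end IsDiagonal

end Spectral

theorem IsEigenSystem.isDiagonal {K : L2II} {lam : ℕ → ℝ} {phi : ℕ → L2I}
    (h : IsEigenSystem K lam phi) : IsDiagonal (kernelOp K) lam phi where
  orthonormal := h.orthonormal
  antitone := h.antitone
  nonneg := h.nonneg
  eigen := h.kernelOp_eigen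
  exhaustive _ hf := h.kernelOp_eq_zero hf

/-- The eigenprojections depend on the kernel in a Lipschitz way as long as there is a spectral
gap. -/
theorem IsEigenSystem.exists_norm_tensorL2_sub_le {K : L2II} {lam : ℕ → ℝ} {phi : ℕ → L2I}
    (h : IsEigenSystem K lam phi) {d : ℕ} (hgap : ∀ j < d, lam (j + 1) < lam j) {j : ℕ}
    (hj : j < d) :
    ∃ c : ℝ, ∀ (K' : L2II) (lam' : ℕ → ℝ) (phi' : ℕ → L2I),
      IsEigenSystem K' lam' phi' →
      ‖tensorL2 (phi' j) (phi' j) - tensorL2 (phi j) (phi j)‖ ≤ c * ‖K' - K‖ := by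
  -- The smaller of the two neighbouring gaps; for j = 0 there is only the gap below. Monotonicity
  -- extends the upper gap to all k < j.
  obtain ⟨δ, hδ, hlow, hup⟩ : ∃ δ : ℝ, 0 < δ ∧ δ ≤ lam j - lam (j + 1) ∧
      ∀ k < j, δ ≤ lam k - lam j := by
    rcases Nat.eq_zero_or_pos j with rfl | hj0
    · exact ⟨lam 0 - lam 1, sub_pos.2 (hgap 0 hj), le_rfl, fun k hk => absurd hk (by omega)⟩
    · have h1 := hgap (j - 1) (by omega)
      rw [Nat.sub_add_cancel hj0] at h1
      refine ⟨min (lam j - lam (j + 1)) (lam (j - 1) - lam j),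
        lt_min (sub_pos.2 (hgap j hj)) (sub_pos.2 h1), min_le_left _ _, fun k hk => ?_⟩
      exact (min_le_right _ _).trans (sub_le_sub_right (h.antitone (by omega)) _)
  -- The squared distance is 2(1 − r²) ≤ 2(2D/δ)²; the factor 2 is rounded up to 4 to keep the
  -- constant free of √2.
  refine ⟨2 * (2 / δ), fun K' lam' phi' h' => ?_⟩
  have hD : ∀ v, ‖kernelOp K v - kernelOp K' v‖ ≤ ‖K' - K‖ * ‖v‖ := fun v => by
    rw [← kernelOp_sub, norm_sub_rev K' K]; exact norm_kernelOp_le _ _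
  have h1 := h.isDiagonal.one_sub_inner_sq_le h'.isDiagonal hD hδ hlow hup
  refine le_of_sq_le_sq ?_ (by positivity)
  rw [norm_tensorL2_self_sub_sq (h'.orthonormal.1 j) (h.orthonormal.1 j)]
  have h2 : (2 * ‖K' - K‖ / δ) ^ 2 * 4 = (2 * (2 / δ) * ‖K' - K‖) ^ 2 := by ring
  rw [← h2]
  nlinarith [sq_nonneg (2 * ‖K' - K‖ / δ)]

/-! ### Root mean squares -/

section RootMeanSquare

variable {Ω : Type*} [MeasurableSpace Ω] {P : Measure Ω}
  {E : Type*} [NormedAddCommGroup E]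

/-- The `L²`-norm of `X` as a real number. -/
def rms (P : Measure Ω) (X : Ω → E) : ℝ := √(∫ ω, ‖X ω‖ ^ 2 ∂P)

theorem rms_nonneg (X : Ω → E) : 0 ≤ rms P X := Real.sqrt_nonneg _

theorem rms_sq (X : Ω → E) : rms P X ^ 2 = ∫ ω, ‖X ω‖ ^ 2 ∂P :=
  Real.sq_sqrt (integral_nonneg fun _ => sq_nonneg _)

theorem rms_congr {F : Type*} [NormedAddCommGroup F] {X : Ω → E} {Y : Ω → F}
    (h : ∀ ω, ‖X ω‖ = ‖Y ω‖) : rms P X = rms P Y := by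
  simp only [rms, h]

theorem rms_eq_toReal_eLpNorm {X : Ω → E} (hX : MemLp X 2 P) :
    rms P X = (eLpNorm X 2 P).toReal := by
  rw [hX.eLpNorm_eq_integral_rpow_norm two_ne_zero ENNReal.ofNat_ne_top,
    ENNReal.toReal_ofReal (by positivity), rms, Real.sqrt_eq_rpow]
  simp

theorem rms_add_le {X Y : Ω → E} (hX : MemLp X 2 P) (hY : MemLp Y 2 P) :
    rms P (fun ω => X ω + Y ω) ≤ rms P X + rms P Y := by
  have h : MemLp (fun ω => X ω + Y ω) 2 P := hX.add hY
  rw [rms_eq_toReal_eLpNorm hX, rms_eq_toReal_eLpNorm hY, rms_eq_toReal_eLpNorm h,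
    ← ENNReal.toReal_add hX.2.ne hY.2.ne]
  exact ENNReal.toReal_mono (ENNReal.add_ne_top.2 ⟨hX.2.ne, hY.2.ne⟩)
    (eLpNorm_add_le hX.1 hY.1 one_le_two)

theorem rms_mono {F : Type*} [NormedAddCommGroup F] {X : Ω → E} {Y : Ω → F}
    (hY : MemLp Y 2 P) (h : ∀ ω, ‖X ω‖ ≤ ‖Y ω‖) : rms P X ≤ rms P Y := by
  refine Real.sqrt_le_sqrt (integral_mono_of_nonneg (Eventually.of_forall fun _ => sq_nonneg _)
    hY.norm.integrable_sq (Eventually.of_forall fun ω => ?_))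
  exact pow_le_pow_left₀ (norm_nonneg _) (h ω) 2

theorem rms_const_mul {c : ℝ} (hc : 0 ≤ c) (X : Ω → ℝ) :
    rms P (fun ω => c * X ω) = c * rms P X := by
  simp only [rms, norm_mul, mul_pow, integral_const_mul]
  rw [Real.sqrt_mul (sq_nonneg _), Real.sqrt_sq (norm_nonneg _), Real.norm_of_nonneg hc]

theorem integral_norm_mul_norm_le {F : Type*} [NormedAddCommGroup F] {X : Ω → E} {Y : Ω → F}
    (hX : MemLp X 2 P) (hY : MemLp Y 2 P) :
    ∫ ω, ‖X ω‖ * ‖Y ω‖ ∂P ≤ rms P X * rms P Y := by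
  have h := integral_mul_le_Lp_mul_Lq_of_nonneg (μ := P) (f := fun ω => ‖X ω‖)
    (g := fun ω => ‖Y ω‖) Real.HolderConjugate.two_two
    (Eventually.of_forall fun _ => norm_nonneg _)
    (Eventually.of_forall fun _ => norm_nonneg _) (by simpa using hX.norm) (by simpa using hY.norm)
  simpa [rms, Real.sqrt_eq_rpow] using h

theorem integral_norm_le_rms [IsProbabilityMeasure P] {X : Ω → E} (hX : MemLp X 2 P) :
    ∫ ω, ‖X ω‖ ∂P ≤ rms P X := by
  have h := integral_norm_mul_norm_le hX (memLp_const (1 : ℝ) (μ := P) (p := 2))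
  simpa [rms] using h

theorem abs_integral_inner_le [InnerProductSpace ℝ E] {X Y : Ω → E}
    (hX : MemLp X 2 P) (hY : MemLp Y 2 P) :
    |∫ ω, inner ℝ (X ω) (Y ω) ∂P| ≤ rms P X * rms P Y := by
  refine (abs_integral_le_integral_abs).trans (le_trans ?_ (integral_norm_mul_norm_le hX hY))
  refine integral_mono_of_nonneg (Eventually.of_forall fun _ => abs_nonneg _)
    (hX.norm.integrable_mul hY.norm) (Eventually.of_forall fun ω => ?_)
  exact abs_real_inner_le_norm _ _

theorem integrable_inner_of_memLp [InnerProductSpace ℝ E] {X Y : Ω → E}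
    (hX : MemLp X 2 P) (hY : MemLp Y 2 P) : Integrable (fun ω => inner ℝ (X ω) (Y ω)) P := by
  refine (hX.norm.integrable_mul hY.norm).mono' (hX.1.inner hY.1)
    (Eventually.of_forall fun ω => ?_)
  exact abs_real_inner_le_norm _ _

theorem rms_map {Ω' : Type*} [MeasurableSpace Ω'] {φ : Ω → Ω'} (hφ : Measurable φ) {X : Ω' → E}
    (hX : StronglyMeasurable X) : rms (P.map φ) X = rms P fun ω => X (φ ω) := by
  have hX2 : StronglyMeasurable fun x => ‖X x‖ ^ 2 := hX.norm.pow 2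
  rw [rms, integral_map hφ.aemeasurable hX2.aestronglyMeasurable, rms]

/-- Independence replaces the fourth moments that a product of two L² variables would otherwise
need. -/
theorem memLp_mul_of_indepFun {X Y : Ω → ℝ} (h : IndepFun X Y P) (hX : MemLp X 2 P)
    (hY : MemLp Y 2 P) : MemLp (fun ω => X ω * Y ω) 2 P := by
  have hm : AEStronglyMeasurable (fun ω => X ω * Y ω) P := hX.1.mul hY.1
  rw [memLp_two_iff_integrable_sq hm]
  have h2 : IndepFun (fun ω => X ω ^ 2) (fun ω => Y ω ^ 2) P :=
    h.comp (φ := fun x => x ^ 2) (ψ := fun x => x ^ 2) (by fun_prop) (by fun_prop)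
  have h3 : Integrable (fun ω => X ω ^ 2 * Y ω ^ 2) P :=
    h2.integrable_mul hX.integrable_sq hY.integrable_sq
  simpa only [mul_pow] using h3

theorem rms_mul_of_indepFun {X Y : Ω → ℝ} (h : IndepFun X Y P) (hX : AEStronglyMeasurable X P)
    (hY : AEStronglyMeasurable Y P) :
    rms P (fun ω => X ω * Y ω) = rms P X * rms P Y := by
  have h2 : IndepFun (fun ω => ‖X ω‖ ^ 2) (fun ω => ‖Y ω‖ ^ 2) P :=
    h.comp (φ := fun x => ‖x‖ ^ 2) (ψ := fun x => ‖x‖ ^ 2) (by fun_prop) (by fun_prop)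
  rw [rms, rms, rms, ← Real.sqrt_mul (integral_nonneg fun _ => sq_nonneg _),
    ← h2.integral_fun_mul_eq_mul_integral (hX.norm.pow 2) (hY.norm.pow 2)]
  simp only [norm_mul, mul_pow]

end RootMeanSquare

/-! ### Functionals of the innovations -/

section Innovations

variable {Ω S : Type*}

/-- All innovations, the original ones and the copies, as one family. -/
def innovations (e : ℤ → Ω → S) (es : ℤ → ℕ → ℤ → Ω → S) : ℤ ⊕ (ℤ × ℕ × ℤ) → Ω → S :=
  Sum.elim e fun k => es k.1 k.2.1 k.2.2

/-- The past `(ϵ_i, ϵ_{i-1}, …)`. -/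
def past (e : ℤ → Ω → S) (i : ℤ) (ω : Ω) : ℕ → S := fun k => e (i - k) ω

/-- The past at `i` in which the entries of lag at least `l` are replaced by copies. -/
def coupledPast (e : ℤ → Ω → S) (es : ℤ → ℕ → ℤ → Ω → S) (i : ℤ) (l : ℕ) (ω : Ω) : ℕ → S :=
  fun k => if k < l then e (i - k) ω else es i l (i - k) ω

/-- The pair consisting of a sequence and its modification at lags at least `l`. -/
def splice (l : ℕ) (W : ℕ ⊕ ℕ → S) : (ℕ → S) × (ℕ → S) :=
  (fun k => W (Sum.inl k), fun k => if k < l then W (Sum.inl k) else W (Sum.inr k))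

theorem past_add_shift (e : ℤ → Ω → S) (i : ℤ) (l : ℕ) (ω : Ω) :
    (fun k : ℕ => past e (i + l) ω (k + l)) = past e i ω := by
  ext k
  simp only [past]
  congr 1
  push_cast
  ring

variable [MeasurableSpace S]

/-- The `σ`-algebra generated by the members of a family with index in `T`. -/
@[reducible]
def sigmaOf {ι : Type*} (Z : ι → Ω → S) (T : Set ι) : MeasurableSpace Ω :=
  ⨆ i ∈ T, MeasurableSpace.comap (Z i) inferInstance

theorem measurable_sigmaOf {ι κ : Type*} {Z : ι → Ω → S} {T : Set ι} {f : κ → ι}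
    (hf : ∀ k, f k ∈ T) : Measurable[sigmaOf Z T] fun ω k => Z (f k) ω := by
  refine @measurable_pi_lambda _ _ _ (sigmaOf Z T) _ _ fun k => ?_
  rw [measurable_iff_comap_le]
  exact le_iSup₂_of_le (f k) (hf k) le_rfl

variable [MeasurableSpace Ω]

theorem measurable_splice (l : ℕ) : Measurable (splice l : (ℕ ⊕ ℕ → S) → _) := by
  refine (measurable_pi_lambda _ fun k => measurable_pi_apply _).prodMk
    (measurable_pi_lambda _ fun k => ?_)
  by_cases h : k < l
  · simp only [h, if_true]; exact measurable_pi_apply _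
  · simp only [h, if_false]; exact measurable_pi_apply _

/-- The law of the past of the innovations. -/
def pastLaw (P : Measure Ω) (e : ℤ → Ω → S) : Measure (ℕ → S) := P.map (past e 0)

/-- The joint law of the past and of the coupled past. -/
def pairLaw (P : Measure Ω) (e : ℤ → Ω → S) (l : ℕ) : Measure ((ℕ → S) × (ℕ → S)) :=
  (Measure.infinitePi fun _ : ℕ ⊕ ℕ => P.map (e 0)).map (splice l)

variable {P : Measure Ω} {e : ℤ → Ω → S} {es : ℤ → ℕ → ℤ → Ω → S}

/-- The indices of the innovations on which `past e i` depends. -/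
def pastIdx (i : ℤ) : Set (ℤ ⊕ (ℤ × ℕ × ℤ)) := {s | Sum.elim (fun j => j ≤ i) (fun _ => False) s}

/-- The indices of the innovations on which `coupledPast e es i l` depends. -/
def coupledIdx (i : ℤ) (l : ℕ) : Set (ℤ ⊕ (ℤ × ℕ × ℤ)) :=
  {s | Sum.elim (fun j => i - l < j ∧ j ≤ i) (fun k => k.1 = i ∧ k.2.1 = l) s}

@[simp]
theorem inl_mem_pastIdx {i j : ℤ} : Sum.inl j ∈ pastIdx i ↔ j ≤ i := Iff.rfl

@[simp]
theorem inr_mem_pastIdx {i : ℤ} {k : ℤ × ℕ × ℤ} : Sum.inr k ∈ pastIdx i ↔ False := Iff.rfl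

@[simp]
theorem inl_mem_coupledIdx {i j : ℤ} {l : ℕ} :
    Sum.inl j ∈ coupledIdx i l ↔ i - l < j ∧ j ≤ i := Iff.rfl

@[simp]
theorem inr_mem_coupledIdx {i : ℤ} {l : ℕ} {k : ℤ × ℕ × ℤ} :
    Sum.inr k ∈ coupledIdx i l ↔ k.1 = i ∧ k.2.1 = l := Iff.rfl

theorem measurable_past_sigmaOf {T : Set (ℤ ⊕ (ℤ × ℕ × ℤ))} {i : ℤ} (h : pastIdx i ⊆ T) :
    Measurable[sigmaOf (innovations e es) T] (past e i) :=
  measurable_sigmaOf (Z := innovations e es) (f := fun k : ℕ => Sum.inl (i - k)) fun k =>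
    h (by simp)

theorem measurable_coupledPast_sigmaOf {T : Set (ℤ ⊕ (ℤ × ℕ × ℤ))} {i : ℤ} {l : ℕ}
    (h : coupledIdx i l ⊆ T) :
    Measurable[sigmaOf (innovations e es) T] (coupledPast e es i l) := by
  have h1 := measurable_sigmaOf (Z := innovations e es) (T := T)
    (f := fun k : ℕ => if k < l then Sum.inl (i - k) else Sum.inr (i, l, i - k)) fun k => h (by
      by_cases hk : k < l
      · simp only [hk, if_true, inl_mem_coupledIdx]; omega
      · simp [hk])
  convert h1 using 1
  ext ω k
  by_cases hk : k < l <;> simp [coupledPast, innovations, hk]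

namespace IsInnovationSystem

theorem measurable_innovations (he : IsInnovationSystem P e es) (s : ℤ ⊕ (ℤ × ℕ × ℤ)) :
    Measurable (innovations e es s) := by
  rcases s with i | k
  · exact he.measurable i
  · exact he.measurable_copy _ _ _

theorem map_innovations (he : IsInnovationSystem P e es) (s : ℤ ⊕ (ℤ × ℕ × ℤ)) :
    P.map (innovations e es s) = P.map (e 0) := by
  rcases s with i | k
  · exact (he.identDistrib i).map_eq
  · exact (he.identDistrib_copy _ _ _).map_eq

theorem measurable_past (he : IsInnovationSystem P e es) (i : ℤ) : Measurable (past e i) :=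
  measurable_pi_lambda _ fun _ => he.measurable _

theorem measurable_coupledPast (he : IsInnovationSystem P e es) (i : ℤ) (l : ℕ) :
    Measurable (coupledPast e es i l) := by
  refine measurable_pi_lambda _ fun k => ?_
  by_cases hk : k < l
  · simp only [coupledPast, hk, if_true]; exact he.measurable _
  · simp only [coupledPast, hk, if_false]; exact he.measurable_copy _ _ _

/-- Every independence claim below goes through this lemma: it becomes disjointness of two index
sets of innovations, which is integer arithmetic. Copies attached to different pairs (i, l) are
disjoint. -/
theorem indepFun (he : IsInnovationSystem P e es) {T T' : Set (ℤ ⊕ (ℤ × ℕ × ℤ))}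
    (hT : Disjoint T T') {A B : Type*} [MeasurableSpace A] [MeasurableSpace B] {X : Ω → A}
    {Y : Ω → B} (hX : Measurable[sigmaOf (innovations e es) T] X)
    (hY : Measurable[sigmaOf (innovations e es) T'] Y) : IndepFun X Y P := by
  rw [IndepFun_iff_Indep]
  have h : Indep (sigmaOf (innovations e es) T) (sigmaOf (innovations e es) T') P :=
    indep_iSup_of_disjoint (fun s => (he.measurable_innovations s).comap_le) he.indep.iIndep hT
  exact indep_of_indep_of_le_left (indep_of_indep_of_le_right h hY.comap_le) hX.comap_le

theorem map_comp_innovations (he : IsInnovationSystem P e es) {κ : Type*}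
    {f : κ → ℤ ⊕ (ℤ × ℕ × ℤ)} (hf : f.Injective) :
    P.map (fun ω k => innovations e es (f k) ω) = Measure.infinitePi fun _ : κ => P.map (e 0) := by
  have h := (he.indep.precomp hf).map_fun_eq_infinitePi_map
    (fun k => he.measurable_innovations (f k))
  have h2 : (fun k => P.map (innovations e es (f k))) = fun _ => P.map (e 0) :=
    funext fun k => he.map_innovations (f k)
  rw [← h2]
  exact h

/-- Distinct innovations are i.i.d., so only injectivity of the indexing matters. Each stationarity
statement below amounts to choosing f. -/
theorem map_splice (he : IsInnovationSystem P e es) {f : ℕ ⊕ ℕ → ℤ ⊕ (ℤ × ℕ × ℤ)}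
    (hf : f.Injective) (l : ℕ) :
    P.map (fun ω => splice l fun s => innovations e es (f s) ω) = pairLaw P e l := by
  rw [pairLaw, ← he.map_comp_innovations hf, Measure.map_map (measurable_splice l)
    (measurable_pi_lambda _ fun s => he.measurable_innovations _)]
  rfl

theorem map_past_coupledPast (he : IsInnovationSystem P e es) (i : ℤ) (l : ℕ) :
    P.map (fun ω => (past e i ω, coupledPast e es i l ω)) = pairLaw P e l := by
  rw [← he.map_splice (f := Sum.map (fun k : ℕ => i - k) fun k : ℕ => (i, l, i - (k : ℤ)))]
  · rfl
  · refine Sum.map_injective.2 ⟨fun a b h => ?_, fun a b h => ?_⟩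
    · simpa using h
    · simpa using h

/-- For d < l the past coupled at l serves as the original sequence, and the copies of (i, d) as
fresh ones. They are distinct from the copies of (i, l), and the first d entries agree. -/
theorem map_coupledPast_coupledPast (he : IsInnovationSystem P e es) (i : ℤ) {l d : ℕ}
    (hd : d < l) :
    P.map (fun ω => (coupledPast e es i l ω, coupledPast e es i d ω)) = pairLaw P e d := by
  rw [← he.map_splice (f := Sum.elim
    (fun k : ℕ => if k < l then Sum.inl (i - k) else Sum.inr (i, l, i - (k : ℤ)))
    fun k : ℕ => Sum.inr (i, d, i - (k : ℤ)))]
  · congr 1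
    ext ω : 1
    refine Prod.ext (funext fun k => ?_) (funext fun k => ?_)
    · by_cases hk : k < l <;> simp [coupledPast, innovations, splice, hk]
    · by_cases hk : k < d
      · simp [coupledPast, innovations, splice, hk, hk.trans hd]
      · simp [coupledPast, innovations, splice, hk]
  · refine Function.Injective.sumElim (fun a b h => ?_) (fun a b h => ?_) fun a b h => ?_
    · by_cases ha : a < l <;> by_cases hb : b < l <;> simp [ha, hb] at h <;> exact h
    · simpa using h
    · by_cases ha : a < l <;> simp [ha] at h
      omega

/-- Dropping the n most recent entries leaves a pair whose first l − n entries still agree, so lag l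
becomes lag l − n. -/
theorem map_shift_past_coupledPast (he : IsInnovationSystem P e es) (i : ℤ) {l n : ℕ}
    (hn : n ≤ l) :
    P.map (fun ω => ((fun k => past e i ω (k + n)), fun k => coupledPast e es i l ω (k + n))) =
      pairLaw P e (l - n) := by
  rw [← he.map_splice (f := Sum.map (fun k : ℕ => i - (k + n : ℕ))
    fun k : ℕ => (i, l, i - ((k + n : ℕ) : ℤ)))]
  · congr 1
    ext ω : 1
    refine Prod.ext rfl (funext fun k => ?_)
    by_cases hk : k + n < l
    · have hk' : k < l - n := by omega
      simp [coupledPast, innovations, splice, hk, hk']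
    · have hk' : ¬ k < l - n := by omega
      simp [coupledPast, innovations, splice, hk, hk']
  · refine Sum.map_injective.2 ⟨fun a b h => ?_, fun a b h => ?_⟩
    · simpa using h
    · simpa using h

theorem map_past (he : IsInnovationSystem P e es) (i : ℤ) : P.map (past e i) = pastLaw P e := by
  have h : ∀ i, P.map (past e i) = Measure.infinitePi fun _ : ℕ => P.map (e 0) := fun i => by
    rw [← he.map_comp_innovations (f := fun k : ℕ => Sum.inl (i - k))]
    · rfl
    · intro a b h
      simpa using h
  rw [pastLaw, h, h]

theorem map_coupledPast (he : IsInnovationSystem P e es) (i : ℤ) (l : ℕ) :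
    P.map (coupledPast e es i l) = pastLaw P e := by
  have h : ∀ i, P.map (past e i) = Measure.infinitePi fun _ : ℕ => P.map (e 0) := fun i => by
    rw [← he.map_comp_innovations (f := fun k : ℕ => Sum.inl (i - k))]
    · rfl
    · intro a b h
      simpa using h
  rw [pastLaw, h, ← he.map_comp_innovations
    (f := fun k : ℕ => if k < l then Sum.inl (i - k) else Sum.inr (i, l, i - (k : ℤ)))]
  · congr 1
    ext ω k
    by_cases hk : k < l <;> simp [coupledPast, innovations, hk]
  · intro a b h
    by_cases ha : a < l <;> by_cases hb : b < l <;> simp [ha, hb] at h <;> exact h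

end IsInnovationSystem

end Innovations

/-! ### Covariance bounds for functionals of the past -/

section SecondMoments

variable {Ω : Type*} [MeasurableSpace Ω] {P : Measure Ω}
  {E : Type*} [NormedAddCommGroup E] [InnerProductSpace ℝ E]

/-- Each distance d from i is attained by at most two indices, i + d and i − d. -/
theorem sum_natAbs_sub_le {c : ℕ → ℝ} (hc : ∀ d, 0 ≤ c d) (N : ℕ) {i : ℤ}
    (hi : i ∈ Finset.Icc (1 : ℤ) N) :
    ∑ k ∈ Finset.Icc (1 : ℤ) N, c (k - i).natAbs ≤ 2 * ∑ d ∈ Finset.range N, c d := by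
  rw [Finset.mem_Icc] at hi
  rw [← Finset.sum_fiberwise_of_maps_to (g := fun k : ℤ => (k - i).natAbs)
    (t := Finset.range N), Finset.mul_sum]
  · refine Finset.sum_le_sum fun d _ => ?_
    rw [Finset.sum_congr rfl (g := fun _ => c d) (fun k hk => by rw [(Finset.mem_filter.1 hk).2]),
      Finset.sum_const, nsmul_eq_mul]
    refine mul_le_mul_of_nonneg_right ?_ (hc d)
    have h : (Finset.Icc (1 : ℤ) N).filter (fun k => (k - i).natAbs = d) ⊆ {i + d, i - d} := by
      intro k hk
      have := (Finset.mem_filter.1 hk).2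
      simp only [Finset.mem_insert, Finset.mem_singleton]
      omega
    have h2 := (Finset.card_le_card h).trans Finset.card_le_two
    exact_mod_cast h2
  · intro k hk
    rw [Finset.mem_Icc] at hk
    rw [Finset.mem_range]
    omega

/-- The second moment of a sum of random elements whose covariances decay with the lag. -/
theorem integral_norm_sum_sq_le {V : ℤ → Ω → E} (hV : ∀ i, MemLp (V i) 2 P) {c : ℕ → ℝ}
    (hc : ∀ (i : ℤ) (d : ℕ), |∫ ω, inner ℝ (V i ω) (V (i + d) ω) ∂P| ≤ c d) (N : ℕ) :
    ∫ ω, ‖∑ i ∈ Finset.Icc (1 : ℤ) N, V i ω‖ ^ 2 ∂P ≤ N * (2 * ∑ d ∈ Finset.range N, c d) := by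
  have hc0 : ∀ d, 0 ≤ c d := fun d => (abs_nonneg _).trans (hc 0 d)
  have hc' : ∀ i k : ℤ, ∫ ω, inner ℝ (V i ω) (V k ω) ∂P ≤ c (k - i).natAbs := by
    intro i k
    rcases le_total i k with h | h
    · have h1 := hc i (k - i).natAbs
      have h2 : i + ((k - i).natAbs : ℤ) = k := by omega
      rw [h2] at h1
      exact (le_abs_self _).trans h1
    · have h1 := hc k (k - i).natAbs
      have h2 : k + ((k - i).natAbs : ℤ) = i := by omega
      rw [h2] at h1
      simp only [real_inner_comm] at h1 ⊢
      exact (le_abs_self _).trans h1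
  have h1 : ∫ ω, ‖∑ i ∈ Finset.Icc (1 : ℤ) N, V i ω‖ ^ 2 ∂P =
      ∑ i ∈ Finset.Icc (1 : ℤ) N, ∑ k ∈ Finset.Icc (1 : ℤ) N, ∫ ω, inner ℝ (V i ω) (V k ω) ∂P := by
    simp only [← real_inner_self_eq_norm_sq, sum_inner, inner_sum]
    rw [integral_finsetSum _ fun i _ => integrable_finsetSum _ fun k _ =>
      integrable_inner_of_memLp (hV _) (hV _)]
    refine Finset.sum_congr rfl fun i _ => ?_
    rw [integral_finsetSum _ fun k _ => integrable_inner_of_memLp (hV _) (hV _)]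
    exact Finset.sum_congr rfl fun k _ =>
      integral_congr_ae (Eventually.of_forall fun ω => real_inner_comm _ _)
  rw [h1]
  calc _ ≤ ∑ i ∈ Finset.Icc (1 : ℤ) N, 2 * ∑ d ∈ Finset.range N, c d :=
        Finset.sum_le_sum fun i hi =>
          (Finset.sum_le_sum fun k _ => hc' i k).trans (sum_natAbs_sub_le hc0 N hi)
    _ = N * (2 * ∑ d ∈ Finset.range N, c d) := by
        rw [Finset.sum_const, nsmul_eq_mul]; simp

end SecondMoments

/-! ### Decoupling functionals of the past -/

section Functionals

variable {Ω S : Type*} [MeasurableSpace Ω] [MeasurableSpace S] {P : Measure Ω}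
  {e : ℤ → Ω → S} {es : ℤ → ℕ → ℤ → Ω → S} {E : Type*} [NormedAddCommGroup E]

/-- The coefficient `‖F(ϵ_0, ϵ_{-1}, …) - F(ϵ_0, …, ϵ_{-l+1}, ϵ*, …)‖` in `L²`. -/
def depCoef (P : Measure Ω) (e : ℤ → Ω → S) (F : (ℕ → S) → E) (l : ℕ) : ℝ :=
  rms (pairLaw P e l) fun z => F z.1 - F z.2

theorem depCoef_nonneg (F : (ℕ → S) → E) (l : ℕ) : 0 ≤ depCoef P e F l := rms_nonneg _

namespace IsInnovationSystem

variable {F G : (ℕ → S) → E}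

theorem isProbabilityMeasure_pastLaw [IsProbabilityMeasure P] (he : IsInnovationSystem P e es) :
    IsProbabilityMeasure (pastLaw P e) :=
  Measure.isProbabilityMeasure_map (he.measurable_past 0).aemeasurable

theorem memLp_past (he : IsInnovationSystem P e es) {p : ENNReal}
    (hF : MemLp F p (pastLaw P e)) (i : ℤ) : MemLp (fun ω => F (past e i ω)) p P := by
  rw [← he.map_past i] at hF
  exact hF.comp_of_map (he.measurable_past i).aemeasurable

theorem memLp_coupledPast (he : IsInnovationSystem P e es) {p : ENNReal}
    (hF : MemLp F p (pastLaw P e)) (i : ℤ) (l : ℕ) :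
    MemLp (fun ω => F (coupledPast e es i l ω)) p P := by
  rw [← he.map_coupledPast i l] at hF
  exact hF.comp_of_map (he.measurable_coupledPast i l).aemeasurable

theorem rms_past (he : IsInnovationSystem P e es) (hF : StronglyMeasurable F) (i : ℤ) :
    rms P (fun ω => F (past e i ω)) = rms (pastLaw P e) F := by
  rw [← he.map_past i, rms_map (he.measurable_past i) hF]

theorem rms_coupledPast (he : IsInnovationSystem P e es) (hF : StronglyMeasurable F) (i : ℤ)
    (l : ℕ) : rms P (fun ω => F (coupledPast e es i l ω)) = rms (pastLaw P e) F := by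
  rw [← he.map_coupledPast i l, rms_map (he.measurable_coupledPast i l) hF]

theorem integral_past [NormedSpace ℝ E] (he : IsInnovationSystem P e es)
    (hF : StronglyMeasurable F) (i : ℤ) :
    ∫ ω, F (past e i ω) ∂P = ∫ x, F x ∂(pastLaw P e) := by
  rw [← he.map_past i, integral_map (he.measurable_past i).aemeasurable hF.aestronglyMeasurable]

theorem integral_coupledPast [NormedSpace ℝ E] (he : IsInnovationSystem P e es)
    (hF : StronglyMeasurable F) (i : ℤ) (l : ℕ) :
    ∫ ω, F (coupledPast e es i l ω) ∂P = ∫ x, F x ∂(pastLaw P e) := by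
  rw [← he.map_coupledPast i l,
    integral_map (he.measurable_coupledPast i l).aemeasurable hF.aestronglyMeasurable]

theorem stronglyMeasurable_sub (hF : StronglyMeasurable F) :
    StronglyMeasurable fun z : (ℕ → S) × (ℕ → S) => F z.1 - F z.2 :=
  (hF.comp_measurable measurable_fst).sub (hF.comp_measurable measurable_snd)

theorem rms_past_sub_coupledPast (he : IsInnovationSystem P e es) (hF : StronglyMeasurable F)
    (i : ℤ) (l : ℕ) :
    rms P (fun ω => F (past e i ω) - F (coupledPast e es i l ω)) = depCoef P e F l := by
  rw [depCoef, ← he.map_past_coupledPast i l,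
    rms_map ((he.measurable_past i).prodMk (he.measurable_coupledPast i l))
      (stronglyMeasurable_sub hF)]

theorem rms_coupledPast_sub_coupledPast (he : IsInnovationSystem P e es)
    (hF : StronglyMeasurable F) (i : ℤ) {l d : ℕ} (hd : d < l) :
    rms P (fun ω => F (coupledPast e es i l ω) - F (coupledPast e es i d ω)) =
      depCoef P e F d := by
  rw [depCoef, ← he.map_coupledPast_coupledPast i hd,
    rms_map ((he.measurable_coupledPast i l).prodMk (he.measurable_coupledPast i d))
      (stronglyMeasurable_sub hF)]

theorem rms_shift_past_sub_coupledPast (he : IsInnovationSystem P e es)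
    (hF : StronglyMeasurable F) (i : ℤ) {l n : ℕ} (hn : n ≤ l) :
    rms P (fun ω => F (fun k => past e i ω (k + n)) - F (fun k => coupledPast e es i l ω (k + n))) =
      depCoef P e F (l - n) := by
  have h1 : ∀ {f : Ω → ℕ → S}, Measurable f → Measurable fun ω k => f ω (k + n) := fun hf =>
    measurable_pi_lambda _ fun k => (measurable_pi_apply _).comp hf
  rw [depCoef, ← he.map_shift_past_coupledPast i hn,
    rms_map ((h1 (he.measurable_past i)).prodMk (h1 (he.measurable_coupledPast i l)))
      (stronglyMeasurable_sub hF)]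

theorem disjoint_pastIdx_coupledIdx {i k : ℤ} {l : ℕ} (h : i + l ≤ k) :
    Disjoint (pastIdx i) (coupledIdx k l) := by
  rw [Set.disjoint_left]
  rintro (j | j) h1 h2
  · simp only [inl_mem_pastIdx, inl_mem_coupledIdx] at h1 h2; omega
  · simp at h1

theorem indepFun_past_coupledPast (he : IsInnovationSystem P e es) {i k : ℤ} {l : ℕ}
    (h : i + l ≤ k) : IndepFun (past e i) (coupledPast e es k l) P :=
  he.indepFun (disjoint_pastIdx_coupledIdx h) (measurable_past_sigmaOf Set.Subset.rfl)
    (measurable_coupledPast_sigmaOf Set.Subset.rfl)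

/-- The covariance bound that replaces mixing for functionals of the innovations. -/
theorem abs_integral_inner_past_le [InnerProductSpace ℝ E] [CompleteSpace E]
    [IsProbabilityMeasure P]
    (he : IsInnovationSystem P e es) (hG : StronglyMeasurable G)
    (hF : StronglyMeasurable F) (hF2 : MemLp F 2 (pastLaw P e)) (hG2 : MemLp G 2 (pastLaw P e))
    (hG0 : ∫ x, G x ∂(pastLaw P e) = 0) (i : ℤ) (l : ℕ) :
    |∫ ω, inner ℝ (F (past e i ω)) (G (past e (i + l) ω)) ∂P| ≤
      rms (pastLaw P e) F * depCoef P e G l := by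
  have := he.isProbabilityMeasure_pastLaw
  -- The coupled past at i + l uses only the innovations i + 1, …, i + l and copies, so the
  -- expectation factorises and G is centred. Subtracting this zero leaves G minus its coupled
  -- version.
  have h0 : ∫ ω, inner ℝ (F (past e i ω)) (G (coupledPast e es (i + l) l ω)) ∂P = 0 := by
    have h1 := (he.indepFun_past_coupledPast (le_refl (i + (l : ℤ)))).integral_bilin_comp_comp
      (f := F) (g := G) (he.measurable_past i).aemeasurable
      (he.measurable_coupledPast (i + l) l).aemeasurable
      (by rw [he.map_past]; exact hF2.integrable one_le_two)
      (by rw [he.map_coupledPast]; exact hG2.integrable one_le_two) (innerSL ℝ (E := E))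
    rw [he.integral_coupledPast hG, hG0, map_zero] at h1
    exact h1
  have hm1 := he.memLp_past hF2 i
  have hm2 := he.memLp_past hG2 (i + l)
  have hm3 := he.memLp_coupledPast hG2 (i + l) l
  have h2 : ∫ ω, inner ℝ (F (past e i ω)) (G (past e (i + l) ω)) ∂P =
      ∫ ω, inner ℝ (F (past e i ω))
        (G (past e (i + l) ω) - G (coupledPast e es (i + l) l ω)) ∂P := by
    simp only [inner_sub_right]
    rw [integral_sub (integrable_inner_of_memLp hm1 hm2) (integrable_inner_of_memLp hm1 hm3), h0,
      sub_zero]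
  rw [h2, ← he.rms_past hF i, ← he.rms_past_sub_coupledPast hG (i + l) l]
  exact abs_integral_inner_le hm1 (hm2.sub hm3)

theorem integral_norm_sum_past_sq_le [InnerProductSpace ℝ E] [CompleteSpace E]
    [IsProbabilityMeasure P]
    (he : IsInnovationSystem P e es) (hF : StronglyMeasurable F) (hF2 : MemLp F 2 (pastLaw P e))
    (hF0 : ∫ x, F x ∂(pastLaw P e) = 0) (N : ℕ) :
    ∫ ω, ‖∑ i ∈ Finset.Icc (1 : ℤ) N, F (past e i ω)‖ ^ 2 ∂P ≤
      N * (2 * ∑ d ∈ Finset.range N, rms (pastLaw P e) F * depCoef P e F d) :=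
  integral_norm_sum_sq_le (V := fun i ω => F (past e i ω)) (fun i => he.memLp_past hF2 i)
    (fun i d => he.abs_integral_inner_past_le hF hF hF2 hF2 hF0 i d) N

end IsInnovationSystem

end Functionals

/-! ### Sample autocovariances of functionals of the past -/

theorem real_inner_eq_mul (x y : ℝ) : inner ℝ x y = x * y := by
  simp [mul_comm]

section Autocovariance

variable {Ω S : Type*} [MeasurableSpace Ω] [MeasurableSpace S] {P : Measure Ω}
  {e : ℤ → Ω → S} {es : ℤ → ℕ → ℤ → Ω → S} {F G : (ℕ → S) → ℝ}

/-- A bound for the covariances of the decoupled products. -/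
def prodCoef (P : Measure Ω) (e : ℤ → Ω → S) (F G : (ℕ → S) → ℝ) (d : ℕ) : ℝ :=
  rms (pastLaw P e) F ^ 2 * rms (pastLaw P e) G *
    if d = 0 then rms (pastLaw P e) G else depCoef P e G d

namespace IsInnovationSystem

theorem memLp_past_mul_coupledPast (he : IsInnovationSystem P e es)
    (hF : StronglyMeasurable F) (hG : StronglyMeasurable G)
    (hF2 : MemLp F 2 (pastLaw P e)) (hG2 : MemLp G 2 (pastLaw P e)) (i : ℤ) (l : ℕ) :
    MemLp (fun ω => F (past e i ω) * G (coupledPast e es (i + l) l ω)) 2 P :=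
  memLp_mul_of_indepFun
    ((he.indepFun_past_coupledPast le_rfl).comp hF.measurable hG.measurable)
    (he.memLp_past hF2 i) (he.memLp_coupledPast hG2 _ _)

theorem rms_past_mul_coupledPast (he : IsInnovationSystem P e es)
    (hF : StronglyMeasurable F) (hG : StronglyMeasurable G)
    (hF2 : MemLp F 2 (pastLaw P e)) (hG2 : MemLp G 2 (pastLaw P e)) (i : ℤ) (l : ℕ) :
    rms P (fun ω => F (past e i ω) * G (coupledPast e es (i + l) l ω)) =
      rms (pastLaw P e) F * rms (pastLaw P e) G := by
  rw [← he.rms_past hF i, ← he.rms_coupledPast hG (i + l) l]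
  exact rms_mul_of_indepFun
    ((he.indepFun_past_coupledPast le_rfl).comp hF.measurable hG.measurable)
    (he.memLp_past hF2 i).1 (he.memLp_coupledPast hG2 _ _).1

/-- Writing V_i for the decoupled product, Cauchy–Schwarz suffices for d = 0. For d ≥ l the last
factor of V_{i+d} is centred and independent of all the others, so the covariance vanishes. For 0 <
d < l this fails, and the last factor is recoupled at the shorter lag d. The bound does not depend
on l. -/
theorem abs_integral_prod_le [IsProbabilityMeasure P] (he : IsInnovationSystem P e es)
    (hF : StronglyMeasurable F) (hG : StronglyMeasurable G)
    (hF2 : MemLp F 2 (pastLaw P e)) (hG2 : MemLp G 2 (pastLaw P e))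
    (hG0 : ∫ x, G x ∂(pastLaw P e) = 0) (l : ℕ) (i : ℤ) (d : ℕ) :
    |∫ ω, inner ℝ (F (past e i ω) * G (coupledPast e es (i + l) l ω))
      (F (past e (i + d) ω) * G (coupledPast e es (i + d + l) l ω)) ∂P| ≤ prodCoef P e F G d := by
  set V : ℤ → Ω → ℝ := fun i ω => F (past e i ω) * G (coupledPast e es (i + l) l ω) with hV
  have hV2 : ∀ i, MemLp (V i) 2 P := fun i => he.memLp_past_mul_coupledPast hF hG hF2 hG2 i l
  have hVr : ∀ i, rms P (V i) = rms (pastLaw P e) F * rms (pastLaw P e) G := fun i =>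
    he.rms_past_mul_coupledPast hF hG hF2 hG2 i l
  change |∫ ω, inner ℝ (V i ω) (V (i + d) ω) ∂P| ≤ _
  have hσF := rms_nonneg (P := pastLaw P e) F
  have hσG := rms_nonneg (P := pastLaw P e) G
  have hδ := depCoef_nonneg (P := P) (e := e) G d
  rw [prodCoef]
  split_ifs with hd
  · subst hd
    refine (abs_integral_inner_le (hV2 _) (hV2 _)).trans ?_
    rw [hVr, hVr]
    exact le_of_eq (by ring)
  simp only [real_inner_eq_mul]
  rcases lt_or_ge d l with hdl | hdl
  · set Y : Ω → ℝ := fun ω => G (coupledPast e es (i + d + l) l ω) with hY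
    set Y' : Ω → ℝ := fun ω => G (coupledPast e es (i + d + l) d ω) with hY'
    set A : Ω → ℝ := fun ω => F (past e (i + d) ω) with hA
    have hA2 : MemLp A 2 P := he.memLp_past hF2 _
    have hY2 : MemLp Y 2 P := he.memLp_coupledPast hG2 _ _
    have hY2' : MemLp Y' 2 P := he.memLp_coupledPast hG2 _ _
    -- Y' uses only innovations after i + l and its own copies, whereas V_i and A use innovations up
    -- to i + l and the copies of (i + l, l). Hence V_i A Y' integrates to zero and Y may be
    -- replaced by Y − Y'.
    have hind : IndepFun (fun ω => V i ω * A ω) Y' P := by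
      refine he.indepFun (T := pastIdx (i + l) ∪ coupledIdx (i + l) l)
        (T' := coupledIdx (i + d + l) d) ?_ ?_ ?_
      · rw [Set.disjoint_left]
        rintro (j | j) h1 h2
        · simp only [Set.mem_union, inl_mem_pastIdx, inl_mem_coupledIdx] at h1 h2; omega
        · simp only [Set.mem_union, inr_mem_pastIdx, inr_mem_coupledIdx, false_or] at h1 h2; omega
      · refine Measurable.mul (Measurable.mul ?_ ?_) ?_
        · refine hF.measurable.comp (measurable_past_sigmaOf ?_)
          rintro (j | j) h1
          · simp only [Set.mem_union, inl_mem_pastIdx, inl_mem_coupledIdx] at h1 ⊢; omega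
          · simp at h1
        · exact hG.measurable.comp (measurable_coupledPast_sigmaOf Set.subset_union_right)
        · refine hF.measurable.comp (measurable_past_sigmaOf ?_)
          rintro (j | j) h1
          · simp only [Set.mem_union, inl_mem_pastIdx, inl_mem_coupledIdx] at h1 ⊢; omega
          · simp at h1
      · exact hG.measurable.comp (measurable_coupledPast_sigmaOf Set.Subset.rfl)
    have hVA : Integrable (fun ω => V i ω * A ω) P := (hV2 i).integrable_mul hA2
    have h0 : ∫ ω, V i ω * A ω * Y' ω ∂P = 0 := by
      rw [hind.integral_fun_mul_eq_mul_integral hVA.1 hY2'.1, he.integral_coupledPast hG, hG0,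
        mul_zero]
    -- Both Y and Y' see only innovations after i + d, so the L² norm of A(Y − Y') factorises into
    -- ‖F‖ δ_d(G).
    have hind2 : IndepFun A (fun ω => Y ω - Y' ω) P := by
      refine he.indepFun (T := pastIdx (i + d))
        (T' := coupledIdx (i + d + l) l ∪ coupledIdx (i + d + l) d) ?_ ?_ ?_
      · rw [Set.disjoint_left]
        rintro (j | j) h1 h2
        · simp only [Set.mem_union, inl_mem_pastIdx, inl_mem_coupledIdx] at h1 h2; omega
        · simp at h1
      · exact hF.measurable.comp (measurable_past_sigmaOf Set.Subset.rfl)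
      · exact (hG.measurable.comp
          (measurable_coupledPast_sigmaOf Set.subset_union_left)).sub
          (hG.measurable.comp (measurable_coupledPast_sigmaOf Set.subset_union_right))
    have hYY : MemLp (fun ω => Y ω - Y' ω) 2 P := hY2.sub hY2'
    have hAY : MemLp (fun ω => A ω * (Y ω - Y' ω)) 2 P := memLp_mul_of_indepFun hind2 hA2 hYY
    have h1 : ∫ ω, V i ω * V (i + d) ω ∂P =
        ∫ ω, inner ℝ (V i ω) (A ω * (Y ω - Y' ω)) ∂P := by
      have hI1 : Integrable (fun ω => V i ω * A ω * Y' ω) P :=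
        hind.integrable_mul hVA (hY2'.integrable one_le_two)
      have hI2 : Integrable (fun ω => V i ω * V (i + d) ω) P := (hV2 _).integrable_mul (hV2 _)
      rw [← sub_zero (∫ ω, V i ω * V (i + d) ω ∂P), ← h0, ← integral_sub hI2 hI1]
      refine integral_congr_ae (Eventually.of_forall fun ω => ?_)
      simp only [real_inner_eq_mul, hV, hA, hY, hY']
      ring
    rw [h1]
    refine (abs_integral_inner_le (hV2 _) hAY).trans ?_
    rw [hVr, rms_mul_of_indepFun hind2 hA2.1 hYY.1, he.rms_past hF,
      he.rms_coupledPast_sub_coupledPast hG _ hdl]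
    exact le_of_eq (by ring)
  · have hind : IndepFun (fun ω => V i ω * F (past e (i + d) ω))
        (fun ω => G (coupledPast e es (i + d + l) l ω)) P := by
      refine he.indepFun (T := pastIdx (i + d) ∪ coupledIdx (i + l) l)
        (T' := coupledIdx (i + d + l) l) ?_ ?_ ?_
      · rw [Set.disjoint_left]
        rintro (j | j) h1 h2
        · simp only [Set.mem_union, inl_mem_pastIdx, inl_mem_coupledIdx] at h1 h2; omega
        · simp only [Set.mem_union, inr_mem_pastIdx, inr_mem_coupledIdx, false_or] at h1 h2; omega
      · refine Measurable.mul (Measurable.mul ?_ ?_) ?_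
        · refine hF.measurable.comp (measurable_past_sigmaOf ?_)
          rintro (j | j) h1
          · simp only [Set.mem_union, inl_mem_pastIdx, inl_mem_coupledIdx] at h1 ⊢; omega
          · simp at h1
        · exact hG.measurable.comp (measurable_coupledPast_sigmaOf Set.subset_union_right)
        · exact hF.measurable.comp (measurable_past_sigmaOf Set.subset_union_left)
      · exact hG.measurable.comp (measurable_coupledPast_sigmaOf Set.Subset.rfl)
    have hVA : Integrable (fun ω => V i ω * F (past e (i + d) ω)) P :=
      (hV2 i).integrable_mul (he.memLp_past hF2 _)
    have h0 : ∫ ω, V i ω * V (i + d) ω ∂P = 0 := by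
      have h1 := hind.integral_fun_mul_eq_mul_integral hVA.1 (he.memLp_coupledPast hG2 _ _).1
      rw [he.integral_coupledPast hG, hG0, mul_zero] at h1
      rw [← h1]
      refine integral_congr_ae (Eventually.of_forall fun ω => ?_)
      simp only [hV]
      ring
    rw [h0, abs_zero]
    positivity

/-- Makes the variance of a sum of N decoupled products O(N), with a constant that is free of both
the lag and N. -/
theorem sum_prodCoef_le (hG : Summable (depCoef P e G)) (N : ℕ) :
    ∑ d ∈ Finset.range N, prodCoef P e F G d ≤
      rms (pastLaw P e) F ^ 2 * rms (pastLaw P e) G *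
        (rms (pastLaw P e) G + ∑' d, depCoef P e G d) := by
  have hσG := rms_nonneg (P := pastLaw P e) G
  simp only [prodCoef]
  rw [← Finset.mul_sum]
  refine mul_le_mul_of_nonneg_left ?_ (by positivity)
  have h1 : ∀ d ∈ Finset.range N,
      (if d = 0 then rms (pastLaw P e) G else depCoef P e G d) ≤
        (if d = 0 then rms (pastLaw P e) G else 0) + depCoef P e G d := by
    intro d _
    have := depCoef_nonneg (P := P) (e := e) G d
    split_ifs <;> linarith
  refine (Finset.sum_le_sum h1).trans ?_
  rw [Finset.sum_add_distrib]
  refine add_le_add ?_ (hG.sum_le_tsum _ fun d _ => depCoef_nonneg G d)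
  rw [Finset.sum_ite_eq']
  split_ifs <;> linarith

/-- A uniform bound for the first moment of a sum of lagged products. -/
theorem integral_abs_sum_past_mul_past_le [IsProbabilityMeasure P]
    (he : IsInnovationSystem P e es)
    (hF : StronglyMeasurable F) (hG : StronglyMeasurable G)
    (hF2 : MemLp F 2 (pastLaw P e)) (hG2 : MemLp G 2 (pastLaw P e))
    (hG0 : ∫ x, G x ∂(pastLaw P e) = 0) (hGs : Summable (depCoef P e G)) (l N : ℕ) :
    ∫ ω, |∑ i ∈ Finset.Icc (1 : ℤ) N, F (past e i ω) * G (past e (i + l) ω)| ∂P ≤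
      N * (rms (pastLaw P e) F * depCoef P e G l) +
      √(N * (2 * (rms (pastLaw P e) F ^ 2 * rms (pastLaw P e) G *
        (rms (pastLaw P e) G + ∑' d, depCoef P e G d)))) := by
  -- V is the decoupled product, controlled through its variance. The remainder R is small in L¹
  -- term by term, by Cauchy–Schwarz.
  set V : ℤ → Ω → ℝ := fun i ω => F (past e i ω) * G (coupledPast e es (i + l) l ω) with hV
  set R : ℤ → Ω → ℝ := fun i ω => F (past e i ω) *
    (G (past e (i + l) ω) - G (coupledPast e es (i + l) l ω)) with hR
  have hV2 : ∀ i, MemLp (V i) 2 P := fun i => he.memLp_past_mul_coupledPast hF hG hF2 hG2 i l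
  have hA2 : ∀ i, MemLp (fun ω => F (past e i ω)) 2 P := fun i => he.memLp_past hF2 i
  have hD2 : ∀ i : ℤ, MemLp (fun ω => G (past e (i + l) ω) -
      G (coupledPast e es (i + l) l ω)) 2 P := fun i =>
    (he.memLp_past hG2 _).sub (he.memLp_coupledPast hG2 _ _)
  have hR1 : ∀ i, Integrable (R i) P := fun i => (hA2 i).integrable_mul (hD2 i)
  have hSV : MemLp (fun ω => ∑ i ∈ Finset.Icc (1 : ℤ) N, V i ω) 2 P :=
    memLp_finsetSum _ fun i _ => hV2 i
  have h1 : ∀ ω, |∑ i ∈ Finset.Icc (1 : ℤ) N, F (past e i ω) * G (past e (i + l) ω)| ≤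
      (∑ i ∈ Finset.Icc (1 : ℤ) N, ‖R i ω‖) + ‖∑ i ∈ Finset.Icc (1 : ℤ) N, V i ω‖ := by
    intro ω
    have h2 : ∑ i ∈ Finset.Icc (1 : ℤ) N, F (past e i ω) * G (past e (i + l) ω) =
        ∑ i ∈ Finset.Icc (1 : ℤ) N, R i ω + ∑ i ∈ Finset.Icc (1 : ℤ) N, V i ω := by
      rw [← Finset.sum_add_distrib]
      refine Finset.sum_congr rfl fun i _ => ?_
      simp only [hR, hV]; ring
    rw [h2, ← Real.norm_eq_abs]
    exact (norm_add_le _ _).trans (add_le_add (norm_sum_le _ _) le_rfl)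
  have hIR : Integrable (fun ω => ∑ i ∈ Finset.Icc (1 : ℤ) N, ‖R i ω‖) P :=
    integrable_finsetSum _ fun i _ => (hR1 i).norm
  have hIV : Integrable (fun ω => ‖∑ i ∈ Finset.Icc (1 : ℤ) N, V i ω‖) P :=
    (hSV.integrable one_le_two).norm
  refine (integral_mono_of_nonneg (Eventually.of_forall fun _ => abs_nonneg _) (hIR.add hIV)
    (Eventually.of_forall h1)).trans ?_
  simp only [Pi.add_apply]
  rw [integral_add hIR hIV]
  refine add_le_add ?_ ?_
  · rw [integral_finsetSum _ fun i _ => (hR1 i).norm]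
    calc _ ≤ ∑ i ∈ Finset.Icc (1 : ℤ) N, rms (pastLaw P e) F * depCoef P e G l := by
          refine Finset.sum_le_sum fun i _ => ?_
          rw [← he.rms_past hF i, ← he.rms_past_sub_coupledPast hG (i + l) l]
          simp only [hR, norm_mul]
          exact integral_norm_mul_norm_le (hA2 i) (hD2 i)
      _ = _ := by rw [Finset.sum_const, nsmul_eq_mul]; simp
  · refine (integral_norm_le_rms hSV).trans (Real.sqrt_le_sqrt ?_)
    refine (integral_norm_sum_sq_le hV2
      (fun i d => he.abs_integral_prod_le hF hG hF2 hG2 hG0 l i d) N).trans ?_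
    have := sum_prodCoef_le (F := F) hGs N
    gcongr

end IsInnovationSystem

end Autocovariance

/-! ### Laws of large numbers in `L¹` -/

/-- The truncation of `x` to `[-t, t]`. -/
def clamp (t x : ℝ) : ℝ := max (-t) (min x t)

theorem abs_clamp_sub_clamp_le (t x y : ℝ) : |clamp t x - clamp t y| ≤ |x - y| := by
  have h1 := abs_min_sub_min_le_max x t y t
  have h2 := abs_max_sub_max_le_max (-t) (min x t) (-t) (min y t)
  rw [sub_self, abs_zero, max_eq_left (abs_nonneg _)] at h1
  rw [sub_self, abs_zero, max_eq_right (abs_nonneg (min x t - min y t))] at h2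
  exact h2.trans h1

theorem abs_clamp_le {t : ℝ} (ht : 0 ≤ t) (x : ℝ) : |clamp t x| ≤ t := by
  rw [abs_le]
  exact ⟨le_max_left _ _, max_le (by linarith) (min_le_right _ _)⟩

theorem clamp_eq_self {t x : ℝ} (h : |x| ≤ t) : clamp t x = x := by
  rw [abs_le] at h
  rw [clamp, min_eq_left h.2, max_eq_right h.1]

theorem abs_clamp_le_abs {t : ℝ} (ht : 0 ≤ t) (x : ℝ) : |clamp t x| ≤ |x| := by
  have h := abs_clamp_sub_clamp_le t x 0
  rwa [clamp_eq_self (x := 0) (by simpa using ht), sub_zero, sub_zero] at h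

theorem continuous_clamp (t : ℝ) : Continuous (clamp t) := by
  unfold clamp; fun_prop

section LawOfLargeNumbers

variable {Ω S : Type*} [MeasurableSpace Ω] [MeasurableSpace S] {P : Measure Ω}
  {e : ℤ → Ω → S} {es : ℤ → ℕ → ℤ → Ω → S}

namespace IsInnovationSystem

/-- The second moment of the average is at most (2σ/N) Σ_{d<N} δ_d, a Cesàro mean, so δ_d → 0 is
enough. -/
theorem tendsto_integral_abs_sum_of_depCoef [IsProbabilityMeasure P]
    (he : IsInnovationSystem P e es) {H : (ℕ → S) → ℝ} (hH : StronglyMeasurable H)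
    (hH2 : MemLp H 2 (pastLaw P e)) (hHδ : Tendsto (depCoef P e H) atTop (𝓝 0)) (m : ℤ) :
    Tendsto (fun N : ℕ => (N : ℝ)⁻¹ * ∫ ω, |∑ i ∈ Finset.Icc (1 : ℤ) N,
      (H (past e (i + m) ω) - ∫ x, H x ∂(pastLaw P e))| ∂P) atTop (𝓝 0) := by
  have := he.isProbabilityMeasure_pastLaw
  set c := ∫ x, H x ∂(pastLaw P e) with hc
  set H0 : (ℕ → S) → ℝ := fun x => H x - c with hH0def
  have hH0 : StronglyMeasurable H0 := hH.sub stronglyMeasurable_const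
  have hH02 : MemLp H0 2 (pastLaw P e) := hH2.sub (memLp_const c)
  have hH00 : ∫ x, H0 x ∂(pastLaw P e) = 0 := by
    simp only [hH0def]
    rw [integral_sub (hH2.integrable one_le_two) (integrable_const c), ← hc]
    simp
  have hδ : depCoef P e H0 = depCoef P e H := by
    ext l
    refine rms_congr fun z => ?_
    simp [hH0def]
  set σ := rms (pastLaw P e) H0
  have hb : ∀ N : ℕ, (N : ℝ)⁻¹ * ∫ ω, |∑ i ∈ Finset.Icc (1 : ℤ) N, H0 (past e (i + m) ω)| ∂P ≤
      √(2 * σ * ((N : ℝ)⁻¹ * ∑ d ∈ Finset.range N, depCoef P e H d)) := by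
    intro N
    have hm : ∀ i : ℤ, MemLp (fun ω => H0 (past e (i + m) ω)) 2 P := fun i =>
      he.memLp_past hH02 _
    have h1 : ∫ ω, |∑ i ∈ Finset.Icc (1 : ℤ) N, H0 (past e (i + m) ω)| ∂P ≤
        √(N * (2 * ∑ d ∈ Finset.range N, σ * depCoef P e H0 d)) := by
      have hs : MemLp (fun ω => ∑ i ∈ Finset.Icc (1 : ℤ) N, H0 (past e (i + m) ω)) 2 P :=
        memLp_finsetSum _ fun i _ => hm i
      refine (integral_norm_le_rms hs).trans (Real.sqrt_le_sqrt ?_)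
      refine integral_norm_sum_sq_le (V := fun i ω => H0 (past e (i + m) ω)) hm (fun i d => ?_) N
      have := he.abs_integral_inner_past_le hH0 hH0 hH02 hH02 hH00 (i + m) d
      rwa [show i + m + (d : ℤ) = i + d + m by ring] at this
    rw [hδ] at h1
    rcases Nat.eq_zero_or_pos N with rfl | hN
    · simp
    have hN' : (0 : ℝ) < N := by exact_mod_cast hN
    calc _ ≤ (N : ℝ)⁻¹ * √(N * (2 * ∑ d ∈ Finset.range N, σ * depCoef P e H d)) := by gcongr
      _ = √((N : ℝ)⁻¹ ^ 2 * (N * (2 * ∑ d ∈ Finset.range N, σ * depCoef P e H d))) := by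
        rw [Real.sqrt_mul (sq_nonneg _), Real.sqrt_sq (by positivity)]
      _ = _ := by
        rw [← Finset.mul_sum]
        congr 1
        field_simp
  have hlim : Tendsto (fun N : ℕ => √(2 * σ * ((N : ℝ)⁻¹ *
      ∑ d ∈ Finset.range N, depCoef P e H d))) atTop (𝓝 0) := by
    have h1 := (hHδ.cesaro.const_mul (2 * σ)).sqrt
    simpa using h1
  exact squeeze_zero (fun N => mul_nonneg (by positivity)
    (integral_nonneg fun _ => abs_nonneg _)) hb hlim

/-- J need not be square integrable. By stationarity, replacing J by H changes the normalised L¹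
norm by at most ‖J − H‖₁ for the functional plus the same for its mean, uniformly in N. -/
theorem tendsto_integral_abs_sum_past [IsProbabilityMeasure P]
    (he : IsInnovationSystem P e es) {J : (ℕ → S) → ℝ} (hJ : StronglyMeasurable J)
    (hJ1 : Integrable J (pastLaw P e))
    (happ : ∀ ε : ℝ, 0 < ε → ∃ H : (ℕ → S) → ℝ, StronglyMeasurable H ∧ MemLp H 2 (pastLaw P e) ∧
      Tendsto (depCoef P e H) atTop (𝓝 0) ∧ ∫ x, |J x - H x| ∂(pastLaw P e) ≤ ε) (m : ℤ) :
    Tendsto (fun N : ℕ => (N : ℝ)⁻¹ * ∫ ω, |∑ i ∈ Finset.Icc (1 : ℤ) N,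
      (J (past e (i + m) ω) - ∫ x, J x ∂(pastLaw P e))| ∂P) atTop (𝓝 0) := by
  have := he.isProbabilityMeasure_pastLaw
  rw [Metric.tendsto_atTop]
  intro ε hε
  -- Three errors of at most ε/4 each: J against H, the centred sum of H, and the difference of the
  -- means.
  obtain ⟨H, hH, hH2, hHδ, hJH⟩ := happ (ε / 4) (by positivity)
  have hH1 : Integrable H (pastLaw P e) := hH2.integrable one_le_two
  obtain ⟨N0, hN0⟩ := Metric.tendsto_atTop.1
    (he.tendsto_integral_abs_sum_of_depCoef hH hH2 hHδ m) (ε / 4) (by positivity)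
  refine ⟨max N0 1, fun N hN => ?_⟩
  have hNpos : (0 : ℝ) < N := by
    have : 1 ≤ N := (le_max_right _ _).trans hN
    exact_mod_cast this
  have h1 := hN0 N ((le_max_left _ _).trans hN)
  have hnn : ∀ f : Ω → ℝ, 0 ≤ (N : ℝ)⁻¹ * ∫ ω, |f ω| ∂P := fun f =>
    mul_nonneg (by positivity) (integral_nonneg fun _ => abs_nonneg _)
  rw [Real.dist_0_eq_abs, abs_of_nonneg (hnn _)] at h1 ⊢
  set cJ := ∫ x, J x ∂(pastLaw P e) with hcJ
  set cH := ∫ x, H x ∂(pastLaw P e) with hcH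
  have hJp : ∀ i, Integrable (fun ω => J (past e i ω)) P := fun i =>
    memLp_one_iff_integrable.1 (he.memLp_past (memLp_one_iff_integrable.2 hJ1) i)
  have hHp : ∀ i, Integrable (fun ω => H (past e i ω)) P := fun i =>
    (he.memLp_past hH2 i).integrable one_le_two
  have hc : |cH - cJ| ≤ ε / 4 := by
    rw [abs_sub_comm, hcJ, hcH, ← integral_sub hJ1 hH1]
    exact abs_integral_le_integral_abs.trans hJH
  have hpt : ∀ ω, |∑ i ∈ Finset.Icc (1 : ℤ) N, (J (past e (i + m) ω) - cJ)| ≤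
      (∑ i ∈ Finset.Icc (1 : ℤ) N, |J (past e (i + m) ω) - H (past e (i + m) ω)|) +
      |∑ i ∈ Finset.Icc (1 : ℤ) N, (H (past e (i + m) ω) - cH)| + N * (ε / 4) := by
    intro ω
    have h2 : ∑ i ∈ Finset.Icc (1 : ℤ) N, (J (past e (i + m) ω) - cJ) =
        ∑ i ∈ Finset.Icc (1 : ℤ) N, (J (past e (i + m) ω) - H (past e (i + m) ω)) +
        ∑ i ∈ Finset.Icc (1 : ℤ) N, (H (past e (i + m) ω) - cH) + N * (cH - cJ) := by
      have h3 : (N : ℝ) * (cH - cJ) = ∑ i ∈ Finset.Icc (1 : ℤ) N, (cH - cJ) := by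
        rw [Finset.sum_const, nsmul_eq_mul]; simp
      rw [h3, ← Finset.sum_add_distrib, ← Finset.sum_add_distrib]
      refine Finset.sum_congr rfl fun i _ => ?_
      ring
    rw [h2]
    refine (abs_add_three _ _ _).trans (add_le_add (add_le_add
      (Finset.abs_sum_le_sum_abs _ _) le_rfl) ?_)
    rw [abs_mul, abs_of_pos hNpos]
    gcongr
  have hI0 : ∀ i : ℤ, Integrable (fun ω => |J (past e (i + m) ω) - H (past e (i + m) ω)|) P :=
    fun i => ((hJp _).sub (hHp _)).abs
  have hI1 : Integrable (fun ω => ∑ i ∈ Finset.Icc (1 : ℤ) N,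
      |J (past e (i + m) ω) - H (past e (i + m) ω)|) P :=
    integrable_finsetSum _ fun i _ => hI0 i
  have hI2 : Integrable (fun ω => |∑ i ∈ Finset.Icc (1 : ℤ) N, (H (past e (i + m) ω) - cH)|) P :=
    (integrable_finsetSum _ fun i _ => (hHp _).sub (integrable_const cH)).abs
  have hI12 : Integrable (fun ω => (∑ i ∈ Finset.Icc (1 : ℤ) N,
      |J (past e (i + m) ω) - H (past e (i + m) ω)|) +
      |∑ i ∈ Finset.Icc (1 : ℤ) N, (H (past e (i + m) ω) - cH)|) P := hI1.add hI2
  have h3 : ∫ ω, |∑ i ∈ Finset.Icc (1 : ℤ) N, (J (past e (i + m) ω) - cJ)| ∂P ≤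
      N * (ε / 4) + ∫ ω, |∑ i ∈ Finset.Icc (1 : ℤ) N, (H (past e (i + m) ω) - cH)| ∂P +
      N * (ε / 4) := by
    refine (integral_mono_of_nonneg (Eventually.of_forall fun _ => abs_nonneg _)
      (hI12.add (integrable_const (N * (ε / 4)))) (Eventually.of_forall hpt)).trans ?_
    simp only [Pi.add_apply]
    rw [integral_add hI12 (integrable_const _), integral_add hI1 hI2,
      integral_finsetSum _ fun i _ => hI0 i]
    refine add_le_add (add_le_add ?_ le_rfl) (by simp)
    calc _ ≤ ∑ i ∈ Finset.Icc (1 : ℤ) N, ε / 4 := by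
          refine Finset.sum_le_sum fun i _ => ?_
          have h4 := he.integral_past (F := fun x => |J x - H x|) (hJ.sub hH).norm (i + m)
          exact h4.le.trans hJH
      _ = _ := by rw [Finset.sum_const, nsmul_eq_mul]; simp
  calc _ ≤ (N : ℝ)⁻¹ * (N * (ε / 4) +
        ∫ ω, |∑ i ∈ Finset.Icc (1 : ℤ) N, (H (past e (i + m) ω) - cH)| ∂P + N * (ε / 4)) := by
        gcongr
    _ = ε / 4 + (N : ℝ)⁻¹ * ∫ ω, |∑ i ∈ Finset.Icc (1 : ℤ) N, (H (past e (i + m) ω) - cH)| ∂P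
        + ε / 4 := by field_simp
    _ < ε := by linarith

theorem measurable_shift (l : ℕ) : Measurable fun (x : ℕ → S) (k : ℕ) => x (k + l) :=
  measurable_pi_lambda _ fun _ => measurable_pi_apply _

theorem memLp_shift (he : IsInnovationSystem P e es) {F : (ℕ → S) → ℝ}
    (hF : StronglyMeasurable F) (hF2 : MemLp F 2 (pastLaw P e)) (l : ℕ) :
    MemLp (fun x : ℕ → S => F fun k => x (k + l)) 2 (pastLaw P e) := by
  have hm : StronglyMeasurable fun x : ℕ → S => F fun k => x (k + l) :=
    hF.comp_measurable (measurable_shift l)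
  rw [← he.map_past ((0 : ℤ) + l), memLp_map_measure_iff hm.aestronglyMeasurable
    (he.measurable_past _).aemeasurable]
  have h : ((fun x : ℕ → S => F fun k => x (k + l)) ∘ past e ((0 : ℤ) + l)) =
      fun ω => F (past e 0 ω) := by
    ext ω
    simp only [Function.comp, past_add_shift]
  rw [h]
  exact he.memLp_past hF2 0

/-- The product of factors clamped at t is t-Lipschitz in each of them. The factor F reads the past
shifted by l, which loses l lags in its coefficient. -/
theorem depCoef_clamp_mul_clamp_le (he : IsInnovationSystem P e es) {F G : (ℕ → S) → ℝ}
    (hF : StronglyMeasurable F) (hG : StronglyMeasurable G)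
    (hF2 : MemLp F 2 (pastLaw P e)) (hG2 : MemLp G 2 (pastLaw P e)) {t : ℝ} (ht : 0 ≤ t)
    {l d : ℕ} (hd : l ≤ d) :
    depCoef P e (fun x => clamp t (F fun k => x (k + l)) * clamp t (G x)) d ≤
      t * (depCoef P e F (d - l) + depCoef P e G d) := by
  set H : (ℕ → S) → ℝ := fun x => clamp t (F fun k => x (k + l)) * clamp t (G x) with hH
  have hHm : StronglyMeasurable H :=
    ((continuous_clamp t).comp_stronglyMeasurable (hF.comp_measurable (measurable_shift l))).mul
      ((continuous_clamp t).comp_stronglyMeasurable hG)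
  have hFl := he.memLp_shift hF hF2 l
  set A : Ω → ℝ := fun ω => F (fun k => past e 0 ω (k + l)) -
    F (fun k => coupledPast e es 0 d ω (k + l)) with hA
  set B : Ω → ℝ := fun ω => G (past e 0 ω) - G (coupledPast e es 0 d ω) with hB
  have hA2 : MemLp (fun ω => ‖A ω‖) 2 P :=
    ((he.memLp_past hFl 0).sub (he.memLp_coupledPast hFl 0 d)).norm
  have hB2 : MemLp (fun ω => ‖B ω‖) 2 P :=
    ((he.memLp_past hG2 0).sub (he.memLp_coupledPast hG2 0 d)).norm
  rw [← he.rms_past_sub_coupledPast hHm 0 d, ← he.rms_past_sub_coupledPast hG 0 d,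
    ← he.rms_shift_past_sub_coupledPast hF 0 hd]
  have hAB : MemLp (fun ω => ‖A ω‖ + ‖B ω‖) 2 P := hA2.add hB2
  calc _ ≤ rms P (fun ω => t * (‖A ω‖ + ‖B ω‖)) := by
        refine rms_mono (hAB.const_mul t) fun ω => ?_
        rw [Real.norm_of_nonneg (by positivity : 0 ≤ t * (‖A ω‖ + ‖B ω‖))]
        have h1 := abs_clamp_sub_clamp_le t (F (fun k => past e 0 ω (k + l)))
          (F (fun k => coupledPast e es 0 d ω (k + l)))
        have h2 := abs_clamp_sub_clamp_le t (G (past e 0 ω)) (G (coupledPast e es 0 d ω))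
        have h3 := abs_clamp_le ht (G (past e 0 ω))
        have h4 := abs_clamp_le ht (F (fun k => coupledPast e es 0 d ω (k + l)))
        simp only [hH, hA, hB, Real.norm_eq_abs]
        set x := clamp t (F (fun k => past e 0 ω (k + l)))
        set x' := clamp t (F (fun k => coupledPast e es 0 d ω (k + l)))
        set y := clamp t (G (past e 0 ω))
        set y' := clamp t (G (coupledPast e es 0 d ω))
        have h5 : x * y - x' * y' = (x - x') * y + x' * (y - y') := by ring
        rw [h5, mul_add, mul_comm t]
        refine (abs_add_le _ _).trans (add_le_add ?_ ?_)
        · rw [abs_mul]; gcongr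
        · rw [abs_mul]; gcongr
    _ = t * rms P (fun ω => ‖A ω‖ + ‖B ω‖) := rms_const_mul ht _
    _ ≤ t * (rms P (fun ω => ‖A ω‖) + rms P (fun ω => ‖B ω‖)) := by
        gcongr; exact rms_add_le hA2 hB2
    _ = t * (rms P A + rms P B) := by
        rw [rms_congr (fun ω => norm_norm (A ω)), rms_congr (fun ω => norm_norm (B ω))]

/-- The sample autocovariances of a fixed lag are consistent in `L¹`. -/
theorem tendsto_integral_abs_sum_mul [IsProbabilityMeasure P]
    (he : IsInnovationSystem P e es) {F G : (ℕ → S) → ℝ}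
    (hF : StronglyMeasurable F) (hG : StronglyMeasurable G)
    (hF2 : MemLp F 2 (pastLaw P e)) (hG2 : MemLp G 2 (pastLaw P e))
    (hFδ : Tendsto (depCoef P e F) atTop (𝓝 0)) (hGδ : Tendsto (depCoef P e G) atTop (𝓝 0))
    (l : ℕ) :
    Tendsto (fun N : ℕ => (N : ℝ)⁻¹ * ∫ ω, |∑ i ∈ Finset.Icc (1 : ℤ) N,
      (F (past e i ω) * G (past e (i + l) ω) -
        ∫ ω', F (past e 0 ω') * G (past e l ω') ∂P)| ∂P) atTop (𝓝 0) := by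
  have := he.isProbabilityMeasure_pastLaw
  -- The lagged product is one functional of the past at the later time i + l, from which the past
  -- at i is recovered by a shift.
  set J : (ℕ → S) → ℝ := fun x => F (fun k => x (k + l)) * G x with hJ
  have hFl := he.memLp_shift hF hF2 l
  have hFlm := hF.comp_measurable (measurable_shift (S := S) l)
  have hJm : StronglyMeasurable J := hFlm.mul hG
  have hJ1 : Integrable J (pastLaw P e) := hFl.integrable_mul hG2
  have hJp : ∀ i ω, J (past e (i + l) ω) = F (past e i ω) * G (past e (i + l) ω) := fun i ω => by
    simp only [hJ, past_add_shift]
  have hJc : ∫ ω', F (past e 0 ω') * G (past e l ω') ∂P = ∫ x, J x ∂(pastLaw P e) := by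
    have h0 := hJp 0
    rw [zero_add] at h0
    rw [← he.integral_past hJm l]
    simp only [h0]
  simp only [hJc, ← hJp]
  refine he.tendsto_integral_abs_sum_past hJm hJ1 (fun ε hε => ?_) l
  -- Truncating both factors at n gives bounded functionals that agree with J at each point for
  -- large n; dominated convergence with majorant 2|J| makes the L¹ error small.
  set H : ℕ → (ℕ → S) → ℝ := fun n x => clamp n (F fun k => x (k + l)) * clamp n (G x) with hH
  have hHm : ∀ n, StronglyMeasurable (H n) := fun n =>
    ((continuous_clamp n).comp_stronglyMeasurable hFlm).mul
      ((continuous_clamp n).comp_stronglyMeasurable hG)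
  have hlim : Tendsto (fun n => ∫ x, |J x - H n x| ∂(pastLaw P e)) atTop
      (𝓝 (∫ _, (0 : ℝ) ∂(pastLaw P e))) := by
    refine tendsto_integral_of_dominated_convergence (fun x => 2 * |J x|)
      (fun n => (hJm.sub (hHm n)).norm.aestronglyMeasurable) (hJ1.abs.const_mul 2)
      (fun n => Eventually.of_forall fun x => ?_) (Eventually.of_forall fun x => ?_)
    · have h1 : |H n x| ≤ |J x| := by
        simp only [hH, hJ, abs_mul]
        exact mul_le_mul (abs_clamp_le_abs n.cast_nonneg _) (abs_clamp_le_abs n.cast_nonneg _)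
          (abs_nonneg _) (abs_nonneg _)
      rw [Real.norm_eq_abs, abs_abs]
      linarith [abs_sub (J x) (H n x)]
    · refine tendsto_const_nhds.congr' ?_
      obtain ⟨n0, hn0⟩ := exists_nat_ge (max |F fun k => x (k + l)| |G x|)
      filter_upwards [eventually_ge_atTop n0] with n hn
      have h2 : (n0 : ℝ) ≤ n := by exact_mod_cast hn
      have h3 : |F fun k => x (k + l)| ≤ n := (le_max_left _ _).trans (hn0.trans h2)
      have h4 : |G x| ≤ n := (le_max_right _ _).trans (hn0.trans h2)
      simp only [hH, hJ]
      rw [clamp_eq_self h3, clamp_eq_self h4]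
      simp
  rw [integral_zero] at hlim
  obtain ⟨n, hn⟩ := (hlim.eventually (eventually_le_nhds hε)).exists
  refine ⟨H n, hHm n, ?_, ?_, hn⟩
  · refine MemLp.of_bound (hHm n).aestronglyMeasurable ((n : ℝ) * n)
      (Eventually.of_forall fun x => ?_)
    rw [Real.norm_eq_abs, abs_mul]
    exact mul_le_mul (abs_clamp_le n.cast_nonneg _) (abs_clamp_le n.cast_nonneg _)
      (abs_nonneg _) n.cast_nonneg
  · have h1 : Tendsto (fun d : ℕ => (n : ℝ) * (depCoef P e F (d - l) + depCoef P e G d)) atTop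
        (𝓝 0) := by
      have := ((hFδ.comp (tendsto_sub_atTop_nat l)).add hGδ).const_mul (n : ℝ)
      simpa using this
    refine squeeze_zero' (Eventually.of_forall fun d => depCoef_nonneg _ _) ?_ h1
    filter_upwards [eventually_ge_atTop l] with d hd
    exact he.depCoef_clamp_mul_clamp_le hF hG hF2 hG2 n.cast_nonneg hd

end IsInnovationSystem

end LawOfLargeNumbers

/-! ### The lag-window sum of functionals of the past -/

/-- The sample cross-covariance `n⁻¹ ∑_i x_i y_{i+l}` of two real sequences. -/
def crossCov (n : ℕ) (x y : ℤ → ℝ) (l : ℤ) : ℝ := (n : ℝ)⁻¹ * ∑ i ∈ lagIndex n l, x i * y (i + l)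

theorem lagIndex_natCast (n l : ℕ) : lagIndex n l = Finset.Icc (1 : ℤ) ((n - l : ℕ) : ℤ) := by
  rw [lagIndex, if_pos (by positivity)]
  ext i
  simp only [Finset.mem_Icc]
  omega

theorem lagIndex_eq_empty {n : ℕ} {l : ℤ} (h : (n : ℤ) ≤ |l|) : lagIndex n l = ∅ := by
  rw [lagIndex]
  split_ifs with h0
  · rw [abs_of_nonneg h0] at h
    exact Finset.Icc_eq_empty (by omega)
  · rw [abs_of_neg (not_le.1 h0)] at h
    exact Finset.Icc_eq_empty (by omega)

/-- Lets every bound be proved for nonnegative lags only, with F and G exchanged for the negative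
ones. -/
theorem crossCov_neg (n l : ℕ) (x y : ℤ → ℝ) : crossCov n x y (-l) = crossCov n y x l := by
  rcases Nat.eq_zero_or_pos l with rfl | hl
  · simp [crossCov, mul_comm]
  rw [crossCov, crossCov]
  congr 1
  refine Finset.sum_nbij' (fun i => i - l) (fun i => i + l) ?_ ?_ ?_ ?_ ?_
  · intro i hi
    rw [lagIndex, if_neg (by omega), Finset.mem_Icc] at hi
    rw [lagIndex, if_pos (by omega), Finset.mem_Icc]
    omega
  · intro i hi
    rw [lagIndex, if_pos (by omega), Finset.mem_Icc] at hi
    rw [lagIndex, if_neg (by omega), Finset.mem_Icc]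
    omega
  · intro i _; ring
  · intro i _; ring
  · intro i _
    rw [sub_add_cancel, ← sub_eq_add_neg, mul_comm]

/-- At most 2⌊mh⌋ + 1 lags are active. The condition w ≤ 1 is one-sided, so the bound on |w| comes
from continuity and compact support; it is raised by 1 below to be positive. -/
theorem IsLagWindow.exists_bound {w : ℝ → ℝ} (hw : IsLagWindow w) :
    ∃ W m : ℝ, 0 < W ∧ 0 < m ∧ (∀ u, |w u| ≤ W) ∧ ∀ h : ℝ, 0 < h → ∀ s : Finset ℤ,
      ∑ l ∈ s, |w (l / h)| ≤ W * (2 * (m * h) + 1) := by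
  obtain ⟨m, hm, hsupp⟩ := hw.bounded_support
  have hcs : HasCompactSupport w := by
    refine HasCompactSupport.intro (isCompact_Icc (a := -m) (b := m)) fun x hx => hsupp x ?_
    by_contra hcon
    exact hx (Set.mem_Icc.2 (abs_le.1 (not_lt.1 hcon)))
  obtain ⟨W, hW⟩ := hw.continuous.bounded_above_of_compact_support hcs
  have hW0 : 0 ≤ W := (norm_nonneg _).trans (hW 0)
  refine ⟨W + 1, m, by linarith, hm, fun u => (hW u).trans (by linarith), fun h hh s => ?_⟩
  have hmh : 0 ≤ m * h := by positivity
  set t := Finset.Icc (-(⌊m * h⌋₊ : ℤ)) ⌊m * h⌋₊ with ht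
  have h1 : ∑ l ∈ s, |w (l / h)| ≤ ∑ l ∈ t, W := by
    calc ∑ l ∈ s, |w (l / h)| = ∑ l ∈ s.filter (· ∈ t), |w (l / h)| := by
          refine (Finset.sum_filter_of_ne fun l _ hl => ?_).symm
          have h2 : |(l : ℝ) / h| ≤ m := by
            by_contra hcon
            exact hl (by rw [hsupp _ (not_le.1 hcon), abs_zero])
          rw [abs_div, abs_of_pos hh, div_le_iff₀ hh] at h2
          have h3 : l.natAbs ≤ ⌊m * h⌋₊ := by
            rw [Nat.le_floor_iff hmh, Nat.cast_natAbs]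
            exact_mod_cast h2
          rw [ht, Finset.mem_Icc]
          omega
      _ ≤ ∑ l ∈ s.filter (· ∈ t), W := Finset.sum_le_sum fun l _ => hW _
      _ ≤ ∑ l ∈ t, W := by
          refine Finset.sum_le_sum_of_subset_of_nonneg (fun l hl => (Finset.mem_filter.1 hl).2)
            fun _ _ _ => hW0
  refine h1.trans ?_
  rw [Finset.sum_const, ht, Int.card_Icc, nsmul_eq_mul]
  have h4 : ((((⌊m * h⌋₊ : ℤ) + 1 - -(⌊m * h⌋₊ : ℤ)).toNat : ℕ) : ℝ) = 2 * ⌊m * h⌋₊ + 1 := by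
    have : ((⌊m * h⌋₊ : ℤ) + 1 - -(⌊m * h⌋₊ : ℤ)).toNat = 2 * ⌊m * h⌋₊ + 1 := by omega
    rw [this]; push_cast; ring
  rw [h4, mul_comm]
  have h5 := Nat.floor_le hmh
  gcongr
  linarith

theorem summable_comp_natAbs {f : ℕ → ℝ} (hf : Summable f) : Summable fun l : ℤ => f l.natAbs :=
  Summable.of_nat_of_neg (by simpa using hf) (by simpa using hf)

section LagWindow

variable {Ω S : Type*} [MeasurableSpace Ω] [MeasurableSpace S] {P : Measure Ω}
  {e : ℤ → Ω → S} {es : ℤ → ℕ → ℤ → Ω → S}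

/-- A centered square-integrable functional of the past with summable dependence coefficients. -/
structure IsShortRange (P : Measure Ω) (e : ℤ → Ω → S) {E : Type*} [NormedAddCommGroup E]
    [NormedSpace ℝ E] (F : (ℕ → S) → E) : Prop where
  stronglyMeasurable : StronglyMeasurable F
  memLp : MemLp F 2 (pastLaw P e)
  integral_eq_zero : ∫ x, F x ∂(pastLaw P e) = 0
  summable : Summable (depCoef P e F)

/-- The covariance of lag `l` of two functionals of the past. -/
def lagCov (P : Measure Ω) (e : ℤ → Ω → S) (F G : (ℕ → S) → ℝ) (l : ℤ) : ℝ :=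
  ∫ ω, F (past e 0 ω) * G (past e l ω) ∂P

namespace IsInnovationSystem

variable {F G : (ℕ → S) → ℝ}

theorem integral_past_mul_past (he : IsInnovationSystem P e es) (hF : StronglyMeasurable F)
    (hG : StronglyMeasurable G) (i : ℤ) (l : ℕ) :
    ∫ ω, F (past e i ω) * G (past e (i + l) ω) ∂P = lagCov P e F G l := by
  have hJ : StronglyMeasurable fun x : ℕ → S => F (fun k => x (k + l)) * G x :=
    (hF.comp_measurable (measurable_shift l)).mul hG
  have h : ∀ i : ℤ, ∫ ω, F (past e i ω) * G (past e (i + l) ω) ∂P =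
      ∫ x, F (fun k => x (k + l)) * G x ∂(pastLaw P e) := fun i => by
    rw [← he.integral_past hJ (i + l)]
    simp only [past_add_shift]
  rw [h i, lagCov, ← h 0]
  simp only [zero_add]

theorem lagCov_neg (he : IsInnovationSystem P e es) (hF : StronglyMeasurable F)
    (hG : StronglyMeasurable G) (l : ℕ) : lagCov P e F G (-l) = lagCov P e G F l := by
  rw [← he.integral_past_mul_past hG hF (-l) l, lagCov]
  simp only [neg_add_cancel, mul_comm]

theorem abs_lagCov_natCast_le [IsProbabilityMeasure P] (he : IsInnovationSystem P e es)
    (hF : IsShortRange P e F) (hG : IsShortRange P e G) (l : ℕ) :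
    |lagCov P e F G l| ≤ rms (pastLaw P e) F * depCoef P e G l := by
  have h := he.abs_integral_inner_past_le hG.stronglyMeasurable hF.stronglyMeasurable hF.memLp
    hG.memLp hG.integral_eq_zero 0 l
  simpa only [lagCov, real_inner_eq_mul, zero_add] using h

/-- A summable bound for the covariances. -/
theorem abs_lagCov_le [IsProbabilityMeasure P] (he : IsInnovationSystem P e es)
    (hF : IsShortRange P e F) (hG : IsShortRange P e G) (l : ℤ) :
    |lagCov P e F G l| ≤ rms (pastLaw P e) F * depCoef P e G l.natAbs +
      rms (pastLaw P e) G * depCoef P e F l.natAbs := by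
  have h1 : 0 ≤ rms (pastLaw P e) F * depCoef P e G l.natAbs :=
    mul_nonneg (rms_nonneg _) (depCoef_nonneg _ _)
  have h2 : 0 ≤ rms (pastLaw P e) G * depCoef P e F l.natAbs :=
    mul_nonneg (rms_nonneg _) (depCoef_nonneg _ _)
  rcases Int.natAbs_eq l with h | h
  · have := he.abs_lagCov_natCast_le hF hG l.natAbs
    rw [← h] at this
    linarith
  · have := he.abs_lagCov_natCast_le hG hF l.natAbs
    rw [← he.lagCov_neg hF.stronglyMeasurable hG.stronglyMeasurable, ← h] at this
    linarith

theorem summable_lagCov_bound (hF : IsShortRange P e F) (hG : IsShortRange P e G) :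
    Summable fun l : ℤ => rms (pastLaw P e) F * depCoef P e G l.natAbs +
      rms (pastLaw P e) G * depCoef P e F l.natAbs :=
  ((summable_comp_natAbs hG.summable).mul_left _).add ((summable_comp_natAbs hF.summable).mul_left _)

theorem summable_lagCov [IsProbabilityMeasure P] (he : IsInnovationSystem P e es)
    (hF : IsShortRange P e F) (hG : IsShortRange P e G) : Summable (lagCov P e F G) :=
  Summable.of_norm_bounded (summable_lagCov_bound hF hG) fun l => he.abs_lagCov_le hF hG l

theorem integrable_past_mul_past (he : IsInnovationSystem P e es)
    (hF : IsShortRange P e F) (hG : IsShortRange P e G) (i k : ℤ) :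
    Integrable (fun ω => F (past e i ω) * G (past e k ω)) P :=
  (he.memLp_past hF.memLp i).integrable_mul (he.memLp_past hG.memLp k)

theorem integrable_crossCov (he : IsInnovationSystem P e es)
    (hF : IsShortRange P e F) (hG : IsShortRange P e G) (n : ℕ) (l : ℤ) :
    Integrable (fun ω => crossCov n (fun i => F (past e i ω)) (fun i => G (past e i ω)) l) P :=
  (integrable_finsetSum _ fun _ _ => he.integrable_past_mul_past hF hG _ _).const_mul _

/-- The mean absolute error of the sample covariance of lag `l`. -/
def covError (P : Measure Ω) (e : ℤ → Ω → S) (F G : (ℕ → S) → ℝ) (n : ℕ) (l : ℤ) : ℝ :=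
  ∫ ω, |crossCov n (fun i => F (past e i ω)) (fun i => G (past e i ω)) l - lagCov P e F G l| ∂P

theorem covError_nonneg (n : ℕ) (l : ℤ) : 0 ≤ covError P e F G n l :=
  integral_nonneg fun _ => abs_nonneg _

theorem covError_neg (he : IsInnovationSystem P e es) (hF : StronglyMeasurable F)
    (hG : StronglyMeasurable G) (n l : ℕ) :
    covError P e F G n (-l) = covError P e G F n l := by
  simp only [covError, crossCov_neg, he.lagCov_neg hF hG]

/-- The sum has n − l terms but is divided by n, which leaves a deterministic bias of at most l|γ|/n
beside the law of large numbers. -/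
theorem tendsto_covError_natCast [IsProbabilityMeasure P] (he : IsInnovationSystem P e es)
    (hF : IsShortRange P e F) (hG : IsShortRange P e G) (l : ℕ) :
    Tendsto (fun n => covError P e F G n l) atTop (𝓝 0) := by
  set γ := lagCov P e F G l with hγ
  have h1 := (he.tendsto_integral_abs_sum_mul hF.stronglyMeasurable hG.stronglyMeasurable
    hF.memLp hG.memLp hF.summable.tendsto_atTop_zero hG.summable.tendsto_atTop_zero l).comp
    (tendsto_sub_atTop_nat l)
  change Tendsto (fun n : ℕ => ((n - l : ℕ) : ℝ)⁻¹ * ∫ ω, |∑ i ∈ Finset.Icc (1 : ℤ) ((n - l : ℕ)),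
      (F (past e i ω) * G (past e (i + l) ω) - γ)| ∂P) atTop (𝓝 0) at h1
  have h2 : Tendsto (fun n : ℕ => (l * |γ|) / (n : ℝ)) atTop (𝓝 0) :=
    tendsto_const_div_atTop_nhds_zero_nat _
  have h3 := h1.add h2
  rw [add_zero] at h3
  refine squeeze_zero' (Eventually.of_forall fun n => covError_nonneg n l) ?_ h3
  filter_upwards [eventually_gt_atTop l] with n hn
  have hn0 : (0 : ℝ) < n := by exact_mod_cast (Nat.zero_le l).trans_lt hn
  have hN0 : (0 : ℝ) < (n - l : ℕ) := by exact_mod_cast Nat.sub_pos_of_lt hn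
  have hNn : ((n - l : ℕ) : ℝ) ≤ n := by exact_mod_cast Nat.sub_le n l
  have hI : Integrable (fun ω => |∑ i ∈ Finset.Icc (1 : ℤ) ((n - l : ℕ)),
      (F (past e i ω) * G (past e (i + l) ω) - γ)|) P :=
    (integrable_finsetSum _ fun i _ =>
      (he.integrable_past_mul_past hF hG _ _).sub (integrable_const γ)).abs
  have hpt : ∀ ω, |crossCov n (fun i => F (past e i ω)) (fun i => G (past e i ω)) l - γ| ≤
      ((n - l : ℕ) : ℝ)⁻¹ * |∑ i ∈ Finset.Icc (1 : ℤ) ((n - l : ℕ)),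
        (F (past e i ω) * G (past e (i + l) ω) - γ)| + (l * |γ|) / n := by
    intro ω
    have h4 : crossCov n (fun i => F (past e i ω)) (fun i => G (past e i ω)) l - γ =
        (n : ℝ)⁻¹ * ∑ i ∈ Finset.Icc (1 : ℤ) ((n - l : ℕ)),
          (F (past e i ω) * G (past e (i + l) ω) - γ) + -(l * γ / n) := by
      rw [crossCov, lagIndex_natCast, Finset.sum_sub_distrib, Finset.sum_const, nsmul_eq_mul,
        Int.card_Icc]
      have h5 : ((((n - l : ℕ) : ℤ) + 1 - 1).toNat : ℝ) = n - l := by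
        rw [add_sub_cancel_right, Int.toNat_natCast, Nat.cast_sub hn.le]
      rw [h5]
      field_simp
      ring
    rw [h4]
    refine (abs_add_le _ _).trans (add_le_add ?_ ?_)
    · rw [abs_mul, abs_of_pos (inv_pos.2 hn0)]
      gcongr
    · rw [abs_neg, abs_div, abs_mul, abs_of_pos hn0, abs_of_nonneg (Nat.cast_nonneg l)]
  refine (integral_mono_of_nonneg (Eventually.of_forall fun _ => abs_nonneg _)
    ((hI.const_mul _).add (integrable_const _)) (Eventually.of_forall hpt)).trans ?_
  simp only [Pi.add_apply]
  rw [integral_add (hI.const_mul _) (integrable_const _), integral_const_mul]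
  simp

/-- The point is that C is free of l, so the bound can be summed over a growing range of lags. One
copy of ‖F‖ δ_l(G) comes from coupling, the other from the covariance itself. -/
theorem exists_covError_natCast_le [IsProbabilityMeasure P] (he : IsInnovationSystem P e es)
    (hF : IsShortRange P e F) (hG : IsShortRange P e G) :
    ∃ C : ℝ, 0 ≤ C ∧ ∀ (n l : ℕ), covError P e F G n l ≤
      2 * (rms (pastLaw P e) F * depCoef P e G l) + C / √n := by
  set K := 2 * (rms (pastLaw P e) F ^ 2 * rms (pastLaw P e) G *
        (rms (pastLaw P e) G + ∑' d, depCoef P e G d)) with hK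
  refine ⟨√K, Real.sqrt_nonneg _, fun n l => ?_⟩
  have hγ := he.abs_lagCov_natCast_le hF hG l
  have hσδ : 0 ≤ rms (pastLaw P e) F * depCoef P e G l :=
    mul_nonneg (rms_nonneg _) (depCoef_nonneg _ _)
  have hI := (he.integrable_crossCov hF hG n l).abs
  have h1 : covError P e F G n l ≤
      (∫ ω, |crossCov n (fun i => F (past e i ω)) (fun i => G (past e i ω)) l| ∂P) +
        |lagCov P e F G l| := by
    refine (integral_mono_of_nonneg (Eventually.of_forall fun _ => abs_nonneg _)
      (hI.add (integrable_const |lagCov P e F G l|))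
      (Eventually.of_forall fun ω => abs_sub _ _)).trans ?_
    simp only [Pi.add_apply]
    rw [integral_add hI (integrable_const _)]
    simp
  have h2 : ∫ ω, |crossCov n (fun i => F (past e i ω)) (fun i => G (past e i ω)) l| ∂P ≤
      rms (pastLaw P e) F * depCoef P e G l + √K / √n := by
    rcases Nat.eq_zero_or_pos n with rfl | hn
    · simpa [crossCov] using hσδ
    have hn0 : (0 : ℝ) < n := by exact_mod_cast hn
    have hNn : ((n - l : ℕ) : ℝ) ≤ n := by exact_mod_cast Nat.sub_le n l
    have hK0 : 0 ≤ K := by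
      have := rms_nonneg (P := pastLaw P e) G
      have : 0 ≤ ∑' d, depCoef P e G d := tsum_nonneg fun d => depCoef_nonneg G d
      positivity
    have h3 := he.integral_abs_sum_past_mul_past_le hF.stronglyMeasurable hG.stronglyMeasurable
      hF.memLp hG.memLp hG.integral_eq_zero hG.summable l (n - l)
    rw [← hK] at h3
    simp only [crossCov, lagIndex_natCast, abs_mul, abs_of_pos (inv_pos.2 hn0)]
    rw [integral_const_mul]
    calc _ ≤ (n : ℝ)⁻¹ * (n * (rms (pastLaw P e) F * depCoef P e G l) + √(n * K)) := by
          gcongr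
          refine h3.trans ?_
          gcongr
      _ = _ := by
          rw [Real.sqrt_mul hn0.le, mul_add, ← mul_assoc, inv_mul_cancel₀ hn0.ne', one_mul]
          congr 1
          have h4 := Real.mul_self_sqrt hn0.le
          have h5 := Real.sqrt_pos.2 hn0
          field_simp
          rw [sq, h4]
  linarith

theorem tendsto_covError [IsProbabilityMeasure P] (he : IsInnovationSystem P e es)
    (hF : IsShortRange P e F) (hG : IsShortRange P e G) (l : ℤ) :
    Tendsto (fun n => covError P e F G n l) atTop (𝓝 0) := by
  rcases Int.natAbs_eq l with h | h
  · rw [h]; exact he.tendsto_covError_natCast hF hG _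
  · rw [h]
    simp only [he.covError_neg hF.stronglyMeasurable hG.stronglyMeasurable]
    exact he.tendsto_covError_natCast hG hF _

theorem exists_covError_le [IsProbabilityMeasure P] (he : IsInnovationSystem P e es)
    (hF : IsShortRange P e F) (hG : IsShortRange P e G) :
    ∃ C : ℝ, 0 ≤ C ∧ ∀ (n : ℕ) (l : ℤ), covError P e F G n l ≤
      2 * (rms (pastLaw P e) F * depCoef P e G l.natAbs +
        rms (pastLaw P e) G * depCoef P e F l.natAbs) + C / √n := by
  obtain ⟨C, hC, hCb⟩ := he.exists_covError_natCast_le hF hG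
  obtain ⟨C', hC', hCb'⟩ := he.exists_covError_natCast_le hG hF
  refine ⟨C + C', add_nonneg hC hC', fun n l => ?_⟩
  have h1 : 0 ≤ rms (pastLaw P e) F * depCoef P e G l.natAbs :=
    mul_nonneg (rms_nonneg _) (depCoef_nonneg _ _)
  have h2 : 0 ≤ rms (pastLaw P e) G * depCoef P e F l.natAbs :=
    mul_nonneg (rms_nonneg _) (depCoef_nonneg _ _)
  have h3 : 0 ≤ C / √(n : ℝ) := by positivity
  have h4 : 0 ≤ C' / √(n : ℝ) := by positivity
  rw [add_div]
  rcases Int.natAbs_eq l with h | h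
  · have := hCb n l.natAbs
    rw [← h] at this
    linarith
  · have := hCb' n l.natAbs
    rw [← he.covError_neg hF.stronglyMeasurable hG.stronglyMeasurable, ← h] at this
    linarith

end IsInnovationSystem

/-- The two consequences of the bandwidth condition. -/
theorem bandwidth_limits {h : ℕ → ℝ} (hpos : ∀ᶠ n in atTop, 0 < h n)
    (hh : Tendsto (fun n : ℕ => 1 / h n + h n / √(n : ℝ)) atTop (𝓝 0)) :
    Tendsto (fun n => 1 / h n) atTop (𝓝 0) ∧
      Tendsto (fun n : ℕ => h n / √(n : ℝ)) atTop (𝓝 0) := by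
  constructor
  · refine squeeze_zero' ?_ ?_ hh
    · filter_upwards [hpos] with n hn using by positivity
    · filter_upwards [hpos] with n hn
      have : 0 ≤ h n / √(n : ℝ) := by positivity
      linarith
  · refine squeeze_zero' ?_ ?_ hh
    · filter_upwards [hpos] with n hn using by positivity
    · filter_upwards [hpos] with n hn
      have : 0 ≤ 1 / h n := by positivity
      linarith

/-- The total weight of the window is O(h + 1), and each lag will carry an error of order n^{-1/2}.
-/
theorem tendsto_window_mass {h : ℕ → ℝ}
    (hh : Tendsto (fun n : ℕ => h n / √(n : ℝ)) atTop (𝓝 0)) (W m : ℝ) :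
    Tendsto (fun n : ℕ => W * (2 * (m * h n) + 1) / √(n : ℝ)) atTop (𝓝 0) := by
  have h1 : Tendsto (fun n : ℕ => 1 / √(n : ℝ)) atTop (𝓝 0) := by
    simp only [one_div]
    exact (Real.tendsto_sqrt_atTop.comp tendsto_natCast_atTop_atTop).inv_tendsto_atTop
  have h2 := ((hh.const_mul (2 * m)).add h1).const_mul W
  simp only [mul_zero, add_zero] at h2
  refine h2.congr fun n => ?_
  ring

/-- Consistency in `L¹` of the lag-window sum that is based on functionals of the past. -/
theorem IsInnovationSystem.tendsto_integral_abs_lagWindow [IsProbabilityMeasure P]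
    (he : IsInnovationSystem P e es) {F G : (ℕ → S) → ℝ}
    (hF : IsShortRange P e F) (hG : IsShortRange P e G) {w : ℝ → ℝ} (hw : IsLagWindow w)
    {h : ℕ → ℝ} (hpos : ∀ᶠ n in atTop, 0 < h n)
    (hh : Tendsto (fun n : ℕ => 1 / h n + h n / √(n : ℝ)) atTop (𝓝 0)) :
    Tendsto (fun n : ℕ => ∫ ω, |∑ l ∈ Finset.Icc (-(n : ℤ)) n, w (l / h n) *
      crossCov n (fun i => F (past e i ω)) (fun i => G (past e i ω)) l -
      ∑' l : ℤ, lagCov P e F G l| ∂P) atTop (𝓝 0) := by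
  obtain ⟨W, m, hW, hm, hWb, hWs⟩ := hw.exists_bound
  obtain ⟨hh1, hh2⟩ := bandwidth_limits hpos hh
  obtain ⟨C, hC, hCb⟩ := he.exists_covError_le hF hG
  set κ : ℤ → ℝ := fun l => rms (pastLaw P e) F * depCoef P e G l.natAbs +
    rms (pastLaw P e) G * depCoef P e F l.natAbs with hκ
  have hκs : Summable κ := summable_lagCov_bound hF hG
  have hκ0 : ∀ l, 0 ≤ κ l := fun l => add_nonneg
    (mul_nonneg (rms_nonneg _) (depCoef_nonneg _ _))
    (mul_nonneg (rms_nonneg _) (depCoef_nonneg _ _))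
  set γ := lagCov P e F G with hγ
  have hγκ : ∀ l, |γ l| ≤ κ l := fun l => he.abs_lagCov_le hF hG l
  -- the bias
  have hbias : Tendsto (fun n : ℕ => ∑ l ∈ Finset.Icc (-(n : ℤ)) n, w (l / h n) * γ l) atTop
      (𝓝 (∑' l, γ l)) := by
    have h1 : Tendsto (fun n : ℕ => ∑' l : ℤ,
        if l ∈ Finset.Icc (-(n : ℤ)) n then w (l / h n) * γ l else 0) atTop (𝓝 (∑' l, γ l)) := by
      refine tendsto_tsum_of_dominated_convergence (bound := fun l => W * κ l)
        (hκs.mul_left W) (fun l => ?_) (Eventually.of_forall fun n l => ?_)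
      · have h2 : Tendsto (fun n => w (l / h n) * γ l) atTop (𝓝 (γ l)) := by
          have h3 : Tendsto (fun n => (l : ℝ) / h n) atTop (𝓝 0) := by
            have := hh1.const_mul (l : ℝ)
            simpa [div_eq_mul_inv] using this
          have h4 := ((hw.continuous.tendsto 0).comp h3).mul_const (γ l)
          rwa [hw.map_zero, one_mul] at h4
        refine h2.congr' ?_
        filter_upwards [eventually_ge_atTop l.natAbs] with n hn
        rw [if_pos]
        rw [Finset.mem_Icc]
        omega
      · split_ifs
        · rw [norm_mul]
          exact mul_le_mul (hWb _) (hγκ l) (norm_nonneg _) hW.le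
        · rw [norm_zero]
          exact mul_nonneg hW.le (hκ0 l)
    refine h1.congr fun n => ?_
    rw [tsum_eq_sum (s := Finset.Icc (-(n : ℤ)) n) fun l hl => if_neg hl]
    exact Finset.sum_congr rfl fun l hl => if_pos hl
  -- the stochastic part
  set f : ℕ → ℤ → ℝ := fun n l => covError P e F G n l with hf
  -- The term C/√n has no summable majorant over all lags, so it is split off and charged to the
  -- window mass. What remains is dominated by 2κ.
  set r : ℕ → ℤ → ℝ := fun n l => max (f n l - C / √n) 0 with hr
  have hsq : Tendsto (fun n : ℕ => C / √(n : ℝ)) atTop (𝓝 0) := by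
    have := (Real.tendsto_sqrt_atTop.comp tendsto_natCast_atTop_atTop).inv_tendsto_atTop.const_mul C
    simpa [div_eq_mul_inv] using this
  have hr0 : Tendsto (fun n => ∑' l, r n l) atTop (𝓝 0) := by
    have h1 : Tendsto (fun n => ∑' l, r n l) atTop (𝓝 (∑' _ : ℤ, (0 : ℝ))) := by
      refine tendsto_tsum_of_dominated_convergence (bound := fun l => 2 * κ l)
        (hκs.mul_left 2) (fun l => ?_) (Eventually.of_forall fun n l => ?_)
      · have h2 := ((he.tendsto_covError hF hG l).sub hsq).max
          (tendsto_const_nhds (x := (0 : ℝ)))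
        simpa using h2
      · rw [Real.norm_of_nonneg (le_max_right _ _)]
        refine max_le ?_ (mul_nonneg zero_le_two (hκ0 l))
        have := hCb n l
        simp only [hf, hκ]
        linarith
    rwa [tsum_zero] at h1
  have hrs : ∀ n, Summable (r n) := fun n => by
    refine Summable.of_nonneg_of_le (fun l => le_max_right _ _) (fun l => ?_) (hκs.mul_left 2)
    refine max_le ?_ (mul_nonneg zero_le_two (hκ0 l))
    have := hCb n l
    simp only [hf, hκ]
    linarith
  have hlim : Tendsto (fun n : ℕ => W * ∑' l, r n l + C * (W * (2 * (m * h n) + 1) / √(n : ℝ)) +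
      |∑ l ∈ Finset.Icc (-(n : ℤ)) n, w (l / h n) * γ l - ∑' l, γ l|) atTop (𝓝 0) := by
    have h1 := ((hr0.const_mul W).add ((tendsto_window_mass hh2 W m).const_mul C)).add
      (hbias.sub (tendsto_const_nhds (x := ∑' l, γ l))).abs
    simpa using h1
  refine squeeze_zero' (Eventually.of_forall fun n => integral_nonneg fun _ => abs_nonneg _) ?_ hlim
  filter_upwards [hpos] with n hn
  set b := |∑ l ∈ Finset.Icc (-(n : ℤ)) n, w (l / h n) * γ l - ∑' l, γ l| with hb
  set c : ℤ → Ω → ℝ := fun l ω =>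
    crossCov n (fun i => F (past e i ω)) (fun i => G (past e i ω)) l with hc
  have hcI : ∀ l : ℤ, Integrable (fun ω => |w (l / h n)| * |c l ω - γ l|) P := fun l =>
    (((he.integrable_crossCov hF hG n l).sub (integrable_const _)).abs).const_mul _
  have hpt : ∀ ω, |∑ l ∈ Finset.Icc (-(n : ℤ)) n, w (l / h n) * c l ω - ∑' l, γ l| ≤
      ∑ l ∈ Finset.Icc (-(n : ℤ)) n, |w (l / h n)| * |c l ω - γ l| + b := by
    intro ω
    have h1 : ∑ l ∈ Finset.Icc (-(n : ℤ)) n, w (l / h n) * c l ω - ∑' l, γ l =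
        ∑ l ∈ Finset.Icc (-(n : ℤ)) n, w (l / h n) * (c l ω - γ l) +
        (∑ l ∈ Finset.Icc (-(n : ℤ)) n, w (l / h n) * γ l - ∑' l, γ l) := by
      simp only [mul_sub, Finset.sum_sub_distrib]
      ring
    rw [h1]
    refine (abs_add_le _ _).trans (add_le_add ?_ le_rfl)
    refine (Finset.abs_sum_le_sum_abs _ _).trans (le_of_eq ?_)
    simp only [abs_mul]
  have hcS : Integrable (fun ω => ∑ l ∈ Finset.Icc (-(n : ℤ)) n,
      |w (l / h n)| * |c l ω - γ l|) P := integrable_finsetSum _ fun l _ => hcI l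
  refine (integral_mono_of_nonneg (Eventually.of_forall fun _ => abs_nonneg _)
    (hcS.add (integrable_const b)) (Eventually.of_forall hpt)).trans ?_
  simp only [Pi.add_apply]
  rw [integral_add hcS (integrable_const b), integral_finsetSum _ fun l _ => hcI l]
  refine add_le_add ?_ (by simp)
  calc ∑ l ∈ Finset.Icc (-(n : ℤ)) n, ∫ ω, |w (l / h n)| * |c l ω - γ l| ∂P
      = ∑ l ∈ Finset.Icc (-(n : ℤ)) n, |w (l / h n)| * f n l := by
        simp only [integral_const_mul, hf, covError, hc, hγ]
    _ ≤ ∑ l ∈ Finset.Icc (-(n : ℤ)) n, (W * r n l + C / √n * |w (l / h n)|) := by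
        refine Finset.sum_le_sum fun l _ => ?_
        have h1 : f n l ≤ r n l + C / √n := by
          have := le_max_left (f n l - C / √n) 0
          simp only [hr]; linarith
        calc |w (l / h n)| * f n l ≤ |w (l / h n)| * (r n l + C / √n) := by gcongr
          _ = |w (l / h n)| * r n l + C / √n * |w (l / h n)| := by ring
          _ ≤ _ := by
            have := hWb (l / h n)
            have h2 : 0 ≤ r n l := le_max_right _ _
            gcongr
    _ ≤ W * ∑' l, r n l + C / √n * (W * (2 * (m * h n) + 1)) := by
        rw [Finset.sum_add_distrib, ← Finset.mul_sum, ← Finset.mul_sum]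
        have h3 := (hrs n).sum_le_tsum (Finset.Icc (-(n : ℤ)) n) fun l _ => le_max_right _ _
        have h4 := hWs (h n) hn (Finset.Icc (-(n : ℤ)) n)
        gcongr
    _ = _ := by ring

end LagWindow

/-! ### Boundedness and convergence in probability -/

section InProbability

variable {Ω : Type*} [MeasurableSpace Ω] {P : Measure Ω}

/-- The sequence is bounded from above in probability. -/
def BoundedInProb (P : Measure Ω) (Y : ℕ → Ω → ℝ) : Prop :=
  ∀ η : ENNReal, 0 < η → ∃ K : ℝ, ∀ᶠ n in atTop, P {ω | K < Y n ω} ≤ η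

/-- The positive part of the sequence tends to zero in probability. -/
def NegligibleInProb (P : Measure Ω) (R : ℕ → Ω → ℝ) : Prop :=
  ∀ ε : ℝ, 0 < ε → Tendsto (fun n => P {ω | ε ≤ R n ω}) atTop (𝓝 0)

theorem boundedInProb_const (c : ℝ) : BoundedInProb P fun _ _ => c := fun η _ =>
  ⟨c, Eventually.of_forall fun n => by simp⟩

theorem BoundedInProb.add {X Y : ℕ → Ω → ℝ} (hX : BoundedInProb P X) (hY : BoundedInProb P Y) :
    BoundedInProb P fun n ω => X n ω + Y n ω := by
  intro η hη
  obtain ⟨K, hK⟩ := hX (η / 2) (ENNReal.half_pos hη.ne')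
  obtain ⟨L, hL⟩ := hY (η / 2) (ENNReal.half_pos hη.ne')
  refine ⟨K + L, ?_⟩
  filter_upwards [hK, hL] with n h1 h2
  calc P {ω | K + L < X n ω + Y n ω} ≤ P ({ω | K < X n ω} ∪ {ω | L < Y n ω}) := by
        refine measure_mono fun ω hω => ?_
        by_contra hcon
        simp only [Set.mem_union, Set.mem_ofPred_eq, not_or, not_lt] at hcon hω
        linarith [hcon.1, hcon.2]
    _ ≤ η / 2 + η / 2 := (measure_union_le _ _).trans (add_le_add h1 h2)
    _ = η := ENNReal.add_halves η

theorem BoundedInProb.mul {X Y : ℕ → Ω → ℝ} (hX : BoundedInProb P X) (hY : BoundedInProb P Y)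
    (hX0 : ∀ n ω, 0 ≤ X n ω) (hY0 : ∀ n ω, 0 ≤ Y n ω) :
    BoundedInProb P fun n ω => X n ω * Y n ω := by
  intro η hη
  obtain ⟨K, hK⟩ := hX (η / 2) (ENNReal.half_pos hη.ne')
  obtain ⟨L, hL⟩ := hY (η / 2) (ENNReal.half_pos hη.ne')
  refine ⟨K * L, ?_⟩
  filter_upwards [hK, hL] with n h1 h2
  calc P {ω | K * L < X n ω * Y n ω} ≤ P ({ω | K < X n ω} ∪ {ω | L < Y n ω}) := by
        refine measure_mono fun ω hω => ?_
        by_contra hcon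
        simp only [Set.mem_union, Set.mem_ofPred_eq, not_or, not_lt] at hcon hω
        exact absurd hω (not_lt.2 (mul_le_mul hcon.1 hcon.2 (hY0 n ω)
          ((hX0 n ω).trans hcon.1)))
    _ ≤ η / 2 + η / 2 := (measure_union_le _ _).trans (add_le_add h1 h2)
    _ = η := ENNReal.add_halves η

theorem measure_le_ofReal_integral_div {Y : Ω → ℝ} (hY : Integrable Y P) (hY0 : ∀ ω, 0 ≤ Y ω)
    {K : ℝ} (hK : 0 < K) : P {ω | K ≤ Y ω} ≤ ENNReal.ofReal ((∫ ω, Y ω ∂P) / K) := by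
  have h1 : P {ω | ENNReal.ofReal K ≤ ENNReal.ofReal (Y ω)} ≤
      (∫⁻ ω, ENNReal.ofReal (Y ω) ∂P) / ENNReal.ofReal K :=
    meas_ge_le_lintegral_div hY.1.aemeasurable.ennreal_ofReal
      (by simpa using hK) ENNReal.ofReal_ne_top
  rw [← ofReal_integral_eq_lintegral_ofReal hY (Eventually.of_forall hY0),
    ← ENNReal.ofReal_div_of_pos hK] at h1
  refine (measure_mono fun ω hω => ?_).trans h1
  exact ENNReal.ofReal_le_ofReal hω

theorem boundedInProb_of_integral_le {Y : ℕ → Ω → ℝ} (hY : ∀ n, Integrable (Y n) P)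
    (hY0 : ∀ n ω, 0 ≤ Y n ω) {C : ℝ} (hC : ∀ n, ∫ ω, Y n ω ∂P ≤ C) : BoundedInProb P Y := by
  intro η hη
  have hC0 : 0 ≤ C := (integral_nonneg (hY0 0)).trans (hC 0)
  obtain ⟨η', hη', hle⟩ : ∃ η' : ℝ, 0 < η' ∧ ENNReal.ofReal η' ≤ η := by
    obtain ⟨r, hr, hr'⟩ := ENNReal.lt_iff_exists_real_btwn.1 hη
    exact ⟨r, by simpa using hr'.1, hr'.2.le⟩
  have hK : 0 < C / η' + 1 := by positivity
  refine ⟨C / η' + 1, Eventually.of_forall fun n => ?_⟩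
  have hsub : {ω | C / η' + 1 < Y n ω} ⊆ {ω | C / η' + 1 ≤ Y n ω} := fun ω hω =>
    le_of_lt (Set.mem_ofPred_eq ▸ hω)
  refine ((measure_mono hsub).trans
    (measure_le_ofReal_integral_div (hY n) (hY0 n) hK)).trans
    ((ENNReal.ofReal_le_ofReal ?_).trans hle)
  rw [div_le_iff₀ hK]
  refine (hC n).trans ?_
  rw [mul_add, mul_div_cancel₀ _ hη'.ne']
  linarith

theorem negligibleInProb_of_tendsto_integral {Y : ℕ → Ω → ℝ} (hY : ∀ n, Integrable (Y n) P)
    (hY0 : ∀ n ω, 0 ≤ Y n ω) (h : Tendsto (fun n => ∫ ω, Y n ω ∂P) atTop (𝓝 0)) :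
    NegligibleInProb P Y := by
  intro ε hε
  refine tendsto_of_tendsto_of_tendsto_of_le_of_le tendsto_const_nhds ?_ (fun n => zero_le)
    fun n => measure_le_ofReal_integral_div (hY n) (hY0 n) hε
  have := ENNReal.tendsto_ofReal (h.div_const ε)
  simpa using this

theorem NegligibleInProb.add {X Y : ℕ → Ω → ℝ} (hX : NegligibleInProb P X)
    (hY : NegligibleInProb P Y) : NegligibleInProb P fun n ω => X n ω + Y n ω := by
  intro ε hε
  have h := (hX (ε / 2) (by positivity)).add (hY (ε / 2) (by positivity))
  rw [add_zero] at h
  refine tendsto_of_tendsto_of_tendsto_of_le_of_le tendsto_const_nhds h (fun n => zero_le)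
    fun n => (measure_mono fun ω hω => ?_).trans (measure_union_le _ _)
  by_contra hcon
  simp only [Set.mem_union, Set.mem_ofPred_eq, not_or, not_le] at hcon hω
  linarith [hcon.1, hcon.2]

theorem NegligibleInProb.sum {ι : Type*} (s : Finset ι) {X : ι → ℕ → Ω → ℝ}
    (hX : ∀ i ∈ s, NegligibleInProb P (X i)) :
    NegligibleInProb P fun n ω => ∑ i ∈ s, X i n ω := by
  classical
  induction s using Finset.induction_on with
  | empty =>
    intro ε hε
    have : ∀ n : ℕ, P {ω : Ω | ε ≤ ∑ i ∈ (∅ : Finset ι), X i n ω} = 0 := fun n => by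
      simp [not_le.2 hε]
    simp only [this]
    exact tendsto_const_nhds
  | insert a s ha ih =>
    simp only [Finset.sum_insert ha]
    exact (hX a (Finset.mem_insert_self a s)).add
      (ih fun i hi => hX i (Finset.mem_insert_of_mem hi))

/-- X is not required to be measurable: only monotonicity of P is used. Statistics built from an
arbitrary choice of eigenfunctions enter here. -/
theorem NegligibleInProb.mono {X Y : ℕ → Ω → ℝ} (hY : NegligibleInProb P Y)
    (h : ∀ᶠ n in atTop, ∀ ω, X n ω ≤ Y n ω) : NegligibleInProb P X := by
  intro ε hε
  refine tendsto_of_tendsto_of_tendsto_of_le_of_le' tendsto_const_nhds (hY ε hε)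
    (Eventually.of_forall fun n => zero_le) ?_
  filter_upwards [h] with n hn
  exact measure_mono fun ω hω => le_trans hω (hn ω)

theorem BoundedInProb.negligible_mul {Y : ℕ → Ω → ℝ} (hY : BoundedInProb P Y)
    (hY0 : ∀ n ω, 0 ≤ Y n ω) {a : ℕ → ℝ} (ha : Tendsto a atTop (𝓝 0)) :
    NegligibleInProb P fun n ω => a n * Y n ω := by
  intro ε hε
  rw [ENNReal.tendsto_nhds_zero]
  intro η hη
  obtain ⟨K, hK⟩ := hY η hη
  have h1 : ∀ᶠ n in atTop, |a n| * (|K| + 1) < ε := by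
    have : Tendsto (fun n => |a n| * (|K| + 1)) atTop (𝓝 0) := by
      simpa using ha.abs.mul_const (|K| + 1)
    exact this.eventually (gt_mem_nhds hε)
  filter_upwards [hK, h1] with n hn h2
  refine (measure_mono fun ω hω => ?_).trans hn
  by_contra hcon
  simp only [Set.mem_ofPred_eq, not_lt] at hcon hω
  have h3 : a n * Y n ω ≤ |a n| * (|K| + 1) := by
    refine mul_le_mul (le_abs_self _) (hcon.trans ?_) (hY0 n ω) (abs_nonneg _)
    linarith [le_abs_self K]
  linarith

end InProbability

/-! ### Replacing the estimated scores by the true scores -/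

section PlugIn

/-- The mean square of a finite stretch of a sequence. -/
def meanSq {E : Type*} [NormedAddCommGroup E] (n : ℕ) (x : ℤ → E) : ℝ :=
  (n : ℝ)⁻¹ * ∑ i ∈ Finset.Icc (1 : ℤ) n, ‖x i‖ ^ 2

theorem meanSq_nonneg {E : Type*} [NormedAddCommGroup E] (n : ℕ) (x : ℤ → E) :
    0 ≤ meanSq n x := by
  unfold meanSq; positivity

theorem sum_lagIndex_le {n : ℕ} (l : ℤ) {f : ℤ → ℝ} (hf : ∀ i, 0 ≤ f i) :
    ∑ i ∈ lagIndex n l, f i ≤ ∑ i ∈ Finset.Icc (1 : ℤ) n, f i := by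
  refine Finset.sum_le_sum_of_subset_of_nonneg (fun i hi => ?_) fun i _ _ => hf i
  rw [lagIndex] at hi
  split_ifs at hi <;> rw [Finset.mem_Icc] at hi ⊢ <;> omega

theorem sum_lagIndex_shift_le {n : ℕ} (l : ℤ) {f : ℤ → ℝ} (hf : ∀ i, 0 ≤ f i) :
    ∑ i ∈ lagIndex n l, f (i + l) ≤ ∑ i ∈ Finset.Icc (1 : ℤ) n, f i := by
  rw [← Finset.sum_image (g := fun i => i + l) fun a _ b _ hab => add_right_cancel hab]
  refine Finset.sum_le_sum_of_subset_of_nonneg (fun i hi => ?_) fun i _ _ => hf i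
  obtain ⟨k, hk, rfl⟩ := Finset.mem_image.1 hi
  rw [lagIndex] at hk
  split_ifs at hk <;> rw [Finset.mem_Icc] at hk ⊢ <;> omega

/-- The score error has mean square of order 1/n while the scores are of order 1. Young's inequality
with weight √n balances the cross terms at n^{-1/2}, uniformly in l. -/
theorem abs_crossCov_sub_le {n : ℕ} (hn : 1 ≤ n) (l : ℤ) {x y x' y' : ℤ → ℝ} {q B : ℝ}
    (hx : meanSq n (fun i => x' i - x i) ≤ q / n) (hy : meanSq n (fun i => y' i - y i) ≤ q / n)
    (hxB : meanSq n x ≤ B) (hyB : meanSq n y ≤ B) (hq : 0 ≤ q) :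
    |crossCov n x' y' l - crossCov n x y l| ≤ (2 * q + B) / √n := by
  have hn0 : (0 : ℝ) < n := by exact_mod_cast hn
  have hn1 : (1 : ℝ) ≤ n := by exact_mod_cast hn
  set t := √(n : ℝ) with ht
  have ht1 : 1 ≤ t := Real.one_le_sqrt.2 hn1
  have htt : t * t = n := Real.mul_self_sqrt hn0.le
  have ht0 : 0 < t := by linarith
  set dx : ℤ → ℝ := fun i => x' i - x i with hdx
  set dy : ℤ → ℝ := fun i => y' i - y i with hdy
  have hpt : ∀ i ∈ lagIndex n l, |x' i * y' (i + l) - x i * y (i + l)| ≤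
      (t + 1) / 2 * (‖dx i‖ ^ 2 + ‖dy (i + l)‖ ^ 2) +
        1 / (2 * t) * (‖x i‖ ^ 2 + ‖y (i + l)‖ ^ 2) := by
    intro i _
    have h1 : x' i * y' (i + l) - x i * y (i + l) =
        dx i * dy (i + l) + dx i * y (i + l) + x i * dy (i + l) := by
      simp only [hdx, hdy]; ring
    -- In the mixed terms the small factor a gets weight t = √n and the factor b of order one gets
    -- weight 1/t.
    have h2 : ∀ a b : ℝ, |a * b| ≤ t / 2 * a ^ 2 + 1 / (2 * t) * b ^ 2 := fun a b => by
      have h3 : t / 2 * a ^ 2 + 1 / (2 * t) * b ^ 2 = (t * t * a ^ 2 + b ^ 2) / (2 * t) := by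
        field_simp
      rw [h3, le_div_iff₀ (by positivity), abs_mul]
      have h4 := sq_nonneg (t * |a| - |b|)
      have h5 := sq_abs a
      have h6 := sq_abs b
      nlinarith
    have h7 : ∀ a b : ℝ, |a * b| ≤ 1 / 2 * (a ^ 2 + b ^ 2) := fun a b => by
      rw [abs_mul]
      nlinarith [sq_nonneg (|a| - |b|), sq_abs a, sq_abs b]
    rw [h1]
    refine (abs_add_three _ _ _).trans ?_
    have h8 := h7 (dx i) (dy (i + l))
    have h9 := h2 (dx i) (y (i + l))
    have h10 := h2 (dy (i + l)) (x i)
    rw [mul_comm (dy (i + l))] at h10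
    simp only [Real.norm_eq_abs, sq_abs]
    nlinarith
  have hsum : |crossCov n x' y' l - crossCov n x y l| ≤
      (t + 1) / 2 * (meanSq n dx + meanSq n dy) + 1 / (2 * t) * (meanSq n x + meanSq n y) := by
    rw [crossCov, crossCov, ← mul_sub, ← Finset.sum_sub_distrib, abs_mul,
      abs_of_pos (inv_pos.2 hn0)]
    have h1 := (Finset.abs_sum_le_sum_abs _ _).trans (Finset.sum_le_sum hpt)
    rw [Finset.sum_add_distrib, ← Finset.mul_sum, ← Finset.mul_sum, Finset.sum_add_distrib,
      Finset.sum_add_distrib] at h1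
    have h2 := sum_lagIndex_le (n := n) l (f := fun i => ‖dx i‖ ^ 2) fun i => by positivity
    have h3 := sum_lagIndex_shift_le (n := n) l (f := fun i => ‖dy i‖ ^ 2) fun i => by positivity
    have h4 := sum_lagIndex_le (n := n) l (f := fun i => ‖x i‖ ^ 2) fun i => by positivity
    have h5 := sum_lagIndex_shift_le (n := n) l (f := fun i => ‖y i‖ ^ 2) fun i => by positivity
    calc _ ≤ (n : ℝ)⁻¹ * ((t + 1) / 2 * (∑ i ∈ Finset.Icc (1 : ℤ) n, ‖dx i‖ ^ 2 +
          ∑ i ∈ Finset.Icc (1 : ℤ) n, ‖dy i‖ ^ 2) +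
          1 / (2 * t) * (∑ i ∈ Finset.Icc (1 : ℤ) n, ‖x i‖ ^ 2 +
          ∑ i ∈ Finset.Icc (1 : ℤ) n, ‖y i‖ ^ 2)) := by
          refine mul_le_mul_of_nonneg_left (h1.trans ?_) (by positivity)
          gcongr
      _ = _ := by simp only [meanSq]; ring
  refine hsum.trans ?_
  have hqn : q / n = q / t / t := by rw [← htt]; field_simp
  calc _ ≤ (t + 1) / 2 * (q / n + q / n) + 1 / (2 * t) * (B + B) := by gcongr
    _ = ((1 + 1 / t) * q + B) / t := by rw [hqn]; field_simp; ring
    _ ≤ (2 * q + B) / t := by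
        have : 1 / t ≤ 1 := (div_le_one ht0).2 ht1
        gcongr
        linarith

end PlugIn

/-! ### The model -/

instance instSecondCountableTopologyL2I : SecondCountableTopology L2I :=
  have : Fact ((2 : ENNReal) ≠ ⊤) := ⟨by simp⟩
  inferInstance

instance holderTriple_four_four_two : ENNReal.HolderTriple 4 4 2 := ⟨by
  have h : (4 : ENNReal) = 2 * 2 := by norm_num
  rw [h, ENNReal.mul_inv (by simp) (by simp), ← two_mul, ← mul_assoc,
    ENNReal.mul_inv_cancel (by simp) (by simp), one_mul]⟩

/-- By Fubini, x ↦ g x − g y is in Lᵖ for almost every y; fixing one such y, g differs from it by a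
constant. -/
theorem memLp_of_memLp_sub {A E : Type*} [MeasurableSpace A] {μ : Measure A}
    [IsProbabilityMeasure μ] [NormedAddCommGroup E] {g : A → E} (hg : StronglyMeasurable g)
    {p : ENNReal} (hp0 : p ≠ 0) (hp : p ≠ ⊤)
    (h : MemLp (fun z : A × A => g z.1 - g z.2) p (μ.prod μ)) : MemLp g p μ := by
  obtain ⟨y, hy⟩ := (h.integrable_norm_rpow hp0 hp).prod_left_ae.exists
  have h1 : MemLp (fun x => g x - g y) p μ :=
    (integrable_norm_rpow_iff (hg.sub stronglyMeasurable_const).aestronglyMeasurable hp0 hp).1 hy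
  have h2 : g = fun x => (g x - g y) + g y := by ext x; simp
  rw [h2]
  exact h1.add (memLp_const (g y))

section Model

variable {Ω S : Type*} [MeasurableSpace Ω] [MeasurableSpace S] {P : Measure Ω}
  {e : ℤ → Ω → S} {es : ℤ → ℕ → ℤ → Ω → S}

namespace IsInnovationSystem

/-- At lag 0 no innovation is kept, so the coupled past is an independent copy of the past and their
joint law is a product. The moment of g thus follows from the first coefficient alone. -/
theorem memLp_of_eLpNorm_sub_lt_top [IsProbabilityMeasure P] (he : IsInnovationSystem P e es)
    {E : Type*} [NormedAddCommGroup E] {g : (ℕ → S) → E} (hg : StronglyMeasurable g)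
    {p : ENNReal} (hp0 : p ≠ 0) (hp : p ≠ ⊤)
    (h : eLpNorm (fun ω => g (past e 0 ω) - g (coupledPast e es 0 0 ω)) p P < ⊤) :
    MemLp g p (pastLaw P e) := by
  have := he.isProbabilityMeasure_pastLaw
  have hi := (indepFun_iff_map_prod_eq_prod_map_map (he.measurable_past 0).aemeasurable
    (he.measurable_coupledPast 0 0).aemeasurable).1
    (he.indepFun_past_coupledPast (i := 0) (k := 0) (l := 0) (by simp))
  rw [he.map_past, he.map_coupledPast] at hi
  refine memLp_of_memLp_sub hg hp0 hp ?_
  rw [← hi, memLp_map_measure_iff (stronglyMeasurable_sub hg).aestronglyMeasurable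
    ((he.measurable_past 0).prodMk (he.measurable_coupledPast 0 0)).aemeasurable]
  exact ⟨((hg.comp_measurable (he.measurable_past 0)).sub
    (hg.comp_measurable (he.measurable_coupledPast 0 0))).aestronglyMeasurable, h⟩

theorem isShortRange_of_tsum_eLpNorm [IsProbabilityMeasure P] (he : IsInnovationSystem P e es)
    {E : Type*} [NormedAddCommGroup E] [NormedSpace ℝ E] {g : (ℕ → S) → E}
    (hg : StronglyMeasurable g) (hg4 : MemLp g 4 (pastLaw P e))
    (hg0 : ∫ x, g x ∂(pastLaw P e) = 0)
    (h : ∑' l : ℕ, eLpNorm (fun ω => g (past e 0 ω) - g (coupledPast e es 0 l ω)) 4 P < ⊤) :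
    IsShortRange P e g := by
  have := he.isProbabilityMeasure_pastLaw
  have hg2 : MemLp g 2 (pastLaw P e) := hg4.mono_exponent (by norm_num)
  refine ⟨hg, hg2, hg0, Summable.of_nonneg_of_le (fun l => depCoef_nonneg g l) (fun l => ?_)
    (ENNReal.summable_toReal h.ne)⟩
  have hm4 : MemLp (fun ω => g (past e 0 ω) - g (coupledPast e es 0 l ω)) 4 P :=
    (he.memLp_past hg4 0).sub (he.memLp_coupledPast hg4 0 l)
  have hm2 : MemLp (fun ω => g (past e 0 ω) - g (coupledPast e es 0 l ω)) 2 P :=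
    hm4.mono_exponent (by norm_num)
  rw [← he.rms_past_sub_coupledPast hg 0 l, rms_eq_toReal_eLpNorm hm2]
  exact ENNReal.toReal_mono hm4.2.ne (eLpNorm_le_eLpNorm_of_exponent_le (by norm_num) hm2.1)

/-- The centered tensor square of a functional. -/
def _root_.tensorSquare (C : L2II) (g : (ℕ → S) → L2I) (x : ℕ → S) : L2II :=
  tensorL2 (g x) (g x) - C

theorem _root_.memLp_tensorL2_self {A : Type*} [MeasurableSpace A] {μ : Measure A} {g : A → L2I}
    (hg : MemLp g 4 μ) : MemLp (fun x => tensorL2 (g x) (g x)) 2 μ := by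
  have h1 : MemLp (fun x => ‖g x‖ * ‖g x‖) 2 μ := hg.norm.mul hg.norm
  refine h1.mono (continuous_tensorL2_self.comp_aestronglyMeasurable hg.1)
    (Eventually.of_forall fun x => ?_)
  rw [norm_tensorL2, Real.norm_of_nonneg (by positivity)]

/-- From f⊗f − g⊗g = (f − g)⊗f + g⊗(f − g), Hölder in L⁴ bounds the coefficient by the L⁴
coefficient of g times 2‖g‖₄. -/
theorem isShortRange_tensorSquare [IsProbabilityMeasure P] (he : IsInnovationSystem P e es)
    {g : (ℕ → S) → L2I} (hg : StronglyMeasurable g) (hg4 : MemLp g 4 (pastLaw P e))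
    (h : ∑' l : ℕ, eLpNorm (fun ω => g (past e 0 ω) - g (coupledPast e es 0 l ω)) 4 P < ⊤)
    {C : L2II} (hC : C = ∫ x, tensorL2 (g x) (g x) ∂(pastLaw P e)) :
    IsShortRange P e (tensorSquare C g) := by
  have := he.isProbabilityMeasure_pastLaw
  have hT2 := memLp_tensorL2_self hg4
  have hZ : StronglyMeasurable (tensorSquare C g) :=
    (continuous_tensorL2_self.comp_stronglyMeasurable hg).sub stronglyMeasurable_const
  have hZ2 : MemLp (tensorSquare C g) 2 (pastLaw P e) := hT2.sub (memLp_const C)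
  refine ⟨hZ, hZ2, ?_, ?_⟩
  · simp only [tensorSquare]
    rw [integral_sub (hT2.integrable one_le_two) (integrable_const C), hC]
    simp
  set K := eLpNorm g 4 (pastLaw P e) with hK
  refine Summable.of_nonneg_of_le (fun l => depCoef_nonneg _ l) (fun l => ?_)
    ((ENNReal.summable_toReal h.ne).mul_right (K + K).toReal)
  have hX4 := he.memLp_past hg4 0
  have hY4 := he.memLp_coupledPast hg4 0 l
  set D : Ω → L2I := fun ω => g (past e 0 ω) - g (coupledPast e es 0 l ω) with hD
  have hD4 : MemLp D 4 P := hX4.sub hY4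
  have hXY4 : MemLp (fun ω => ‖g (past e 0 ω)‖ + ‖g (coupledPast e es 0 l ω)‖) 4 P :=
    hX4.norm.add hY4.norm
  have hprod : MemLp (fun ω => ‖D ω‖ * (‖g (past e 0 ω)‖ + ‖g (coupledPast e es 0 l ω)‖)) 2 P :=
    hXY4.mul hD4.norm
  have hKX : eLpNorm (fun ω => ‖g (past e 0 ω)‖ + ‖g (coupledPast e es 0 l ω)‖) 4 P ≤ K + K := by
    refine (eLpNorm_add_le hX4.1.norm hY4.1.norm (by norm_num)).trans (le_of_eq ?_)
    rw [eLpNorm_norm, eLpNorm_norm, hK]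
    congr 1
    · rw [← he.map_past 0, eLpNorm_map_measure hg.aestronglyMeasurable
        (he.measurable_past 0).aemeasurable]
      rfl
    · rw [← he.map_coupledPast 0 l, eLpNorm_map_measure hg.aestronglyMeasurable
        (he.measurable_coupledPast 0 l).aemeasurable]
      rfl
  have hKtop : K + K ≠ ⊤ := ENNReal.add_ne_top.2 ⟨hg4.2.ne, hg4.2.ne⟩
  rw [← he.rms_past_sub_coupledPast hZ 0 l]
  calc _ ≤ rms P (fun ω => ‖D ω‖ * (‖g (past e 0 ω)‖ + ‖g (coupledPast e es 0 l ω)‖)) := by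
        refine rms_mono hprod fun ω => ?_
        rw [Real.norm_of_nonneg (by positivity), tensorSquare, tensorSquare, sub_sub_sub_cancel_right]
        exact norm_tensorL2_self_sub_le _ _
    _ = (eLpNorm (fun ω => ‖D ω‖ * (‖g (past e 0 ω)‖ + ‖g (coupledPast e es 0 l ω)‖)) 2
        P).toReal := rms_eq_toReal_eLpNorm hprod
    _ ≤ (eLpNorm D 4 P * (K + K)).toReal := by
        refine ENNReal.toReal_mono (ENNReal.mul_ne_top hD4.2.ne hKtop) ?_
        have h1 := eLpNorm_le_eLpNorm_mul_eLpNorm_of_nnnorm (p := 4) (q := 4) (r := 2)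
          hD4.1.norm hXY4.1 (fun a b : ℝ => a * b) 1
          (Eventually.of_forall fun ω => by rw [one_mul, nnnorm_mul])
        refine h1.trans ?_
        rw [eLpNorm_norm, ENNReal.coe_one, one_mul]
        gcongr
    _ = _ := ENNReal.toReal_mul

theorem _root_.IsShortRange.inner_right [IsProbabilityMeasure P] (he : IsInnovationSystem P e es)
    {E : Type*} [NormedAddCommGroup E] [InnerProductSpace ℝ E] [CompleteSpace E]
    {F : (ℕ → S) → E} (hF : IsShortRange P e F) (v : E) :
    IsShortRange P e fun x => inner ℝ (F x) v := by
  have := he.isProbabilityMeasure_pastLaw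
  have hm : StronglyMeasurable fun x => inner ℝ (F x) v :=
    hF.stronglyMeasurable.inner stronglyMeasurable_const
  refine ⟨hm, hF.memLp.inner_const v, ?_, ?_⟩
  · simp only [real_inner_comm v]
    rw [integral_inner (hF.memLp.integrable one_le_two), hF.integral_eq_zero, inner_zero_right]
  · refine Summable.of_nonneg_of_le (fun l => depCoef_nonneg _ l) (fun l => ?_)
      (hF.summable.mul_left ‖v‖)
    have hm2 : MemLp (fun ω => F (past e 0 ω) - F (coupledPast e es 0 l ω)) 2 P :=
      (he.memLp_past hF.memLp 0).sub (he.memLp_coupledPast hF.memLp 0 l)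
    rw [← he.rms_past_sub_coupledPast hm 0 l,
      ← he.rms_past_sub_coupledPast hF.stronglyMeasurable 0 l,
      ← rms_congr (fun ω => norm_norm (F (past e 0 ω) - F (coupledPast e es 0 l ω))),
      ← rms_const_mul (norm_nonneg v)]
    refine rms_mono (hm2.norm.const_mul ‖v‖) fun ω => ?_
    rw [← inner_sub_left, Real.norm_of_nonneg (mul_nonneg (norm_nonneg v) (norm_nonneg _)),
      mul_comm]
    exact norm_inner_le_norm _ _

/-! ### Stochastic orders -/

theorem boundedInProb_meanSq [IsProbabilityMeasure P] (he : IsInnovationSystem P e es)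
    {E : Type*} [NormedAddCommGroup E] [NormedSpace ℝ E] {F : (ℕ → S) → E}
    (hF : IsShortRange P e F) :
    BoundedInProb P fun n ω => meanSq n fun i => F (past e i ω) := by
  have hI : ∀ i, Integrable (fun ω => ‖F (past e i ω)‖ ^ 2) P := fun i =>
    (he.memLp_past hF.memLp i).norm.integrable_sq
  refine boundedInProb_of_integral_le (C := rms (pastLaw P e) F ^ 2)
    (fun n => (integrable_finsetSum _ fun i _ => hI i).const_mul _)
    (fun n ω => meanSq_nonneg n _) fun n => ?_
  simp only [meanSq]
  rw [integral_const_mul, integral_finsetSum _ fun i _ => hI i]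
  simp only [← rms_sq, he.rms_past hF.stronglyMeasurable]
  rw [Finset.sum_const, nsmul_eq_mul, ← mul_assoc]
  rcases Nat.eq_zero_or_pos n with rfl | hn
  · simp; positivity
  · have : (n : ℝ) ≠ 0 := by exact_mod_cast hn.ne'
    simp [this]

/-- The root-n rate in Hilbert space. The second moment of the sum is at most 2nσ Σδ_d, so Chebyshev
replaces a central limit theorem. -/
theorem boundedInProb_mean [IsProbabilityMeasure P] (he : IsInnovationSystem P e es)
    {E : Type*} [NormedAddCommGroup E] [InnerProductSpace ℝ E] [CompleteSpace E]
    {F : (ℕ → S) → E} (hF : IsShortRange P e F) :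
    BoundedInProb P fun n ω => n * ‖sampleMean n fun i => F (past e i ω)‖ ^ 2 := by
  have hm : ∀ n : ℕ, MemLp (fun ω => sampleMean n fun i => F (past e i ω)) 2 P := fun n =>
    (memLp_finsetSum _ fun i _ => he.memLp_past hF.memLp i).const_smul (n : ℝ)⁻¹
  refine boundedInProb_of_integral_le
    (C := 2 * (rms (pastLaw P e) F * ∑' d, depCoef P e F d))
    (fun n => (hm n).norm.integrable_sq.const_mul _) (fun n ω => by positivity) fun n => ?_
  have hσ := rms_nonneg (P := pastLaw P e) F
  have h1 : ∑ d ∈ Finset.range n, rms (pastLaw P e) F * depCoef P e F d ≤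
      rms (pastLaw P e) F * ∑' d, depCoef P e F d := by
    rw [← Finset.mul_sum]
    exact mul_le_mul_of_nonneg_left
      (hF.summable.sum_le_tsum _ fun d _ => depCoef_nonneg F d) hσ
  have h2 := he.integral_norm_sum_past_sq_le hF.stronglyMeasurable hF.memLp hF.integral_eq_zero n
  have h0 : 0 ≤ rms (pastLaw P e) F * ∑' d, depCoef P e F d :=
    mul_nonneg hσ (tsum_nonneg fun d => depCoef_nonneg F d)
  rcases Nat.eq_zero_or_pos n with rfl | hn
  · simpa using h0
  have hn0 : (0 : ℝ) < n := by exact_mod_cast hn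
  simp only [sampleMean, norm_smul, mul_pow, norm_inv, Real.norm_natCast]
  rw [integral_const_mul, integral_const_mul]
  calc _ ≤ (n : ℝ) * ((n : ℝ)⁻¹ ^ 2 * (n * (2 * (rms (pastLaw P e) F *
        ∑' d, depCoef P e F d)))) := by
        gcongr
        exact h2.trans (by gcongr)
    _ = _ := by field_simp

end IsInnovationSystem

end Model

/-! ### The sample covariance and the estimated scores -/

section Sample

theorem sampleMean_sub {E : Type*} [AddCommGroup E] [Module ℝ E] (n : ℕ) (x y : ℤ → E) :
    sampleMean n (fun i => x i - y i) = sampleMean n x - sampleMean n y := by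
  simp only [sampleMean, Finset.sum_sub_distrib, smul_sub]

theorem sampleMean_const {E : Type*} [AddCommGroup E] [Module ℝ E] {n : ℕ} (hn : 1 ≤ n) (c : E) :
    sampleMean n (fun _ => c) = c := by
  have : (n : ℝ) ≠ 0 := by exact_mod_cast (by omega : n ≠ 0)
  rw [sampleMean, Finset.sum_const, Int.card_Icc, ← Nat.cast_smul_eq_nsmul ℝ, smul_smul]
  simp [this]

theorem sampleMean_map {E F : Type*} [AddCommGroup E] [Module ℝ E] [AddCommGroup F] [Module ℝ F]
    (T : E →ₗ[ℝ] F) (n : ℕ) (x : ℤ → E) :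
    sampleMean n (fun i => T (x i)) = T (sampleMean n x) := by
  simp only [sampleMean, map_smul, map_sum]

theorem sub_sampleMean_const_add {E : Type*} [AddCommGroup E] [Module ℝ E] {n : ℕ} (hn : 1 ≤ n)
    (c : E) (y : ℤ → E) (i : ℤ) :
    (c + y i) - sampleMean n (fun i => c + y i) = y i - sampleMean n y := by
  have h : sampleMean n (fun i => c + y i) = c + sampleMean n y := by
    have h1 := sampleMean_sub n (fun i => c + y i) (fun _ => c)
    simp only [add_sub_cancel_left] at h1
    rw [h1, sampleMean_const hn]; abel
  rw [h]; abel

/-- The location drops out, and centring by the sample mean costs one rank-one term, which is of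
order 1/n in probability for short-range y. -/
theorem sampleCov_const_add {n : ℕ} (hn : 1 ≤ n) (c : L2I) (y : ℤ → L2I) :
    sampleCov n (fun i => c + y i) =
      sampleMean n (fun i => tensorL2 (y i) (y i)) -
        tensorL2 (sampleMean n y) (sampleMean n y) := by
  simp only [sampleCov, sub_sampleMean_const_add hn]
  set m := sampleMean n y with hm
  have h1 : ∀ i, tensorL2 (y i - m) (y i - m) =
      (tensorL2 (y i) (y i) - tensorL2 (y i) m) - (tensorL2 m (y i) - tensorL2 m m) := fun i => by
    rw [tensorL2_sub_left, tensorL2_sub_right, tensorL2_sub_right]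
  have h2 := sampleMean_map (tensorBilin.flip m).toLinearMap n y
  have h3 := sampleMean_map (tensorBilin m).toLinearMap n y
  simp only [ContinuousLinearMap.coe_coe, ContinuousLinearMap.flip_apply, tensorBilin_apply,
    ← hm] at h2 h3
  simp only [h1]
  rw [sampleMean_sub, sampleMean_sub, sampleMean_sub, sampleMean_const hn, h2, h3]
  abel

theorem norm_sampleCov_sub_le {n : ℕ} (hn : 1 ≤ n) (c : L2I) (y : ℤ → L2I) (C : L2II) :
    ‖sampleCov n (fun i => c + y i) - C‖ ≤
      ‖sampleMean n (fun i => tensorL2 (y i) (y i) - C)‖ + ‖sampleMean n y‖ ^ 2 := by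
  rw [sampleCov_const_add hn, sampleMean_sub, sampleMean_const hn, sub_right_comm]
  refine (norm_sub_le _ _).trans (le_of_eq ?_)
  rw [norm_tensorL2, sq]

/-- The stochastic bound for the squared estimation error of the scores, times `n`. -/
def scoreErrorBound (n : ℕ) (y : ℤ → L2I) (C : L2II) (c : ℝ) : ℝ :=
  3 * ((n * ‖sampleMean n y‖ ^ 2) * (8 * meanSq n y + 2 * (n * ‖sampleMean n y‖ ^ 2)) +
    (1 + c ^ 2 * meanSq n fun i => tensorL2 (y i) (y i) - C) *
      (2 * (n * ‖sampleMean n fun i => tensorL2 (y i) (y i) - C‖ ^ 2) +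
        2 * ((n * ‖sampleMean n y‖ ^ 2) * (n * ‖sampleMean n y‖ ^ 2))))

theorem scoreErrorBound_nonneg (n : ℕ) (y : ℤ → L2I) (C : L2II) (c : ℝ) :
    0 ≤ scoreErrorBound n y C c := by
  have h1 := meanSq_nonneg n y
  have h2 := meanSq_nonneg n fun i => tensorL2 (y i) (y i) - C
  unfold scoreErrorBound
  positivity

/-- Three errors contribute: centring X_i by its sample mean, centring the products by Ĉ instead of
C, and projecting on the estimated eigenfunction. Each has mean square of order 1/n up to
stochastically bounded factors, collected in `scoreErrorBound`. -/
theorem meanSq_scoreHat_sub_le {n d : ℕ} (hn : 1 ≤ n) (m : L2I) (y : ℤ → L2I) (C : L2II)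
    {phi : L2I} {phiHat : ℕ → L2I} (j : Fin d) (hphiHat : ‖phiHat j‖ = 1) {c : ℝ}
    (hproj : ‖tensorL2 (phiHat j) (phiHat j) - tensorL2 phi phi‖ ≤
      c * ‖sampleCov n (fun i => m + y i) - C‖) :
    meanSq n (fun i => scoreHat n d (fun i => m + y i) phiHat i j -
      inner ℝ (tensorL2 (y i) (y i) - C) (tensorL2 phi phi)) ≤ scoreErrorBound n y C c / n := by
  have hn0 : (0 : ℝ) < n := by exact_mod_cast hn
  have hn1 : (1 : ℝ) ≤ n := by exact_mod_cast hn
  set Chat := sampleCov n (fun i => m + y i) with hChat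
  set D := ‖Chat - C‖ with hD
  set b := sampleMean n y with hb
  set z : ℤ → L2II := fun i => tensorL2 (y i) (y i) - C with hz
  set H := tensorL2 (phiHat j) (phiHat j) with hH
  set K := tensorL2 phi phi with hK
  have hH1 : ‖H‖ = 1 := by rw [hH, norm_tensorL2, hphiHat, one_mul]
  have hpt : ∀ i, ‖scoreHat n d (fun i => m + y i) phiHat i j - inner ℝ (z i) K‖ ^ 2 ≤
      3 * (‖b‖ ^ 2 * (8 * ‖y i‖ ^ 2 + 2 * ‖b‖ ^ 2) + D ^ 2 + c ^ 2 * D ^ 2 * ‖z i‖ ^ 2) := by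
    intro i
    have h1 : scoreHat n d (fun i => m + y i) phiHat i j - inner ℝ (z i) K =
        inner ℝ (tensorL2 (y i - b) (y i - b) - tensorL2 (y i) (y i)) H -
        inner ℝ (Chat - C) H + inner ℝ (z i) (H - K) := by
      simp only [scoreHat, sub_sampleMean_const_add hn, ← hChat, ← hb, ← hH, hz,
        inner_sub_left, inner_sub_right]
      ring
    have h2 : ‖inner ℝ (tensorL2 (y i - b) (y i - b) - tensorL2 (y i) (y i)) H‖ ≤
        ‖b‖ * (2 * ‖y i‖ + ‖b‖) := by
      refine (norm_inner_le_norm _ _).trans ?_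
      rw [hH1, mul_one]
      refine (norm_tensorL2_self_sub_le _ _).trans ?_
      rw [sub_sub_cancel_left, norm_neg]
      have := norm_sub_le (y i) b
      exact mul_le_mul_of_nonneg_left (by linarith) (norm_nonneg _)
    have h3 : ‖inner ℝ (Chat - C) H‖ ≤ D := by
      refine (norm_inner_le_norm _ _).trans ?_
      rw [hH1, mul_one]
    have h4 : ‖inner ℝ (z i) (H - K)‖ ≤ c * D * ‖z i‖ := by
      refine (norm_inner_le_norm _ _).trans ?_
      rw [mul_comm]
      gcongr
    have h5 : ‖scoreHat n d (fun i => m + y i) phiHat i j - inner ℝ (z i) K‖ ≤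
        ‖b‖ * (2 * ‖y i‖ + ‖b‖) + D + c * D * ‖z i‖ := by
      rw [h1]
      refine (norm_add_le _ _).trans (add_le_add ((norm_sub_le _ _).trans ?_) h4)
      exact add_le_add h2 h3
    refine (pow_le_pow_left₀ (norm_nonneg _) h5 2).trans ?_
    have h6 : ∀ r s t : ℝ, (r + s + t) ^ 2 ≤ 3 * (r ^ 2 + s ^ 2 + t ^ 2) := fun r s t => by
      nlinarith [sq_nonneg (r - s), sq_nonneg (s - t), sq_nonneg (r - t)]
    refine (h6 _ _ _).trans ?_
    have h7 : (2 * ‖y i‖ + ‖b‖) ^ 2 ≤ 8 * ‖y i‖ ^ 2 + 2 * ‖b‖ ^ 2 := by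
      nlinarith [sq_nonneg (2 * ‖y i‖ - ‖b‖)]
    rw [mul_pow, mul_pow, mul_pow]
    gcongr
  have hD2 : n * D ^ 2 ≤ 2 * (n * ‖sampleMean n z‖ ^ 2) +
      2 * ((n * ‖b‖ ^ 2) * (n * ‖b‖ ^ 2)) := by
    have h1 : D ^ 2 ≤ (‖sampleMean n z‖ + ‖b‖ ^ 2) ^ 2 :=
      pow_le_pow_left₀ (norm_nonneg _) (norm_sampleCov_sub_le hn m y C) 2
    have h2 : (‖sampleMean n z‖ + ‖b‖ ^ 2) ^ 2 ≤
        2 * ‖sampleMean n z‖ ^ 2 + 2 * (‖b‖ ^ 2 * ‖b‖ ^ 2) := by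
      nlinarith [sq_nonneg (‖sampleMean n z‖ - ‖b‖ ^ 2)]
    calc n * D ^ 2 ≤ n * (2 * ‖sampleMean n z‖ ^ 2 + 2 * (‖b‖ ^ 2 * ‖b‖ ^ 2)) := by
          gcongr; exact h1.trans h2
      -- The explicit 1 is then enlarged to n, so that only the bounded quantity n‖b‖² appears.
      _ = 2 * (n * ‖sampleMean n z‖ ^ 2) + 2 * ((n * ‖b‖ ^ 2) * (1 * ‖b‖ ^ 2)) := by ring
      _ ≤ _ := by gcongr
  have hB := meanSq_nonneg n z
  have hA := meanSq_nonneg n y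
  calc meanSq n (fun i => scoreHat n d (fun i => m + y i) phiHat i j - inner ℝ (z i) K)
      ≤ (n : ℝ)⁻¹ * ∑ i ∈ Finset.Icc (1 : ℤ) n,
        3 * (‖b‖ ^ 2 * (8 * ‖y i‖ ^ 2 + 2 * ‖b‖ ^ 2) + D ^ 2 + c ^ 2 * D ^ 2 * ‖z i‖ ^ 2) := by
        rw [meanSq]
        exact mul_le_mul_of_nonneg_left (Finset.sum_le_sum fun i _ => hpt i) (by positivity)
    _ = 3 * (‖b‖ ^ 2 * (8 * meanSq n y + 2 * ‖b‖ ^ 2) + D ^ 2 + c ^ 2 * D ^ 2 * meanSq n z) := by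
        simp only [← Finset.mul_sum, Finset.sum_add_distrib, mul_add, Finset.sum_const,
          nsmul_eq_mul, meanSq, Int.card_Icc, add_sub_cancel_right, Int.toNat_natCast]
        field_simp
    _ = 3 * ((n * ‖b‖ ^ 2) * (8 * meanSq n y + 2 * (1 * ‖b‖ ^ 2)) +
        (1 + c ^ 2 * meanSq n z) * (n * D ^ 2)) / n := by
        field_simp
        ring
    _ ≤ _ := by
        unfold scoreErrorBound
        gcongr

/-- Ĉ is by definition the average of the centred tensor squares, so the estimated scores average to
zero and the second centring in the estimator does nothing. -/
theorem sampleMean_scoreHat {n : ℕ} (hn : 1 ≤ n) (d : ℕ) (x : ℤ → L2I) (phiHat : ℕ → L2I) :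
    sampleMean n (scoreHat n d x phiHat) = 0 := by
  ext j
  have h1 := sampleMean_map (LinearMap.proj j : (Fin d → ℝ) →ₗ[ℝ] ℝ) n (scoreHat n d x phiHat)
  have h2 := sampleMean_map (innerSL ℝ (tensorL2 (phiHat j) (phiHat j))).toLinearMap n fun i =>
    tensorL2 (x i - sampleMean n x) (x i - sampleMean n x) - sampleCov n x
  rw [sampleMean_sub, sampleMean_const hn, ← sampleCov, sub_self, map_zero] at h2
  simp only [LinearMap.proj_apply] at h1
  rw [← h1]
  refine Eq.trans ?_ h2
  simp only [scoreHat, ContinuousLinearMap.coe_coe, innerSL_apply_apply]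
  congr 1
  ext i
  exact real_inner_comm _ _

theorem lagWindowEstimator_scoreHat_apply {n d : ℕ} (hn : 1 ≤ n) (w : ℝ → ℝ) (h : ℝ)
    (x : ℤ → L2I) (phiHat : ℕ → L2I) (j j' : Fin d) :
    lagWindowEstimator w h n (scoreHat n d x phiHat) j j' =
      ∑ l ∈ Finset.Icc (-(n : ℤ)) n, w (l / h) *
        crossCov n (fun i => scoreHat n d x phiHat i j) (fun i => scoreHat n d x phiHat i j') l := by
  rw [lagWindowEstimator, tsum_eq_sum (s := Finset.Icc (-(n : ℤ)) n), Matrix.sum_apply]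
  · refine Finset.sum_congr rfl fun l _ => ?_
    rw [Matrix.smul_apply, sampleAutocov, Matrix.smul_apply, Matrix.sum_apply, crossCov,
      sampleMean_scoreHat hn]
    simp only [smul_eq_mul, Matrix.vecMulVec_apply, sub_zero]
  · intro l hl
    have h1 : (n : ℤ) ≤ |l| := by
      rw [Finset.mem_Icc, not_and_or] at hl
      rw [le_abs]; omega
    rw [sampleAutocov, lagIndex_eq_empty h1, Finset.sum_empty, smul_zero, smul_zero]

theorem frobenius_norm_le_sum {d : ℕ} (A : Matrix (Fin d) (Fin d) ℝ) :
    ‖A‖ ≤ ∑ k : Fin d × Fin d, |A k.1 k.2| := by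
  have h1 : ∑ i, ∑ j, ‖A i j‖ ^ (2 : ℝ) ≤ (∑ k : Fin d × Fin d, |A k.1 k.2|) ^ 2 := by
    rw [← Fintype.sum_prod_type' (f := fun i j => ‖A i j‖ ^ (2 : ℝ)), sq, Finset.sum_mul]
    refine Finset.sum_le_sum fun k _ => ?_
    rw [Real.rpow_two, sq, Real.norm_eq_abs]
    exact mul_le_mul_of_nonneg_left
      (Finset.single_le_sum (f := fun k : Fin d × Fin d => |A k.1 k.2|)
        (fun k _ => abs_nonneg _) (Finset.mem_univ k)) (abs_nonneg _)
  have h0 : 0 ≤ ∑ k : Fin d × Fin d, |A k.1 k.2| := Finset.sum_nonneg fun k _ => abs_nonneg _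
  rw [Matrix.frobenius_norm_def, ← Real.sqrt_eq_rpow]
  exact (Real.sqrt_le_sqrt h1).trans (le_of_eq (Real.sqrt_sq h0))

end Sample

/-! ### Entrywise consistency and assembly -/

section MainTheorem

variable {Ω S : Type*} [MeasurableSpace Ω] [MeasurableSpace S] {P : Measure Ω}
  {e : ℤ → Ω → S} {es : ℤ → ℕ → ℤ → Ω → S}

namespace IsInnovationSystem

/-- The bound is a polynomial with nonnegative coefficients in four nonnegative sequences, each
bounded in probability: n times the squared sample means, and the mean squares, of g and of its
centred tensor square. -/
theorem boundedInProb_scoreErrorBound [IsProbabilityMeasure P] (he : IsInnovationSystem P e es)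
    {g : (ℕ → S) → L2I} {C : L2II} (hg : IsShortRange P e g)
    (hZ : IsShortRange P e (tensorSquare C g)) (c : ℝ) :
    BoundedInProb P fun n ω => scoreErrorBound n (fun i => g (past e i ω)) C c := by
  have hu := he.boundedInProb_mean hg
  have hA := he.boundedInProb_meanSq hg
  have huZ := he.boundedInProb_mean hZ
  have hB := he.boundedInProb_meanSq hZ
  have hc8 : ∀ r : ℝ, 0 ≤ r → ∀ {Y : ℕ → Ω → ℝ}, BoundedInProb P Y → (∀ n ω, 0 ≤ Y n ω) →
      BoundedInProb P fun n ω => r * Y n ω := fun r hr _ hY hY0 =>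
    (boundedInProb_const r).mul hY (fun _ _ => hr) hY0
  have hu0 : ∀ (n : ℕ) (ω : Ω), 0 ≤ n * ‖sampleMean n fun i => g (past e i ω)‖ ^ 2 :=
    fun n ω => by positivity
  have huZ0 : ∀ (n : ℕ) (ω : Ω),
      0 ≤ n * ‖sampleMean n fun i => tensorSquare C g (past e i ω)‖ ^ 2 :=
    fun n ω => by positivity
  have hA0 : ∀ (n : ℕ) (ω : Ω), 0 ≤ meanSq n fun i => g (past e i ω) :=
    fun n ω => meanSq_nonneg _ _
  have hB0 : ∀ (n : ℕ) (ω : Ω), 0 ≤ meanSq n fun i => tensorSquare C g (past e i ω) :=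
    fun n ω => meanSq_nonneg _ _
  have h1 := hu.mul ((hc8 8 (by norm_num) hA hA0).add (hc8 2 (by norm_num) hu hu0)) hu0
    fun n ω => add_nonneg (mul_nonneg (by norm_num) (hA0 n ω)) (mul_nonneg (by norm_num) (hu0 n ω))
  have h2 := ((boundedInProb_const (P := P) 1).add (hc8 (c ^ 2) (sq_nonneg c) hB hB0)).mul
    ((hc8 2 (by norm_num) huZ huZ0).add (hc8 2 (by norm_num) (hu.mul hu hu0 hu0)
      fun n ω => mul_nonneg (hu0 n ω) (hu0 n ω)))
    (fun n ω => add_nonneg zero_le_one (mul_nonneg (sq_nonneg c) (hB0 n ω)))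
    fun n ω => add_nonneg (mul_nonneg (by norm_num) (huZ0 n ω))
      (mul_nonneg (by norm_num) (mul_nonneg (hu0 n ω) (hu0 n ω)))
  refine hc8 3 (by norm_num) (h1.add h2) fun n ω => add_nonneg ?_ ?_
  · exact mul_nonneg (hu0 n ω) (add_nonneg (mul_nonneg (by norm_num) (hA0 n ω))
      (mul_nonneg (by norm_num) (hu0 n ω)))
  · exact mul_nonneg (add_nonneg zero_le_one (mul_nonneg (sq_nonneg c) (hB0 n ω)))
      (add_nonneg (mul_nonneg (by norm_num) (huZ0 n ω))
        (mul_nonneg (by norm_num) (mul_nonneg (hu0 n ω) (hu0 n ω))))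

/-- Consistency of one entry of the lag-window estimator. -/
theorem negligibleInProb_entry [IsProbabilityMeasure P] (he : IsInnovationSystem P e es)
    {g : (ℕ → S) → L2I} {C : L2II} (hg : IsShortRange P e g)
    (hZ : IsShortRange P e (tensorSquare C g)) (m : L2I)
    {lam : ℕ → ℝ} {phi : ℕ → L2I} (hphi : IsEigenSystem C lam phi)
    {d : ℕ} (hgap : ∀ j < d, lam (j + 1) < lam j)
    {lamHat : ℕ → Ω → ℕ → ℝ} {phiHat : ℕ → Ω → ℕ → L2I}
    (hphiHat : ∀ n ω, IsEigenSystem (sampleCov n fun i => m + g (past e i ω))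
      (lamHat n ω) (phiHat n ω))
    {w : ℝ → ℝ} (hw : IsLagWindow w) {h : ℕ → ℝ} (hpos : ∀ᶠ n in atTop, 0 < h n)
    (hh : Tendsto (fun n : ℕ => 1 / h n + h n / √(n : ℝ)) atTop (𝓝 0)) (j j' : Fin d) :
    NegligibleInProb P fun n ω =>
      |∑' l : ℤ, lagCov P e (fun x => inner ℝ (tensorSquare C g x) (tensorL2 (phi j) (phi j)))
          (fun x => inner ℝ (tensorSquare C g x) (tensorL2 (phi j') (phi j'))) l -
        lagWindowEstimator w (h n) n
          (scoreHat n d (fun i => m + g (past e i ω)) (phiHat n ω)) j j'| := by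
  obtain ⟨W, s, hW, hs, hWb, hWs⟩ := hw.exists_bound
  obtain ⟨hh1, hh2⟩ := bandwidth_limits hpos hh
  obtain ⟨c1, hproj1⟩ := hphi.exists_norm_tensorL2_sub_le hgap j.2
  obtain ⟨c2, hproj2⟩ := hphi.exists_norm_tensorL2_sub_le hgap j'.2
  set c := max c1 c2 with hc
  set F : Fin d → (ℕ → S) → ℝ := fun k x =>
    inner ℝ (tensorSquare C g x) (tensorL2 (phi k) (phi k)) with hF
  have hFs : ∀ k, IsShortRange P e (F k) := fun k => hZ.inner_right he _
  set Sg := ∑' l : ℤ, lagCov P e (F j) (F j') l with hSg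
  -- The infeasible estimator built from the true scores. It is close to the limit in L¹ and close
  -- to the actual estimator through the plug-in bound.
  set T : ℕ → Ω → ℝ := fun n ω => ∑ l ∈ Finset.Icc (-(n : ℤ)) n, w (l / h n) *
    crossCov n (fun i => F j (past e i ω)) (fun i => F j' (past e i ω)) l with hT
  set q : ℕ → Ω → ℝ := fun n ω => scoreErrorBound n (fun i => g (past e i ω)) C c with hq
  set B : ℕ → Ω → ℝ := fun n ω => meanSq n fun i => tensorSquare C g (past e i ω) with hB
  have hq0 : ∀ n ω, 0 ≤ q n ω := fun n ω => scoreErrorBound_nonneg _ _ _ _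
  have hB0 : ∀ n ω, 0 ≤ B n ω := fun n ω => meanSq_nonneg _ _
  have hTI : ∀ n, Integrable (fun ω => |T n ω - Sg|) P := fun n =>
    ((integrable_finsetSum _ fun l _ =>
      (he.integrable_crossCov (hFs j) (hFs j') n l).const_mul _).sub (integrable_const Sg)).abs
  have hneg1 : NegligibleInProb P fun n ω => |T n ω - Sg| :=
    negligibleInProb_of_tendsto_integral hTI (fun n ω => abs_nonneg _)
      (he.tendsto_integral_abs_lagWindow (hFs j) (hFs j') hw hpos hh)
  have hbdd : BoundedInProb P fun n ω => 2 * q n ω + B n ω :=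
    ((boundedInProb_const 2).mul (he.boundedInProb_scoreErrorBound hg hZ c)
      (fun _ _ => zero_le_two) hq0).add (he.boundedInProb_meanSq hZ)
  have hneg2 := hbdd.negligible_mul
    (fun n ω => add_nonneg (mul_nonneg zero_le_two (hq0 n ω)) (hB0 n ω))
    (tendsto_window_mass hh2 W s)
  refine (hneg1.add hneg2).mono ?_
  filter_upwards [hpos, eventually_ge_atTop 1] with n hn hn1 ω
  have hphi1 : ∀ k, ‖tensorL2 (phi k) (phi k)‖ = 1 := fun k => by
    rw [norm_tensorL2, hphi.orthonormal.1 k, one_mul]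
  have hFB : ∀ k, meanSq n (fun i => F k (past e i ω)) ≤ B n ω := fun k => by
    refine mul_le_mul_of_nonneg_left (Finset.sum_le_sum fun i _ => ?_) (by positivity)
    refine pow_le_pow_left₀ (norm_nonneg _) ((norm_inner_le_norm _ _).trans ?_) 2
    rw [hphi1, mul_one]
  have hE : ∀ (k : Fin d) (c' : ℝ), c' ≤ c →
      ‖tensorL2 (phiHat n ω k) (phiHat n ω k) - tensorL2 (phi k) (phi k)‖ ≤
        c' * ‖sampleCov n (fun i => m + g (past e i ω)) - C‖ →
      meanSq n (fun i => scoreHat n d (fun i => m + g (past e i ω)) (phiHat n ω) i k -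
        F k (past e i ω)) ≤ q n ω / n := fun k c' hc' hle =>
    meanSq_scoreHat_sub_le hn1 m (fun i => g (past e i ω)) C k ((hphiHat n ω).orthonormal.1 k)
      (hle.trans (mul_le_mul_of_nonneg_right hc' (norm_nonneg _)))
  have hE1 := hE j c1 (le_max_left _ _) (hproj1 _ _ _ (hphiHat n ω))
  have hE2 := hE j' c2 (le_max_right _ _) (hproj2 _ _ _ (hphiHat n ω))
  rw [lagWindowEstimator_scoreHat_apply hn1]
  set sh := scoreHat n d (fun i => m + g (past e i ω)) (phiHat n ω) with hsh
  have hdiff : |T n ω - ∑ l ∈ Finset.Icc (-(n : ℤ)) n, w (l / h n) *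
      crossCov n (fun i => sh i j) (fun i => sh i j') l| ≤
      W * (2 * (s * h n) + 1) / √n * (2 * q n ω + B n ω) := by
    rw [abs_sub_comm, hT, ← Finset.sum_sub_distrib]
    calc _ ≤ ∑ l ∈ Finset.Icc (-(n : ℤ)) n, |w (l / h n)| * ((2 * q n ω + B n ω) / √n) := by
          refine (Finset.abs_sum_le_sum_abs _ _).trans (Finset.sum_le_sum fun l _ => ?_)
          rw [← mul_sub, abs_mul]
          exact mul_le_mul_of_nonneg_left
            (abs_crossCov_sub_le hn1 l hE1 hE2 (hFB j) (hFB j') (hq0 n ω)) (abs_nonneg _)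
      _ ≤ W * (2 * (s * h n) + 1) * ((2 * q n ω + B n ω) / √n) := by
          rw [← Finset.sum_mul]
          exact mul_le_mul_of_nonneg_right (hWs (h n) hn _) (div_nonneg
            (add_nonneg (mul_nonneg zero_le_two (hq0 n ω)) (hB0 n ω)) (Real.sqrt_nonneg _))
      _ = _ := by ring
  have htri := abs_sub_le Sg (T n ω) (∑ l ∈ Finset.Icc (-(n : ℤ)) n, w (l / h n) *
      crossCov n (fun i => sh i j) (fun i => sh i j') l)
  rw [abs_sub_comm Sg (T n ω)] at htri
  exact htri.trans (add_le_add le_rfl hdiff)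

end IsInnovationSystem

end MainTheorem

end

theorem mainTheorem7
    {Ω S : Type*} [MeasurableSpace Ω] [MeasurableSpace S]
    (P : Measure Ω) [IsProbabilityMeasure P]
    -- the errors: a centered Bernoulli shift that is approximable in `L^p` for some `p > 4`
    (g : (ℕ → S) → L2I) (hg : Measurable g)
    (e : ℤ → Ω → S) (es : ℤ → ℕ → ℤ → Ω → S) (he : IsInnovationSystem P e es)
    (eps : ℤ → Ω → L2I) (heps : ∀ i ω, eps i ω = bernoulliShift g e i ω)
    (hcentered : ∀ i, ∫ ω, eps i ω ∂P = 0)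
    (p : ℝ) (hp : 4 < p)
    (happrox : ∀ i, ∑' l : ℕ,
      eLpNorm (fun ω => eps i ω - coupledShift g e es i l ω) (ENNReal.ofReal p) P < ⊤)
    -- the observations
    (mean : L2I) (X : ℤ → Ω → L2I) (hX : ∀ i ω, X i ω = mean + eps i ω)
    -- the population eigenvalues and eigenfunctions
    (lam : ℕ → ℝ) (phi : ℕ → L2I) (hphi : IsEigenSystem (covKernel P (X 0)) lam phi)
    (d : ℕ) (hd : 1 ≤ d) (hgap : ∀ j < d, lam (j + 1) < lam j)
    -- the empirical eigenvalues and eigenfunctions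
    (lamHat : ℕ → Ω → ℕ → ℝ) (phiHat : ℕ → Ω → ℕ → L2I)
    (hphiHat : ∀ n ω,
      IsEigenSystem (sampleCov n fun i => X i ω) (lamHat n ω) (phiHat n ω))
    -- the weight function and the bandwidth
    (w : ℝ → ℝ) (hw : IsLagWindow w)
    (h : ℕ → ℝ) (hpos : ∀ᶠ n in atTop, 0 < h n)
    (hh : Tendsto (fun n : ℕ => 1 / h n + h n / √(n : ℝ)) atTop (𝓝 0)) :
    (∀ j j' : Fin d,
      Summable fun i : ℤ => cov[score P eps phi 0 j, score P eps phi i j'; P]) ∧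
    TendstoInMeasure P
      (fun (n : ℕ) ω => ‖longRunCov P eps phi d
        - lagWindowEstimator w (h n) n (scoreHat n d (fun i => X i ω) (phiHat n ω))‖)
      atTop (fun _ => 0) := by
  obtain rfl : eps = fun i ω => g (past e i ω) := by
    ext1 i; ext1 ω; exact heps i ω
  obtain rfl : X = fun i ω => mean + g (past e i ω) := by
    ext1 i; ext1 ω; exact hX i ω
  have hgm : StronglyMeasurable g := hg.stronglyMeasurable
  have hprob := he.isProbabilityMeasure_pastLaw
  have hp0 : ENNReal.ofReal p ≠ 0 := by
    rw [Ne, ENNReal.ofReal_eq_zero]; linarith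
  have h4p : (4 : ENNReal) ≤ ENNReal.ofReal p := by
    rw [show (4 : ENNReal) = ENNReal.ofReal 4 by simp]
    exact ENNReal.ofReal_le_ofReal hp.le
  have happ : ∑' l : ℕ, eLpNorm (fun ω => g (past e 0 ω) - g (coupledPast e es 0 l ω))
      (ENNReal.ofReal p) P < ⊤ := happrox 0
  -- Finiteness of the l = 0 term of the series is what supplies the moment.
  have hgp : MemLp g (ENNReal.ofReal p) (pastLaw P e) :=
    he.memLp_of_eLpNorm_sub_lt_top hgm hp0 ENNReal.ofReal_ne_top
      ((ENNReal.le_tsum 0).trans_lt happ)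
  have hg4 : MemLp g 4 (pastLaw P e) := hgp.mono_exponent h4p
  have happ4 : ∑' l : ℕ, eLpNorm (fun ω => g (past e 0 ω) - g (coupledPast e es 0 l ω)) 4 P < ⊤ :=
    (ENNReal.tsum_le_tsum fun l => eLpNorm_le_eLpNorm_of_exponent_le h4p
      ((hgm.comp_measurable (he.measurable_past 0)).sub
        (hgm.comp_measurable (he.measurable_coupledPast 0 l))).aestronglyMeasurable).trans_lt happ
  have hg0 : ∫ x, g x ∂(pastLaw P e) = 0 := by
    rw [← he.integral_past hgm 0]; exact hcentered 0
  have hgs := he.isShortRange_of_tsum_eLpNorm hgm hg4 hg0 happ4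
  set C : L2II := ∫ ω, tensorL2 (g (past e 0 ω)) (g (past e 0 ω)) ∂P with hC
  have hCx : C = ∫ x, tensorL2 (g x) (g x) ∂(pastLaw P e) :=
    he.integral_past (F := fun x => tensorL2 (g x) (g x))
      (continuous_tensorL2_self.comp_stronglyMeasurable hgm) 0
  have hZ := he.isShortRange_tensorSquare hgm hg4 happ4 hCx
  have hcov : covKernel P (fun ω => mean + g (past e 0 ω)) = C := by
    have h1 : ∫ ω, mean + g (past e 0 ω) ∂P = mean := by
      rw [integral_add (integrable_const mean)
        ((he.memLp_past hg4 0).integrable (by norm_num)), hcentered 0]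
      simp
    simp only [covKernel, h1, add_sub_cancel_left, hC]
  simp only [hcov] at hphi
  set F : Fin d → (ℕ → S) → ℝ := fun k x =>
    inner ℝ (tensorSquare C g x) (tensorL2 (phi k) (phi k)) with hF
  have hFs : ∀ k, IsShortRange P e (F k) := fun k => hZ.inner_right he _
  have hscore : ∀ (i : ℤ) (k : Fin d),
      score P (fun i ω => g (past e i ω)) phi i k = fun ω => F k (past e i ω) := fun i k => rfl
  have hcov' : ∀ (j j' : Fin d) (i : ℤ), cov[score P (fun i ω => g (past e i ω)) phi 0 j,
      score P (fun i ω => g (past e i ω)) phi i j'; P] = lagCov P e (F j) (F j') i := by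
    intro j j' i
    rw [hscore, hscore, covariance, he.integral_past (hFs j).stronglyMeasurable,
      he.integral_past (hFs j').stronglyMeasurable, (hFs j).integral_eq_zero,
      (hFs j').integral_eq_zero]
    simp only [sub_zero, lagCov]
  refine ⟨fun j j' => ?_, ?_⟩
  · simp only [hcov']
    exact he.summable_lagCov (hFs j) (hFs j')
  -- The Frobenius norm is dominated by the sum of the finitely many absolute entries, each of which
  -- is negligible.
  have hneg : NegligibleInProb P fun (n : ℕ) ω => ‖longRunCov P (fun i ω => g (past e i ω)) phi d
      - lagWindowEstimator w (h n) n
        (scoreHat n d (fun i => mean + g (past e i ω)) (phiHat n ω))‖ := by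
    refine (NegligibleInProb.sum (Finset.univ : Finset (Fin d × Fin d)) fun k _ =>
      he.negligibleInProb_entry hgs hZ mean hphi hgap hphiHat hw hpos hh k.1 k.2).mono
      (Eventually.of_forall fun n ω => ?_)
    refine (frobenius_norm_le_sum _).trans (le_of_eq (Finset.sum_congr rfl fun k _ => ?_))
    rw [Matrix.sub_apply, longRunCov, Matrix.of_apply]
    simp only [hcov']
    rfl
  rw [tendstoInMeasure_iff_norm]
  intro ε hε
  simpa only [sub_zero, norm_norm] using hneg ε hε
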